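/- Conventions. A *dual operator system* is a complex linear space $M\subseteq\mathcal B(H)$ of bounded operators on a complex Hilbert space that contains the identity $\mathbf 1$, is self-adjoint ($M^*=M$) and is closed in the weak$^*$ (ultraweak) topology; $M_*$ is the space of weak$^*$-continuous linear functionals on $M$, and $M^{\rm sa}$ is the real Banach space of self-adjoint elements of $M$. A *JW$^*$-algebra* is a dual operator system that is closed under the Jordan product $x\circ y=\frac12(xy+yx)$. A *Jordan isomorphism* of JW$^*$-algebras is a linear bijection that preserves the Jordan product and the adjoint; a *Jordan automorphism* is a Jordan isomorphism of a JW$^*$-algebra onto itself. A *UP map* is a unit-preserving, positive, weak$^*$-continuous linear map between dual operator systems; a *UP isomorphism* (UP automorphism) is a linear bijection (of a dual operator system onto itself) such that it and its inverse are UP maps. An *asymptotic lift* of a UP map $\phi:M\to M$ is a triple $(N,\alpha,E)$ consisting of a dual operator system $N$, a UP automorphism $\alpha:N\to N$ and a UP map $E:N\to M$ such that - $E\circ\alpha=\phi\circ E$; - if $y\in N$ and $E(\alpha^{-n}(y))=0$ for all $n=0,1,2,\dots$, then $y=0$; - $\|\rho\circ E\restriction_{N^{\rm sa}}\|=\lim_{k\to\infty}\|\rho\circ\phi^k\restriction_{M^{\rm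 sa}}\|$ for every $\rho\in M_*$. **Theorem.** Let $\phi:M\to M$ be a UP map on a von Neumann algebra $M\subseteq\mathcal B(H)$, and let $(N,\alpha,E)$ be an asymptotic lift of $\phi$. Then there are a JW$^*$-algebra $A$ and a UP isomorphism (in particular, a unital order isomorphism) $\theta:N\to A$ such that $\theta\circ\alpha\circ\theta^{-1}$ is a Jordan automorphism of $A$. Moreover, $A$ is unique in the following sense: if $B$ is a JW$^*$-algebra and $\theta':N\to B$ is any unital linear order isomorphism (weak$^*$-continuous or not), then $\theta'\circ\theta^{-1}:A\to B$ is a Jordan isomorphism. -/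

import Mathlib

open Filter Topology
open scoped ENNReal

universe u v w

noncomputable section

section Ultraweak

variable (H : Type u) [NormedAddCommGroup H] [InnerProductSpace ℂ H] [CompleteSpace H]

/-- The weak-star (ultraweak, `σ`-weak) topology of `B(H)`: the coarsest topology for which all
functionals `x ↦ ∑ₙ ⟪ξₙ, x ηₙ⟫`, with `(ξₙ)` and `(ηₙ)` square-summable sequences in `H`, are
continuous. -/
@[reducible] def ultraweakTopology : TopologicalSpace (H →L[ℂ] H) :=
  ⨅ p : lp (fun _ : ℕ => H) 2 × lp (fun _ : ℕ => H) 2,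
    TopologicalSpace.induced (fun x : H →L[ℂ] H => ∑' n : ℕ, inner ℂ (p.1 n) (x (p.2 n)))
      inferInstance

/-- A dual operator system: a weak-star closed self-adjoint linear space of operators on `H` that
contains the identity. -/
structure DualOperatorSystem extends Submodule ℂ (H →L[ℂ] H) where
  one_mem' : (1 : H →L[ℂ] H) ∈ carrier
  star_mem' : ∀ x ∈ carrier, star x ∈ carrier
  isClosed' : IsClosed[ultraweakTopology H] carrier

/-- A JW*-algebra: a dual operator system that is closed under the Jordan product
`x ∘ y = (xy + yx) / 2`. -/
structure JWStarAlgebra extends DualOperatorSystem H where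
  jordan_mem' : ∀ x ∈ carrier, ∀ y ∈ carrier, (2⁻¹ : ℂ) • (x * y + y * x) ∈ carrier

instance : CoeSort (DualOperatorSystem H) (Type u) := ⟨fun M => M.toSubmodule⟩

instance : CoeSort (JWStarAlgebra H) (Type u) := ⟨fun A => A.toSubmodule⟩

end Ultraweak

section Basics

variable {H : Type u} [NormedAddCommGroup H] [InnerProductSpace ℂ H] [CompleteSpace H]

lemma continuous_ultraweak_inner (ξ η : H) :
    Continuous[ultraweakTopology H, inferInstance] (fun x : H →L[ℂ] H => inner ℂ ξ (x η)) := by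
  have h : Continuous[ultraweakTopology H, inferInstance] (fun x : H →L[ℂ] H =>
      ∑' n : ℕ, inner ℂ ((lp.single 2 0 ξ : lp (fun _ : ℕ => H) 2) n)
        (x ((lp.single 2 0 η : lp (fun _ : ℕ => H) 2) n))) :=
    continuous_iInf_dom (i := ((lp.single 2 0 ξ : lp (fun _ : ℕ => H) 2),
      (lp.single 2 0 η : lp (fun _ : ℕ => H) 2))) continuous_induced_dom
  have h2 : (fun x : H →L[ℂ] H => inner ℂ ξ (x η)) = (fun x : H →L[ℂ] H =>
      ∑' n : ℕ, inner ℂ ((lp.single 2 0 ξ : lp (fun _ : ℕ => H) 2) n)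
        (x ((lp.single 2 0 η : lp (fun _ : ℕ => H) 2) n))) := by
    funext x
    rw [tsum_eq_single 0]
    · simp
    · intro n hn
      simp [hn]
  rw [h2]
  exact h

/-- A von Neumann algebra, regarded as a dual operator system. -/
def VonNeumannAlgebra.toDualOperatorSystem (M : VonNeumannAlgebra H) : DualOperatorSystem H where
  toSubmodule := M.toStarSubalgebra.toSubalgebra.toSubmodule
  one_mem' := one_mem M
  star_mem' := fun _ hx => star_mem (S := VonNeumannAlgebra H) (s := M) hx
  isClosed' := by
    have hM : (M.toStarSubalgebra.toSubalgebra.toSubmodule.carrier : Set (H →L[ℂ] H)) =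
        ⋂ (g : H →L[ℂ] H) (_ : g ∈ M.commutant) (ξ : H) (η : H),
          {x : H →L[ℂ] H | inner ℂ ξ (x (g η)) =
            inner ℂ (ContinuousLinearMap.adjoint g ξ) (x η)} := by
      ext x
      have h1 : x ∈ M.toStarSubalgebra.toSubalgebra.toSubmodule.carrier ↔
          x ∈ M.commutant.commutant := by
        rw [VonNeumannAlgebra.commutant_commutant]; rfl
      rw [h1, VonNeumannAlgebra.mem_commutant_iff]
      simp only [Set.mem_iInter, Set.mem_ofPred_eq, ContinuousLinearMap.adjoint_inner_left]
      refine forall₂_congr fun g _ => ?_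
      constructor
      · intro h ξ η
        have h2 : g (x η) = x (g η) := congrArg (fun T : H →L[ℂ] H => T η) h
        rw [h2]
      · intro h
        ext η
        exact (ext_inner_left ℂ fun ξ => h ξ η).symm
    rw [hM]
    let _ := ultraweakTopology H
    refine isClosed_iInter fun g => isClosed_iInter fun _ => isClosed_iInter fun ξ =>
      isClosed_iInter fun η => isClosed_eq (continuous_ultraweak_inner _ _)
        (continuous_ultraweak_inner _ _)

/-- The weak-star topology of a dual operator system `M ⊆ B(H)`: the relative weak-star topology
of `B(H)`. -/
@[reducible] def DualOperatorSystem.weakStar (M : DualOperatorSystem H) : TopologicalSpace M :=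
  (ultraweakTopology H).induced Subtype.val

/-- The identity operator as an element of a dual operator system. -/
def DualOperatorSystem.unit (M : DualOperatorSystem H) : M := ⟨1, M.one_mem'⟩

/-- The adjoint as an operation on a dual operator system. -/
def DualOperatorSystem.adj (M : DualOperatorSystem H) (x : M) : M :=
  ⟨star (x : H →L[ℂ] H), M.star_mem' x x.2⟩

/-- The predual `M_*`: membership of a linear functional in it means weak-star continuity. -/
def DualOperatorSystem.IsNormalFunctional (M : DualOperatorSystem H) (ρ : M →ₗ[ℂ] ℂ) : Prop :=
  Continuous[M.weakStar, inferInstance] ρ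

/-- The norm `‖f↾M^sa‖` of the restriction of a linear functional `f` on `M` to the real Banach
space of self-adjoint elements of `M`, with value `∞` if the restriction is unbounded. -/
def DualOperatorSystem.saNorm (M : DualOperatorSystem H) (f : M →ₗ[ℂ] ℂ) : ℝ≥0∞ :=
  ⨆ x : {x : M // IsSelfAdjoint (x : H →L[ℂ] H) ∧ ‖(x : H →L[ℂ] H)‖ ≤ 1}, ‖f x.1‖ₑ

/-- The Jordan product `x ∘ y = (xy + yx) / 2` of a JW*-algebra. -/
def JWStarAlgebra.jordan (A : JWStarAlgebra H) (x y : A) : A :=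
  ⟨(2⁻¹ : ℂ) • ((x : H →L[ℂ] H) * (y : H →L[ℂ] H) + (y : H →L[ℂ] H) * (x : H →L[ℂ] H)),
    A.jordan_mem' x x.2 y y.2⟩

end Basics

section Maps

variable {H : Type u} [NormedAddCommGroup H] [InnerProductSpace ℂ H] [CompleteSpace H]
variable {K : Type v} [NormedAddCommGroup K] [InnerProductSpace ℂ K] [CompleteSpace K]

/-- A UP map of dual operator systems: a unit-preserving, positive, normal (weak-star continuous)
linear map. -/
structure IsUPMap {M : DualOperatorSystem H} {N : DualOperatorSystem K} (f : M →ₗ[ℂ] N) :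
    Prop where
  map_unit : f M.unit = N.unit
  map_nonneg : ∀ x : M, 0 ≤ (x : H →L[ℂ] H) → 0 ≤ (f x : K →L[ℂ] K)
  normal : Continuous[M.weakStar, N.weakStar] f

/-- An isomorphism in the category of dual operator systems and UP maps, that is, a unital order
isomorphism which is weak-star bicontinuous. -/
structure IsUPIso {M : DualOperatorSystem H} {N : DualOperatorSystem K} (f : M ≃ₗ[ℂ] N) :
    Prop where
  isUPMap : IsUPMap (f : M →ₗ[ℂ] N)
  isUPMap_symm : IsUPMap (f.symm : N →ₗ[ℂ] M)

/-- A unital linear order isomorphism of dual operator systems (no continuity is required). -/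
structure IsUnitalOrderIso {M : DualOperatorSystem H} {N : DualOperatorSystem K}
    (f : M ≃ₗ[ℂ] N) : Prop where
  map_unit : f M.unit = N.unit
  nonneg_iff : ∀ x : M, 0 ≤ (f x : K →L[ℂ] K) ↔ 0 ≤ (x : H →L[ℂ] H)

/-- A linear bijection of JW*-algebras is a Jordan isomorphism if it preserves the Jordan product
and the adjoint. -/
structure IsJordanIso {A : JWStarAlgebra H} {B : JWStarAlgebra K} (f : A ≃ₗ[ℂ] B) : Prop where
  map_jordan : ∀ x y : A, f (A.jordan x y) = B.jordan (f x) (f y)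
  map_adj : ∀ x : A, f (A.adj x) = B.adj (f x)

/-- `(N, α, E)` is a reversible lift of the UP map `φ : M → M`: `α` is a UP automorphism of the
dual operator system `N`, and `E : N → M` is a UP map with `E ∘ α = φ ∘ E`. -/
structure IsReversibleLift {M : DualOperatorSystem H} {N : DualOperatorSystem K}
    (φ : M →ₗ[ℂ] M) (α : N ≃ₗ[ℂ] N) (E : N →ₗ[ℂ] M) : Prop where
  isUPIso : IsUPIso α
  isUPMap : IsUPMap E
  equivariant : ∀ y : N, E (α y) = φ (E y)

/-- `(N, α, E)` is an asymptotic lift of the UP map `φ : M → M`: a nondegenerate reversible lift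
with `‖ρ ∘ E↾N^sa‖ = lim ‖ρ ∘ φ^k↾M^sa‖` for every `ρ ∈ M_*`. -/
structure IsAsymptoticLift {M : DualOperatorSystem H} {N : DualOperatorSystem K}
    (φ : M →ₗ[ℂ] M) (α : N ≃ₗ[ℂ] N) (E : N →ₗ[ℂ] M) : Prop
    extends IsReversibleLift φ α E where
  nondegenerate : ∀ y : N, (∀ n : ℕ, E ((α.symm)^[n] y) = 0) → y = 0
  tendsto_saNorm : ∀ ρ : M →ₗ[ℂ] ℂ, M.IsNormalFunctional ρ →
    Tendsto (fun k : ℕ => M.saNorm (ρ ∘ₗ (φ ^ k))) atTop (𝓝 (N.saNorm (ρ ∘ₗ E)))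

end Maps

end

/-! The lift is recovered from the bounded inverse sequences of `φ`, that is, the bounded sequences
in `M` with `φ (x (k + 1)) = x k`. The map `y ↦ (E (α⁻ᵏ y))ₖ` takes `N` into them and is injective
by nondegeneracy. It is also onto and preserves norms of self-adjoint elements. Indeed, if `x` is a
self-adjoint inverse sequence in the unit ball, then `x k = φʲ (x (k + j))` gives `|ρ (x k)| ≤ ‖ρ ∘
φʲ‖` for every `j`, so `|ρ (x k)| ≤ ‖ρ ∘ E‖` by the limit axiom. Hahn-Banach
(`exists_mem_saBall_of_le_saNorm`) then puts `x k` in the image under `E` of the unit ball, and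
compactness glues the preimages together. Norms determine the order, so `N` is order isomorphic to
the space of inverse sequences.

That space is the range of a positive unital idempotent `P` on the bounded sequences in `M`, where
`(P x)ₘ` is the limit of `φᵏ⁻ᵐ (xₖ)` along a free ultrafilter (`exists_isLimitProjection`). By the
argument of Effros and Størmer, the range of such a projection is a Jordan algebra for `P (xy + yx)
/ 2`. To realize it concretely, the star-algebra generated by the self-adjoint fixed points is
represented by the GNS construction for the functionals `x ↦ ⟪h, (P x)ₘ h⟫`. Kadison's inequality
makes the defects `P (s²) - s²` positive, and `map_star_mul_defect_mul_eq_zero` shows that the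
representation annihilates them. It therefore carries the Jordan product of the fixed points to that
of operators (`exists_isJordanRep`).

The range must be weak-star closed and the isomorphism bicontinuous, although `P` comes from an
ultrafilter and need not be normal. The substitute is `wtendsto_jordan_zero`: Jordan multiplication
by a fixed point is weakly continuous on bounded sets of fixed points, because Cauchy-Schwarz
controls the defect uniformly. Compressions by words inherit this continuity, and then so does the
representation. Krein-Smulian (`isClosed_ultraweak_of_bounded`) passes from balls to the whole
space.

Uniqueness of `A` and the claim about `α` are both cases of `IsUnitalOrderIso.isJordanIso`:
Kadison's inequality for an order isomorphism and for its inverse forces it to preserve squares. -/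

noncomputable section

set_option linter.unusedSectionVars false

/-! ### Weak operator limits of families of operators -/

section WeakLimits

open scoped ComplexOrder

variable {H : Type u} [NormedAddCommGroup H] [InnerProductSpace ℂ H] [CompleteSpace H]
variable {ι : Type*} {l : Filter ι}

/-- Convergence in the weak operator topology, expressed through matrix coefficients. -/
def WTendsto (l : Filter ι) (x : ι → H →L[ℂ] H) (a : H →L[ℂ] H) : Prop :=
  ∀ ξ η : H, Tendsto (fun i => inner ℂ ξ (x i η)) l (𝓝 (inner ℂ ξ (a η)))

lemma WTendsto.unique [l.NeBot] {x : ι → H →L[ℂ] H} {a b : H →L[ℂ] H}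
    (ha : WTendsto l x a) (hb : WTendsto l x b) : a = b := by
  ext η
  exact ext_inner_left ℂ fun ξ => tendsto_nhds_unique (ha ξ η) (hb ξ η)

lemma WTendsto.add {x y : ι → H →L[ℂ] H} {a b : H →L[ℂ] H}
    (ha : WTendsto l x a) (hb : WTendsto l y b) :
    WTendsto l (fun i => x i + y i) (a + b) := fun ξ η => by
  simpa [inner_add_right] using (ha ξ η).add (hb ξ η)

lemma WTendsto.smul {x : ι → H →L[ℂ] H} {a : H →L[ℂ] H} (c : ℂ)
    (ha : WTendsto l x a) : WTendsto l (fun i => c • x i) (c • a) := fun ξ η => by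
  simpa [inner_smul_right] using (ha ξ η).const_mul c

lemma WTendsto.sub {x y : ι → H →L[ℂ] H} {a b : H →L[ℂ] H}
    (ha : WTendsto l x a) (hb : WTendsto l y b) :
    WTendsto l (fun i => x i - y i) (a - b) := fun ξ η => by
  simpa [inner_sub_right] using (ha ξ η).sub (hb ξ η)

lemma WTendsto.star {x : ι → H →L[ℂ] H} {a : H →L[ℂ] H}
    (ha : WTendsto l x a) : WTendsto l (fun i => star (x i)) (star a) := fun ξ η => by
  have := (continuous_star.tendsto _).comp (ha η ξ)
  simpa [ContinuousLinearMap.star_eq_adjoint, ContinuousLinearMap.adjoint_inner_right,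
    Function.comp_def] using this

lemma WTendsto.congr' {x y : ι → H →L[ℂ] H} {a : H →L[ℂ] H} (h : x =ᶠ[l] y)
    (ha : WTendsto l x a) : WTendsto l y a := fun ξ η =>
  (ha ξ η).congr' (h.mono fun i hi => by simp [hi])

lemma WTendsto.const (a : H →L[ℂ] H) : WTendsto l (fun _ => a) a := fun _ _ => tendsto_const_nhds

lemma wtendsto_map {κ : Type*} {f : ι → κ} {x : κ → H →L[ℂ] H} {a : H →L[ℂ] H} :
    WTendsto (l.map f) x a ↔ WTendsto l (fun i => x (f i)) a :=
  forall₂_congr fun _ _ => tendsto_map'_iff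

lemma ContinuousLinearMap.opNorm_le_of_inner_le {a : H →L[ℂ] H} {C : ℝ} (hC : 0 ≤ C)
    (h : ∀ ξ η : H, ‖inner ℂ ξ (a η)‖ ≤ C * ‖ξ‖ * ‖η‖) : ‖a‖ ≤ C := by
  refine a.opNorm_le_bound hC fun η => ?_
  have h1 := h (a η) η
  rw [inner_self_eq_norm_sq_to_K] at h1
  rcases eq_or_ne (‖a η‖) 0 with h0 | h0
  · rw [h0]; positivity
  · have h2 : ‖a η‖ * ‖a η‖ ≤ ‖a η‖ * (C * ‖η‖) := by
      simp only [norm_pow, RCLike.norm_ofReal, abs_norm] at h1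
      nlinarith
    exact le_of_mul_le_mul_left h2 (lt_of_le_of_ne (norm_nonneg _) (Ne.symm h0))

lemma norm_inner_apply_le (a : H →L[ℂ] H) (ξ η : H) :
    ‖inner ℂ ξ (a η)‖ ≤ ‖a‖ * ‖ξ‖ * ‖η‖ := by
  calc _ ≤ ‖ξ‖ * ‖a η‖ := norm_inner_le_norm _ _
    _ ≤ ‖ξ‖ * (‖a‖ * ‖η‖) := by gcongr; exact a.le_opNorm η
    _ = _ := by ring

lemma WTendsto.norm_le [l.NeBot] {x : ι → H →L[ℂ] H} {a : H →L[ℂ] H} {C : ℝ}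
    (ha : WTendsto l x a) (hx : ∀ᶠ i in l, ‖x i‖ ≤ C) : ‖a‖ ≤ C := by
  have hC : 0 ≤ C := by
    obtain ⟨i, hi⟩ := hx.exists
    exact (norm_nonneg _).trans hi
  refine ContinuousLinearMap.opNorm_le_of_inner_le hC fun ξ η => ?_
  refine le_of_tendsto (ha ξ η).norm (hx.mono fun i hi => ?_)
  refine (norm_inner_apply_le _ _ _).trans ?_
  gcongr

lemma ContinuousLinearMap.nonneg_iff_inner {a : H →L[ℂ] H} :
    0 ≤ a ↔ ∀ ξ : H, 0 ≤ (inner ℂ ξ (a ξ) : ℂ) := by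
  rw [ContinuousLinearMap.nonneg_iff_isPositive, ContinuousLinearMap.isPositive_iff_complex]
  refine forall_congr' fun ξ => ?_
  rw [← inner_conj_symm ξ (a ξ), Complex.le_def]
  generalize inner ℂ (a ξ) ξ = z
  simp only [Complex.ext_iff]
  simp [and_comm]
  exact fun _ => eq_comm

lemma WTendsto.nonneg [l.NeBot] {x : ι → H →L[ℂ] H} {a : H →L[ℂ] H}
    (ha : WTendsto l x a) (hx : ∀ᶠ i in l, 0 ≤ x i) : 0 ≤ a := by
  rw [ContinuousLinearMap.nonneg_iff_inner]
  intro ξ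
  exact ge_of_tendsto (ha ξ ξ) (hx.mono fun i hi =>
    ContinuousLinearMap.nonneg_iff_inner.1 hi ξ)

/-- Polarization reduces matrix coefficients to diagonal ones. -/
lemma wtendsto_of_diag {x : ι → H →L[ℂ] H} {a : H →L[ℂ] H}
    (h : ∀ ξ : H, Tendsto (fun i => inner ℂ ξ (x i ξ)) l (𝓝 (inner ℂ ξ (a ξ)))) :
    WTendsto l x a := fun ξ η => by
  have key : ∀ T : H →L[ℂ] H, inner ℂ ξ (T η) =
      (inner ℂ (ξ + η) (T (ξ + η)) - inner ℂ (ξ - η) (T (ξ - η)) -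
        Complex.I * inner ℂ (ξ + Complex.I • η) (T (ξ + Complex.I • η)) +
        Complex.I * inner ℂ (ξ - Complex.I • η) (T (ξ - Complex.I • η))) / 4 := by
    intro T
    simp only [map_add, map_sub, map_smul, inner_add_left, inner_add_right, inner_sub_left,
      inner_sub_right, inner_smul_left, inner_smul_right, Complex.conj_I]
    ring_nf
    simp
    ring
  simp only [key]
  exact ((((h _).sub (h _)).sub ((h _).const_mul _)).add ((h _).const_mul _)).div_const _

/-- Compactness of balls: each matrix coefficient stays in a closed disc and so converges along the
ultrafilter. The limits form a bounded sesquilinear form, which is given by an operator. -/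
lemma exists_wtendsto (𝒰 : Ultrafilter ι) {x : ι → H →L[ℂ] H} {C : ℝ}
    (hx : ∀ᶠ i in 𝒰, ‖x i‖ ≤ C) : ∃ a, WTendsto 𝒰 x a ∧ ‖a‖ ≤ C := by
  have hb : ∀ ξ η : H, ∀ᶠ i in 𝒰, ‖inner ℂ (x i ξ) η‖ ≤ C * ‖ξ‖ * ‖η‖ := fun ξ η =>
    hx.mono fun i hi => by
      rw [norm_inner_symm]
      refine (norm_inner_apply_le _ _ _).trans ?_
      rw [mul_right_comm]
      gcongr
  have hlim : ∀ ξ η : H, ∃ c : ℂ, Tendsto (fun i => inner ℂ (x i ξ) η) 𝒰 (𝓝 c) ∧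
      ‖c‖ ≤ C * ‖ξ‖ * ‖η‖ := by
    intro ξ η
    obtain ⟨c, hc, hc'⟩ := (isCompact_closedBall (0 : ℂ) (C * ‖ξ‖ * ‖η‖)).ultrafilter_le_nhds'
      (𝒰.map fun i => inner ℂ (x i ξ) η)
      (Ultrafilter.mem_map.2 ((hb ξ η).mono fun i hi => by simpa using hi))
    exact ⟨c, hc', by simpa using hc⟩
  choose c hc hcn using hlim
  let B : H →ₗ⋆[ℂ] H →ₗ[ℂ] ℂ := LinearMap.mk₂'ₛₗ (starRingEnd ℂ) (RingHom.id ℂ) c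
    (fun a b d => tendsto_nhds_unique (hc _ _) (by
      simpa [inner_add_left] using (hc a d).add (hc b d)))
    (fun r a b => tendsto_nhds_unique (hc _ _) (by
      simpa [inner_smul_left, mul_comm] using (hc a b).const_mul (starRingEnd ℂ r)))
    (fun a b d => tendsto_nhds_unique (hc _ _) (by
      simpa [inner_add_right] using (hc a b).add (hc a d)))
    (fun r a b => tendsto_nhds_unique (hc _ _) (by
      simpa [inner_smul_right] using (hc a b).const_mul r))
  let B' : H →L⋆[ℂ] H →L[ℂ] ℂ := LinearMap.mkContinuous₂ B C hcn
  refine ⟨InnerProductSpace.continuousLinearMapOfBilin B', ?_⟩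
  have hw : WTendsto 𝒰 x (InnerProductSpace.continuousLinearMapOfBilin B') := by
    intro ξ η
    have h1 := (continuous_star.tendsto _).comp (hc η ξ)
    have h2 : inner ℂ ξ (InnerProductSpace.continuousLinearMapOfBilin B' η) = star (c η ξ) := by
      rw [← inner_conj_symm, InnerProductSpace.continuousLinearMapOfBilin_apply]
      rfl
    rw [h2]
    simpa [Function.comp_def] using h1
  exact ⟨hw, hw.norm_le hx⟩

end WeakLimits

/-! ### The ultraweak topology as a locally convex topology -/

section UltraweakSpace

variable {H : Type u} [NormedAddCommGroup H] [InnerProductSpace ℂ H] [CompleteSpace H]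

lemma summable_norm_mul_norm_of_lp (p : lp (fun _ : ℕ => H) 2 × lp (fun _ : ℕ => H) 2) :
    Summable fun n => ‖p.1 n‖ * ‖p.2 n‖ := by
  have h1 : Summable fun n => ‖p.1 n‖ ^ (2 : ℝ) := by
    simpa using (lp.memℓp p.1).summable (by norm_num)
  have h2 : Summable fun n => ‖p.2 n‖ ^ (2 : ℝ) := by
    simpa using (lp.memℓp p.2).summable (by norm_num)
  refine Summable.of_nonneg_of_le (fun n => by positivity) (fun n => ?_) (h1.add h2)
  simp only [Real.rpow_two]
  nlinarith [sq_nonneg (‖p.1 n‖ - ‖p.2 n‖), sq_nonneg (‖p.1 n‖ + ‖p.2 n‖)]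

lemma summable_inner_apply (p : lp (fun _ : ℕ => H) 2 × lp (fun _ : ℕ => H) 2)
    (x : H →L[ℂ] H) : Summable fun n => (inner ℂ (p.1 n) (x (p.2 n)) : ℂ) := by
  refine Summable.of_norm_bounded ((summable_norm_mul_norm_of_lp p).mul_left ‖x‖) fun n => ?_
  rw [← mul_assoc]
  exact norm_inner_apply_le _ _ _

/-- The functional `x ↦ ∑ₙ ⟪ξₙ, x ηₙ⟫`. -/
def ultraweakFunctional (p : lp (fun _ : ℕ => H) 2 × lp (fun _ : ℕ => H) 2) :
    (H →L[ℂ] H) →ₗ[ℂ] ℂ where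
  toFun x := ∑' n : ℕ, inner ℂ (p.1 n) (x (p.2 n))
  map_add' x y := by
    rw [← (summable_inner_apply p x).tsum_add (summable_inner_apply p y)]
    simp
  map_smul' c x := by
    simp [tsum_mul_left]

/-- On bounded sets the weak operator topology already controls the ultraweak one, by dominated
convergence of the defining series. -/
lemma tendsto_ultraweak_of_bounded {ι : Type*} {l : Filter ι} {x : ι → H →L[ℂ] H}
    {a : H →L[ℂ] H} {C : ℝ} (hx : ∀ᶠ i in l, ‖x i‖ ≤ C) (h : WTendsto l x a) :
    Tendsto x l (@nhds _ (ultraweakTopology H) a) := by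
  simp only [nhds_iInf, nhds_induced, tendsto_iInf, tendsto_comap_iff,
    Function.comp_def]
  intro p
  refine tendsto_tsum_of_dominated_convergence
    ((summable_norm_mul_norm_of_lp p).mul_left C) (fun n => h _ _) ?_
  filter_upwards [hx] with i hi n
  refine (norm_inner_apply_le _ _ _).trans ?_
  rw [← mul_assoc]
  gcongr

lemma wtendsto_of_tendsto_ultraweak {ι : Type*} {l : Filter ι} {x : ι → H →L[ℂ] H}
    {a : H →L[ℂ] H} (h : Tendsto x l (@nhds _ (ultraweakTopology H) a)) : WTendsto l x a := by
  intro ξ η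
  let _ := ultraweakTopology H
  exact ((continuous_ultraweak_inner ξ η).tendsto a).comp h

variable (H) in
/-- The space `B(H)` with its ultraweak topology. -/
def UltraweakSpace : Type u := H →L[ℂ] H

instance : AddCommGroup (UltraweakSpace H) := inferInstanceAs (AddCommGroup (H →L[ℂ] H))
instance : Module ℂ (UltraweakSpace H) := inferInstanceAs (Module ℂ (H →L[ℂ] H))
instance : Module ℝ (UltraweakSpace H) := inferInstanceAs (Module ℝ (H →L[ℂ] H))
instance : IsScalarTower ℝ ℂ (UltraweakSpace H) :=
  inferInstanceAs (IsScalarTower ℝ ℂ (H →L[ℂ] H))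
instance : TopologicalSpace (UltraweakSpace H) := ultraweakTopology H

instance : IsTopologicalAddGroup (UltraweakSpace H) :=
  topologicalAddGroup_iInf fun p =>
    topologicalAddGroup_induced
      (ultraweakFunctional p : (H →L[ℂ] H) →ₗ[ℂ] ℂ)

instance : ContinuousSMul ℂ (UltraweakSpace H) :=
  continuousSMul_iInf fun p =>
    continuousSMul_induced (ultraweakFunctional p : (H →L[ℂ] H) →ₗ[ℂ] ℂ)

instance : LocallyConvexSpace ℝ (UltraweakSpace H) :=
  LocallyConvexSpace.iInf fun p =>
    LocallyConvexSpace.induced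
      ((ultraweakFunctional p : (H →L[ℂ] H) →ₗ[ℂ] ℂ).restrictScalars ℝ)

end UltraweakSpace

/-! ### Null families and the dual of `c₀` -/

section NullSequences

open scoped ZeroAtInfty

variable {ι : Type*} [TopologicalSpace ι] [DiscreteTopology ι]

lemma tendsto_cofinite_zero_iff_cocompact {f : ι → ℂ} :
    Tendsto f (cocompact ι) (𝓝 0) ↔ Tendsto f cofinite (𝓝 0) := by
  rw [cocompact_eq_cofinite]

open Classical in
/-- The null family with a single nonzero entry. -/
def ZeroAtInftyContinuousMap.single (i : ι) (c : ℂ) : C₀(ι, ℂ) where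
  toFun := Pi.single i c
  continuous_toFun := continuous_of_discreteTopology
  zero_at_infty' := by
    rw [tendsto_cofinite_zero_iff_cocompact]
    refine tendsto_nhds_of_eventually_eq ?_
    filter_upwards [(Set.finite_singleton i).compl_mem_cofinite] with j hj
    exact Pi.single_eq_of_ne (M := fun _ => ℂ) hj c

open Classical in
lemma ZeroAtInftyContinuousMap.single_apply (i j : ι) (c : ℂ) :
    ZeroAtInftyContinuousMap.single i c j = if j = i then c else 0 := by
  show (Pi.single i c : ι → ℂ) j = _
  rw [Pi.single_apply]

open Classical in
lemma ZeroAtInftyContinuousMap.sum_single_apply (s : Finset ι) (z : ι → ℂ) (j : ι) :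
    (∑ i ∈ s, ZeroAtInftyContinuousMap.single i (z i)) j = if j ∈ s then z j else 0 := by
  have h : (∑ i ∈ s, ZeroAtInftyContinuousMap.single i (z i)) j =
      ∑ i ∈ s, ZeroAtInftyContinuousMap.single i (z i) j := by
    induction s using Finset.induction_on with
    | empty => simp
    | insert a s ha ih => rw [Finset.sum_insert ha, Finset.sum_insert ha, ← ih]; rfl
  rw [h]
  simp [ZeroAtInftyContinuousMap.single_apply]

lemma ZeroAtInftyContinuousMap.norm_le_of {f : C₀(ι, ℂ)} {C : ℝ} (hC : 0 ≤ C)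
    (h : ∀ i, ‖f i‖ ≤ C) : ‖f‖ ≤ C := by
  rw [← ZeroAtInftyContinuousMap.norm_toBCF_eq_norm]
  exact (BoundedContinuousFunction.norm_le hC).2 h

lemma ZeroAtInftyContinuousMap.hasSum_single (f : C₀(ι, ℂ)) :
    HasSum (fun i => ZeroAtInftyContinuousMap.single i (f i)) f := by
  classical
  rw [HasSum, SummationFilter.unconditional_filter, Metric.tendsto_atTop]
  intro ε hε
  have h0 : Tendsto f cofinite (𝓝 0) := tendsto_cofinite_zero_iff_cocompact.1 f.zero_at_infty'
  have hfin : {i | ¬ ‖f i‖ < ε / 2}.Finite := by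
    have := h0.eventually (Metric.ball_mem_nhds (0 : ℂ) (half_pos hε))
    simpa [Filter.eventually_cofinite] using this
  refine ⟨hfin.toFinset, fun s hs => ?_⟩
  rw [dist_eq_norm]
  refine (ZeroAtInftyContinuousMap.norm_le_of (half_pos hε).le fun i => ?_).trans_lt
    (half_lt_self hε)
  rw [ZeroAtInftyContinuousMap.sub_apply, ZeroAtInftyContinuousMap.sum_single_apply]
  split_ifs with hi
  · simpa using (half_pos hε).le
  · have : ‖f i‖ < ε / 2 := by
      by_contra hcon
      exact hi (hs (hfin.mem_toFinset.2 hcon))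
    simpa using this.le

/-- A continuous functional on the space of null families is given by a summable family. -/
lemma ZeroAtInftyContinuousMap.exists_summable_of_dual (g : C₀(ι, ℂ) →L[ℂ] ℂ) :
    ∃ a : ι → ℂ, Summable (fun i => ‖a i‖) ∧ ∀ f : C₀(ι, ℂ), HasSum (fun i => a i * f i) (g f) := by
  classical
  have hs : ∀ (i : ι) (c : ℂ), ZeroAtInftyContinuousMap.single i c =
      c • ZeroAtInftyContinuousMap.single i (1 : ℂ) := by
    intro i c
    ext j
    simp [ZeroAtInftyContinuousMap.single_apply]
  refine ⟨fun i => g (ZeroAtInftyContinuousMap.single i 1), ?_, fun f => ?_⟩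
  · refine summable_of_sum_le (c := ‖g‖) (fun _ => norm_nonneg _) fun s => ?_
    set a : ι → ℂ := fun i => g (ZeroAtInftyContinuousMap.single i 1) with ha
    -- The phases that make `z i * a i = ‖a i‖`. Where `a i = 0` the quotient is `0`, which does no
    -- harm. Testing `g` on finite sums of these entries bounds the sums of `‖a i‖` by `‖g‖`.
    set z : ι → ℂ := fun i => (starRingEnd ℂ (a i)) / ‖a i‖ with hz
    have hz1 : ∀ i, ‖z i‖ ≤ 1 := fun i => by
      simp only [hz, norm_div, RCLike.norm_conj, Complex.norm_real, norm_norm]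
      exact div_self_le_one _
    have hza : ∀ i, z i * a i = ‖a i‖ := fun i => by
      rcases eq_or_ne (a i) 0 with h0 | h0
      · simp [h0]
      · have : (‖a i‖ : ℂ) ≠ 0 := by simpa using h0
        simp only [hz]
        field_simp
        rw [mul_comm, Complex.mul_conj, Complex.normSq_eq_norm_sq]
        norm_cast
    have h1 : g (∑ i ∈ s, ZeroAtInftyContinuousMap.single i (z i)) =
        ((∑ i ∈ s, ‖a i‖ : ℝ) : ℂ) := by
      rw [map_sum]
      push_cast
      refine Finset.sum_congr rfl fun i _ => ?_
      rw [hs, map_smul, smul_eq_mul, hza]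
    have h2 : ‖∑ i ∈ s, ZeroAtInftyContinuousMap.single i (z i)‖ ≤ 1 :=
      ZeroAtInftyContinuousMap.norm_le_of zero_le_one fun i => by
        rw [ZeroAtInftyContinuousMap.sum_single_apply]
        split_ifs
        · exact hz1 i
        · simp
    have h3 := g.le_opNorm (∑ i ∈ s, ZeroAtInftyContinuousMap.single i (z i))
    rw [h1, Complex.norm_real, Real.norm_of_nonneg (Finset.sum_nonneg fun _ _ => norm_nonneg _)]
      at h3
    exact h3.trans (mul_le_of_le_one_right (norm_nonneg _) h2)
  · have := (ZeroAtInftyContinuousMap.hasSum_single f).mapL g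
    convert this using 2 with i
    rw [hs i (f i), map_smul, smul_eq_mul, mul_comm]

end NullSequences

/-! ### The Krein-Smulian theorem for subspaces of `B(H)` -/

section KreinSmulian

open scoped ZeroAtInfty

variable {H : Type u} [NormedAddCommGroup H] [InnerProductSpace ℂ H] [CompleteSpace H]

lemma isClosed_le_one_ultraweak (p : H × H) :
    IsClosed[ultraweakTopology H] {x : H →L[ℂ] H | ‖(inner ℂ p.1 (x p.2) : ℂ)‖ ≤ 1} := by
  let _ := ultraweakTopology H
  exact isClosed_le (continuous_ultraweak_inner p.1 p.2).norm continuous_const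

/-- One step of the Krein-Smulian construction: a set that is closed on bounded sets and misses
the ball of radius `r`, can be separated from it inside a larger ball by finitely many small
vector functionals. -/
lemma exists_finset_of_disjoint_ball {c : Set (H →L[ℂ] H)} {r R : ℝ} (hr : 0 < r)
    (hc : @IsCompact _ (ultraweakTopology H) (c ∩ {x | ‖x‖ ≤ R}))
    (hd : ∀ x ∈ c, ¬ ‖x‖ ≤ r) :
    ∃ F : Finset (H × H), (∀ p ∈ F, ‖p.1‖ ^ 2 ≤ r⁻¹ ∧ ‖p.2‖ ^ 2 ≤ r⁻¹) ∧
      ∀ x ∈ c, ‖x‖ ≤ R → ∃ p ∈ F, ¬ ‖(inner ℂ p.1 (x p.2) : ℂ)‖ ≤ 1 := by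
  classical
  let _ := ultraweakTopology H
  -- The polar of these vector functionals is the ball of radius `r`, by rescaling `ξ` and `η` to
  -- norm `√(r⁻¹)`. Hence it misses `c`, and compactness leaves finitely many of them.
  let T : Set (H × H) := {p | ‖p.1‖ ^ 2 ≤ r⁻¹ ∧ ‖p.2‖ ^ 2 ≤ r⁻¹}
  obtain ⟨u, hu⟩ := hc.elim_finite_subfamily_closed
    (fun p : T => {x : H →L[ℂ] H | ‖(inner ℂ p.1.1 (x p.1.2) : ℂ)‖ ≤ 1})
    (fun p => isClosed_le_one_ultraweak p.1) (by
      rw [Set.eq_empty_iff_forall_notMem]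
      rintro x ⟨⟨hxc, -⟩, hx⟩
      rw [Set.mem_iInter] at hx
      refine hd x hxc (ContinuousLinearMap.opNorm_le_of_inner_le hr.le fun ξ η => ?_)
      have hs : 0 < √(r⁻¹) := Real.sqrt_pos.2 (inv_pos.2 hr)
      have hss : √(r⁻¹) * √(r⁻¹) = r⁻¹ := Real.mul_self_sqrt (inv_pos.2 hr).le
      rcases eq_or_ne ξ 0 with rfl | hξ
      · simp
      rcases eq_or_ne η 0 with rfl | hη
      · simp
      have hξ' := norm_pos_iff.2 hξ
      have hη' := norm_pos_iff.2 hη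
      have hmem : ∀ ζ : H, ζ ≠ 0 → ‖((√(r⁻¹) / ‖ζ‖ : ℝ) : ℂ) • ζ‖ ^ 2 ≤ r⁻¹ := by
        intro ζ hζ
        have : ‖ζ‖ ≠ 0 := norm_ne_zero_iff.2 hζ
        rw [norm_smul, Complex.norm_real, norm_div, norm_norm, div_mul_cancel₀ _ this,
          Real.norm_of_nonneg hs.le, sq, hss]
      have := hx ⟨(((√(r⁻¹) / ‖ξ‖ : ℝ) : ℂ) • ξ, ((√(r⁻¹) / ‖η‖ : ℝ) : ℂ) • η),
        hmem ξ hξ, hmem η hη⟩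
      simp only [Set.mem_ofPred_eq, map_smul, inner_smul_left, inner_smul_right, norm_mul,
        Complex.conj_ofReal, Complex.norm_real, norm_div, norm_norm,
        Real.norm_of_nonneg hs.le] at this
      have h2 : √r⁻¹ / ‖η‖ * (√r⁻¹ / ‖ξ‖ * ‖(inner ℂ ξ (x η) : ℂ)‖) =
          ‖(inner ℂ ξ (x η) : ℂ)‖ / (r * ‖ξ‖ * ‖η‖) := by
        calc _ = (√r⁻¹ * √r⁻¹) * ‖(inner ℂ ξ (x η) : ℂ)‖ / (‖ξ‖ * ‖η‖) := by
              field_simp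
          _ = _ := by rw [hss]; field_simp
      rw [h2, div_le_one (by positivity)] at this
      exact this)
  refine ⟨u.image Subtype.val, ?_, ?_⟩
  · intro p hp
    obtain ⟨q, -, rfl⟩ := Finset.mem_image.1 hp
    exact q.2
  · intro x hxc hxR
    by_contra! hcon
    have : x ∈ c ∩ {x | ‖x‖ ≤ R} ∩ ⋂ i ∈ u, {x : H →L[ℂ] H | ‖(inner ℂ i.1.1 (x i.1.2) : ℂ)‖ ≤ 1} := by
      refine ⟨⟨hxc, hxR⟩, ?_⟩
      simp only [Set.mem_iInter]
      exact fun p hp => hcon p.1 (Finset.mem_image_of_mem _ hp)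
    rw [hu] at this
    exact this

/-- A set that is ultraweakly compact on balls and misses the unit ball is separated from zero by
a null sequence of vector functionals. -/
lemma exists_null_sequence_of_disjoint_ball {c : Set (H →L[ℂ] H)}
    (hc : ∀ R : ℝ, @IsCompact _ (ultraweakTopology H) (c ∩ {x | ‖x‖ ≤ R}))
    (hd : ∀ x ∈ c, ¬ ‖x‖ ≤ 1) :
    ∃ q : ℕ → H × H, Tendsto (fun k => ‖(q k).1‖ ^ 2) cofinite (𝓝 0) ∧
      Tendsto (fun k => ‖(q k).2‖ ^ 2) cofinite (𝓝 0) ∧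
      ∀ x ∈ c, ∃ k, 1 < ‖(inner ℂ (q k).1 (x (q k).2) : ℂ)‖ := by
  classical
  -- Invariant of the induction: the functionals in `G` detect every point of `c` in the ball of
  -- radius `n + 1`. For `n = 0` the empty set will do, since `c` misses the unit ball.
  let I : ℕ → Finset (H × H) → Prop := fun n G =>
    ∀ x ∈ c, ‖x‖ ≤ (n + 1 : ℝ) → ∃ p ∈ G, ¬ ‖(inner ℂ p.1 (x p.2) : ℂ)‖ ≤ 1
  have step : ∀ (n : ℕ) (G : {G // I n G}), ∃ F : Finset (H × H),
      (∀ p ∈ F, ‖p.1‖ ^ 2 ≤ (n + 1 : ℝ)⁻¹ ∧ ‖p.2‖ ^ 2 ≤ (n + 1 : ℝ)⁻¹) ∧ I (n + 1) (G.1 ∪ F) := by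
    rintro n ⟨G, hG⟩
    -- The points not yet detected. They lie outside the ball of radius `n + 1`, so functionals of
    -- size at most `1 / (n + 1)` suffice to detect those in the next ball.
    let c' := c ∩ {x | ∀ p ∈ G, ‖(inner ℂ p.1 (x p.2) : ℂ)‖ ≤ 1}
    have hcl : IsClosed[ultraweakTopology H]
        {x : H →L[ℂ] H | ∀ p ∈ G, ‖(inner ℂ p.1 (x p.2) : ℂ)‖ ≤ 1} := by
      have : {x : H →L[ℂ] H | ∀ p ∈ G, ‖(inner ℂ p.1 (x p.2) : ℂ)‖ ≤ 1} =
          ⋂ p ∈ G, {x : H →L[ℂ] H | ‖(inner ℂ p.1 (x p.2) : ℂ)‖ ≤ 1} := by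
        ext; simp
      rw [this]
      let _ := ultraweakTopology H
      exact isClosed_biInter fun p _ => isClosed_le_one_ultraweak p
    obtain ⟨F, hF, hF'⟩ := exists_finset_of_disjoint_ball (c := c') (r := n + 1)
      (R := (n + 1 : ℕ) + 1) (by positivity) (by
        have : c' ∩ {x | ‖x‖ ≤ ((n + 1 : ℕ) + 1 : ℝ)} = (c ∩ {x | ‖x‖ ≤ ((n + 1 : ℕ) + 1 : ℝ)}) ∩
            {x | ∀ p ∈ G, ‖(inner ℂ p.1 (x p.2) : ℂ)‖ ≤ 1} := by
          ext; simp only [c', Set.mem_inter_iff]; tauto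
        rw [this]
        let _ := ultraweakTopology H
        exact (hc _).inter_right hcl) (by
        rintro x ⟨hx, hx'⟩ hxn
        obtain ⟨p, hp, hp'⟩ := hG x hx hxn
        exact hp' (hx' p hp))
    refine ⟨F, hF, fun x hx hxn => ?_⟩
    by_cases h : ∀ p ∈ G, ‖(inner ℂ p.1 (x p.2) : ℂ)‖ ≤ 1
    · obtain ⟨p, hp, hp'⟩ := hF' x ⟨hx, h⟩ hxn
      exact ⟨p, Finset.mem_union_right _ hp, hp'⟩
    · push Not at h
      obtain ⟨p, hp, hp'⟩ := h
      exact ⟨p, Finset.mem_union_left _ hp, not_le.2 hp'⟩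
  choose F hF hI using step
  let g : ∀ n, {G // I n G} := fun n => Nat.rec
    ⟨∅, fun x hx hx' => absurd (by simpa using hx') (hd x hx)⟩
    (fun n G => ⟨G.1 ∪ F n G, hI n G⟩) n
  have hg : ∀ n, ∀ p ∈ (g n).1, ∃ m, p ∈ F m (g m) := by
    intro n
    induction n with
    | zero => intro p hp; exact absurd hp (Finset.notMem_empty p)
    | succ n ih =>
      intro p hp
      rcases Finset.mem_union.1 (show p ∈ (g n).1 ∪ F n (g n) from hp) with h | h
      · exact ih p h
      · exact ⟨n, h⟩
  -- The finite layers are arranged into one sequence through the pairing of indices and padded with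
  -- `(0, 0)`. Only finitely many nonzero terms come from the first `N` layers and later ones are
  -- small, so the sequence is null.
  let L : ℕ → List (H × H) := fun n => (F n (g n)).toList
  let q : ℕ → H × H := fun k => (L k.unpair.1).getD k.unpair.2 (0, 0)
  have hq : ∀ k, q k ≠ (0, 0) → q k ∈ F k.unpair.1 (g k.unpair.1) ∧ k.unpair.2 < (L k.unpair.1).length := by
    intro k hk
    by_cases h : k.unpair.2 < (L k.unpair.1).length
    · refine ⟨?_, h⟩
      have : q k = (L k.unpair.1)[k.unpair.2] := List.getD_eq_getElem _ _ h
      rw [this]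
      exact Finset.mem_toList.1 (List.getElem_mem h)
    · exact absurd (List.getD_eq_default _ _ (not_lt.1 h)) hk
  have hfin : ∀ N : ℕ, {k | q k ≠ (0, 0) ∧ k.unpair.1 < N}.Finite := by
    intro N
    refine Set.Finite.subset (s := (fun p : ℕ × ℕ => Nat.pair p.1 p.2) ''
      (⋃ n ∈ Set.Iio N, (Prod.mk n) '' Set.Iio (L n).length))
      (Set.Finite.image _ (Set.Finite.biUnion (Set.finite_Iio N)
        fun n _ => (Set.finite_Iio _).image _)) ?_
    rintro k ⟨hk, hkN⟩
    refine ⟨k.unpair, ?_, Nat.pair_unpair k⟩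
    simp only [Set.mem_iUnion]
    exact ⟨k.unpair.1, hkN, k.unpair.2, (hq k hk).2, rfl⟩
  have htend : ∀ f : H × H → ℝ, f (0, 0) = 0 → (∀ p, 0 ≤ f p) →
      (∀ n, ∀ p ∈ F n (g n), f p ≤ (n + 1 : ℝ)⁻¹) →
      Tendsto (fun k => f (q k)) cofinite (𝓝 0) := by
    intro f hf0 hfn hf
    rw [Metric.tendsto_nhds]
    intro ε hε
    obtain ⟨N, hN⟩ := exists_nat_gt ε⁻¹
    refine (hfin N).subset fun k hk => ?_
    have hk' : ε ≤ f (q k) := by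
      simpa [Real.dist_eq, abs_of_nonneg (hfn _)] using hk
    have hk0 : q k ≠ (0, 0) := fun h => by
      rw [h, hf0] at hk'
      exact absurd hk' (not_le.2 hε)
    refine ⟨hk0, ?_⟩
    by_contra! hcon
    have h1 := hk'.trans (hf _ _ (hq k hk0).1)
    have h2 : (k.unpair.1 + 1 : ℝ) ≤ ε⁻¹ := by
      rw [le_inv_comm₀ (by positivity) hε]
      exact h1
    have h3 : (N : ℝ) ≤ k.unpair.1 := by exact_mod_cast hcon
    linarith
  refine ⟨q, htend (fun p => ‖p.1‖ ^ 2) (by simp) (fun p => by positivity)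
      (fun n p hp => (hF n _ p hp).1),
    htend (fun p => ‖p.2‖ ^ 2) (by simp) (fun p => by positivity)
      (fun n p hp => (hF n _ p hp).2), ?_⟩
  intro x hx
  obtain ⟨n, hn⟩ := exists_nat_ge ‖x‖
  obtain ⟨p, hp, hp'⟩ := (g n).2 x hx (by linarith)
  obtain ⟨m, hm⟩ := hg n p hp
  obtain ⟨i, hi, hi'⟩ := List.getElem_of_mem (Finset.mem_toList.2 hm)
  refine ⟨Nat.pair m i, ?_⟩
  have : q (Nat.pair m i) = p := by
    simp only [q, Nat.unpair_pair]
    rw [← hi']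
    exact List.getD_eq_getElem _ _ hi
  rw [this]
  exact not_le.1 hp'

/-- A summable combination of a null sequence of vector functionals is ultraweakly continuous. -/
lemma exists_ultraweakFunctional_eq {q : ℕ → H × H}
    (h1 : Tendsto (fun k => ‖(q k).1‖ ^ 2) cofinite (𝓝 0))
    (h2 : Tendsto (fun k => ‖(q k).2‖ ^ 2) cofinite (𝓝 0))
    {a : ℕ → ℂ} (ha : Summable fun k => ‖a k‖) :
    ∃ p, ∀ x : H →L[ℂ] H, ultraweakFunctional p x = ∑' k, a k * inner ℂ (q k).1 (x (q k).2) := by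
  have key : ∀ (s : ℕ → ℂ) (z : ℕ → H), (∀ k, ‖s k‖ ^ 2 = ‖a k‖) →
      Tendsto (fun k => ‖z k‖ ^ 2) cofinite (𝓝 0) → Memℓp (fun k => s k • z k) 2 := by
    intro s z hs hz
    refine memℓp_gen ?_
    refine Summable.of_norm_bounded_eventually ha ?_
    filter_upwards [hz.eventually (Iio_mem_nhds zero_lt_one)] with k hk
    have : ‖s k • z k‖ ^ (2 : ℝ≥0∞).toReal = ‖a k‖ * ‖z k‖ ^ 2 := by
      rw [norm_smul, ← hs]
      simp [mul_pow]
    rw [this, Real.norm_of_nonneg (by positivity)]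
    exact mul_le_of_le_one_right (norm_nonneg _) (le_of_lt hk)
  -- The weight `a k` is split as `√‖a k‖` times `a k / √‖a k‖` between the two vectors. Both
  -- factors have squared modulus `‖a k‖`, so both sequences of vectors are square-summable.
  refine ⟨(⟨_, key (fun k => (√‖a k‖ : ℝ)) (fun k => (q k).1) (fun k => ?_) h1⟩,
    ⟨_, key (fun k => a k / (√‖a k‖ : ℝ)) (fun k => (q k).2) (fun k => ?_) h2⟩), fun x => ?_⟩
  · rw [Complex.norm_real, Real.norm_of_nonneg (Real.sqrt_nonneg _),
      Real.sq_sqrt (norm_nonneg _)]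
  · rw [norm_div, Complex.norm_real, Real.norm_of_nonneg (Real.sqrt_nonneg _), div_pow,
      Real.sq_sqrt (norm_nonneg _)]
    rcases eq_or_ne (‖a k‖) 0 with h | h
    · simp [h]
    · field_simp
  · refine tsum_congr fun k => ?_
    simp only [map_smul, inner_smul_left, inner_smul_right, Complex.conj_ofReal]
    rcases eq_or_ne (a k) 0 with h | h
    · simp [h]
    · have : ((√‖a k‖ : ℝ) : ℂ) ≠ 0 := by
        simpa using Real.sqrt_ne_zero'.2 (norm_pos_iff.2 h)
      field_simp

/-- After scaling, a translate of `V` misses the unit ball, and a null sequence of vector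
functionals detects all its points. These functionals map `B(H)` into `c₀`, where the image of the
scaled point has distance at least `1` from the image of `V`. Hahn-Banach in `c₀` separates them,
and the dual of `c₀` consists of summable families, so the separating functional pulls back to an
ultraweakly continuous one. -/
lemma exists_ultraweakFunctional_separating (V : Submodule ℂ (H →L[ℂ] H))
    (hV : ∀ (𝒰 : Ultrafilter (H →L[ℂ] H)) (a : H →L[ℂ] H) (C : ℝ),
      (∀ᶠ x in (𝒰 : Filter _), x ∈ V ∧ ‖x‖ ≤ C) → WTendsto 𝒰 id a → a ∈ V)
    {x₀ : H →L[ℂ] H} (hx₀ : x₀ ∉ V) :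
    ∃ p, (∀ v ∈ V, ultraweakFunctional p v = 0) ∧ ultraweakFunctional p x₀ ≠ 0 := by
  have hclosed : IsClosed (V : Set (H →L[ℂ] H)) := by
    refine isClosed_iff_ultrafilter.2 fun a 𝒰 h𝒰 hmem => hV 𝒰 a (‖a‖ + 1) ?_ ?_
    · have : ∀ᶠ x in 𝓝 a, ‖x‖ < ‖a‖ + 1 :=
        continuous_norm.continuousAt.eventually (Iio_mem_nhds (lt_add_one _))
      filter_upwards [hmem, h𝒰 this] with x h h' using ⟨h, le_of_lt h'⟩
    · intro ξ η
      have : Continuous fun x : H →L[ℂ] H => (inner ℂ ξ (x η) : ℂ) := by fun_prop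
      exact (this.tendsto a).mono_left h𝒰
  obtain ⟨δ, hδ, hball⟩ := Metric.isOpen_iff.1 hclosed.isOpen_compl x₀ hx₀
  -- The scaling turns the gap `δ` between `x₀` and `V` into `2`, which exceeds the radius of the
  -- unit ball.
  let x₁ : H →L[ℂ] H := (2 / δ : ℂ) • x₀
  have hδ' : (δ : ℂ) ≠ 0 := by simpa using hδ.ne'
  let c : Set (H →L[ℂ] H) := {x | x₁ - x ∈ V}
  have hcd : ∀ x ∈ c, ¬ ‖x‖ ≤ 1 := by
    intro x hx hx1
    have h1 : x₀ - (δ / 2 : ℂ) • x ∈ V := by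
      have := V.smul_mem (δ / 2 : ℂ) hx
      rwa [smul_sub, smul_smul, div_mul_div_cancel₀ two_ne_zero, div_self hδ', one_smul] at this
    refine hball ?_ h1
    rw [Metric.mem_ball, dist_eq_norm, sub_sub_cancel_left, norm_neg, norm_smul]
    have : ‖(δ / 2 : ℂ)‖ = δ / 2 := by
      rw [norm_div, Complex.norm_real, Real.norm_of_nonneg hδ.le]; simp
    rw [this]
    nlinarith
  have hcc : ∀ R : ℝ, @IsCompact _ (ultraweakTopology H) (c ∩ {x | ‖x‖ ≤ R}) := by
    intro R
    let _ := ultraweakTopology H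
    refine isCompact_iff_ultrafilter_le_nhds'.2 fun 𝒰 h𝒰 => ?_
    have hR : ∀ᶠ x : H →L[ℂ] H in 𝒰, ‖x‖ ≤ R := by filter_upwards [h𝒰] with x hx using hx.2
    obtain ⟨a, ha, haR⟩ := exists_wtendsto 𝒰 (x := id) hR
    refine ⟨a, ⟨?_, haR⟩, tendsto_ultraweak_of_bounded (x := id) hR ha⟩
    refine hV (𝒰.map fun x => x₁ - x) (x₁ - a) (‖x₁‖ + R) ?_ ?_
    · refine Filter.mem_map.2 ?_
      filter_upwards [h𝒰] with x hx
      refine ⟨hx.1, (norm_sub_le _ _).trans ?_⟩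
      have := hx.2
      simp only [Set.mem_ofPred_eq] at this
      linarith
    · exact (WTendsto.const (l := (𝒰 : Filter (H →L[ℂ] H))) x₁).sub ha
  obtain ⟨q, hq1, hq2, hq⟩ := exists_null_sequence_of_disjoint_ball hcc hcd
  have hzero : ∀ x : H →L[ℂ] H,
      Tendsto (fun k => (inner ℂ (q k).1 (x (q k).2) : ℂ)) (cocompact ℕ) (𝓝 0) := by
    intro x
    rw [tendsto_cofinite_zero_iff_cocompact]
    refine squeeze_zero_norm (a := fun k => ‖x‖ * (‖(q k).1‖ ^ 2 + ‖(q k).2‖ ^ 2))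
      (fun k => ?_) (by simpa using (hq1.add hq2).const_mul ‖x‖)
    refine (norm_inner_apply_le _ _ _).trans ?_
    rw [mul_assoc]
    gcongr
    nlinarith [sq_nonneg (‖(q k).1‖ - ‖(q k).2‖), sq_nonneg (‖(q k).1‖ + ‖(q k).2‖)]
  let T : (H →L[ℂ] H) →ₗ[ℂ] C₀(ℕ, ℂ) :=
    { toFun := fun x => ⟨⟨fun k => inner ℂ (q k).1 (x (q k).2), continuous_of_discreteTopology⟩,
        hzero x⟩
      map_add' := fun x y => by ext k; simp
      map_smul' := fun r x => by ext k; simp }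
  have hT : ∀ x k, T x k = inner ℂ (q k).1 (x (q k).2) := fun _ _ => rfl
  have hnot : T x₁ ∉ closure ((V.map T : Submodule ℂ C₀(ℕ, ℂ)) : Set C₀(ℕ, ℂ)) := by
    rw [Metric.mem_closure_iff]
    push Not
    refine ⟨1, one_pos, ?_⟩
    rintro _ ⟨v, hv, rfl⟩
    rw [dist_eq_norm, ← map_sub]
    obtain ⟨k, hk⟩ := hq (x₁ - v) (by simpa [c] using hv)
    refine hk.le.trans ?_
    rw [← hT, ← ZeroAtInftyContinuousMap.norm_toBCF_eq_norm]
    exact (T (x₁ - v)).toBCF.norm_coe_le_norm k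
  obtain ⟨g, r, hgV, hgr⟩ := RCLike.geometric_hahn_banach_closed_point (𝕜 := ℂ)
    (Submodule.convex ((V.map T).topologicalClosure.restrictScalars ℝ)) isClosed_closure hnot
  have hr : 0 < r := by simpa using hgV 0 (Submodule.zero_mem _)
  have hgV' : ∀ v ∈ V, g (T v) = 0 := by
    intro v hv
    by_contra hne
    have h1 : 0 < ‖g (T v)‖ ^ 2 := by positivity
    -- The multiple of `v` is chosen so that `g` takes exactly the value `r` there, which
    -- contradicts the strict bound on the subspace.
    have h2 := hgV (T (((r / ‖g (T v)‖ ^ 2 : ℝ) * (starRingEnd ℂ) (g (T v)) : ℂ) • v))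
      (Submodule.le_topologicalClosure _ (Submodule.mem_map_of_mem (V.smul_mem _ hv)))
    rw [map_smul, map_smul, smul_eq_mul, mul_assoc, RCLike.conj_mul] at h2
    have h3 : ((r / ‖g (T v)‖ ^ 2 : ℝ) : ℂ) * (‖g (T v)‖ : ℂ) ^ 2 = (r : ℂ) := by
      rw [← Complex.ofReal_pow, ← Complex.ofReal_mul, div_mul_cancel₀ _ h1.ne']
    erw [h3] at h2
    simp at h2
  obtain ⟨a, ha, hag⟩ := ZeroAtInftyContinuousMap.exists_summable_of_dual g
  obtain ⟨p, hp⟩ := exists_ultraweakFunctional_eq hq1 hq2 ha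
  have hpT : ∀ x, ultraweakFunctional p x = g (T x) := fun x => by
    rw [hp]
    exact (hag (T x)).tsum_eq
  refine ⟨p, fun v hv => by rw [hpT, hgV' v hv], fun h => ?_⟩
  rw [← hpT, map_smul, h, smul_zero] at hgr
  simp only [map_zero] at hgr
  exact lt_asymm hr hgr

/-- The Krein-Smulian theorem for linear subspaces of `B(H)`. -/
theorem isClosed_ultraweak_of_bounded (V : Submodule ℂ (H →L[ℂ] H))
    (hV : ∀ (𝒰 : Ultrafilter (H →L[ℂ] H)) (a : H →L[ℂ] H) (C : ℝ),
      (∀ᶠ x in (𝒰 : Filter _), x ∈ V ∧ ‖x‖ ≤ C) → WTendsto 𝒰 id a → a ∈ V) :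
    IsClosed[ultraweakTopology H] (V : Set (H →L[ℂ] H)) := by
  let _ := ultraweakTopology H
  rw [← isOpen_compl_iff, isOpen_iff_mem_nhds]
  intro x₀ hx₀
  obtain ⟨p, hpV, hp⟩ := exists_ultraweakFunctional_separating V hV hx₀
  have hcont : Continuous fun x : H →L[ℂ] H => ultraweakFunctional p x :=
    continuous_iInf_dom (i := p) continuous_induced_dom
  filter_upwards [(isOpen_ne.preimage hcont).mem_nhds hp] with x hx hxV
  exact hx (hpV x hxV)

end KreinSmulian

/-! ### Weak-star continuity tested on bounded sets -/

section DualOperatorSystems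

variable {H : Type u} [NormedAddCommGroup H] [InnerProductSpace ℂ H] [CompleteSpace H]
variable {K : Type v} [NormedAddCommGroup K] [InnerProductSpace ℂ K] [CompleteSpace K]

lemma DualOperatorSystem.mem_of_wtendsto (N : DualOperatorSystem H) {ι : Type*} {l : Filter ι}
    [l.NeBot] {x : ι → H →L[ℂ] H} {a : H →L[ℂ] H} {C : ℝ}
    (hx : ∀ᶠ i in l, x i ∈ N.toSubmodule ∧ ‖x i‖ ≤ C) (h : WTendsto l x a) :
    a ∈ N.toSubmodule := by
  have h1 := tendsto_ultraweak_of_bounded (hx.mono fun i hi => hi.2) h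
  have h2 := N.isClosed'
  let _ := ultraweakTopology H
  exact h2.mem_of_tendsto h1 (hx.mono fun i hi => hi.1)

lemma DualOperatorSystem.exists_wtendsto (N : DualOperatorSystem H) {ι : Type*}
    (𝒰 : Ultrafilter ι) {x : ι → N} {C : ℝ} (hx : ∀ᶠ i in (𝒰 : Filter ι), ‖(x i : H →L[ℂ] H)‖ ≤ C) :
    ∃ a : N, WTendsto 𝒰 (fun i => (x i : H →L[ℂ] H)) a ∧ ‖(a : H →L[ℂ] H)‖ ≤ C := by
  obtain ⟨a, ha, haC⟩ := _root_.exists_wtendsto 𝒰 hx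
  exact ⟨⟨a, N.mem_of_wtendsto (hx.mono fun i hi => ⟨(x i).2, hi⟩) ha⟩, ha, haC⟩

/-- A linear functional on a dual operator system is ball-normal if it respects weak limits of
bounded families. -/
def BallNormal (N : DualOperatorSystem H) (f : N → ℂ) : Prop :=
  ∀ (𝒰 : Ultrafilter N) (a : N) (C : ℝ), (∀ᶠ y : N in 𝒰, ‖(y : H →L[ℂ] H)‖ ≤ C) →
    WTendsto 𝒰 (fun y : N => (y : H →L[ℂ] H)) a → Tendsto f 𝒰 (𝓝 (f a))

/-- The kernel is closed by Krein-Smulian, and a linear functional with closed kernel is continuous.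
-/
lemma DualOperatorSystem.continuous_of_ballNormal (N : DualOperatorSystem H) (f : N →ₗ[ℂ] ℂ)
    (hf : BallNormal N f) : Continuous[N.weakStar, inferInstance] f := by
  let N' : Submodule ℂ (UltraweakSpace H) := N.toSubmodule
  let f' : N' →ₗ[ℂ] ℂ := f
  show Continuous f'
  refine LinearMap.continuous_of_isClosed_ker f' ?_
  have h := isClosed_ultraweak_of_bounded ((LinearMap.ker f).map N.toSubmodule.subtype) (by
    intro 𝒰 a C h𝒰 ha
    have hmem : ∀ᶠ x in (𝒰 : Filter _), x ∈ N.toSubmodule ∧ ‖x‖ ≤ C := by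
      filter_upwards [h𝒰] with x hx
      obtain ⟨⟨y, hy, rfl⟩, hx⟩ := hx
      exact ⟨y.2, hx⟩
    have haN := N.mem_of_wtendsto hmem ha
    have hrange : Set.range (Subtype.val : N → H →L[ℂ] H) ∈ 𝒰 := by
      filter_upwards [hmem] with x hx using ⟨⟨x, hx.1⟩, rfl⟩
    let 𝒱 : Ultrafilter N := 𝒰.comap Subtype.val_injective hrange
    have hmap : (𝒱 : Filter N).map Subtype.val = 𝒰 := by
      rw [Ultrafilter.coe_comap, Filter.map_comap_of_mem hrange]
    have h1 : ∀ᶠ y : N in 𝒱, f y = 0 ∧ ‖(y : H →L[ℂ] H)‖ ≤ C := by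
      rw [← hmap] at h𝒰
      filter_upwards [Filter.mem_map.1 h𝒰] with y hy
      obtain ⟨⟨z, hz, hzy⟩, hy⟩ := hy
      have : z = y := Subtype.ext hzy
      exact ⟨this ▸ hz, hy⟩
    have h2 := hf 𝒱 ⟨a, haN⟩ C (h1.mono fun y hy => hy.2)
      (by rw [← hmap] at ha; exact wtendsto_map.1 ha)
    have h3 : f ⟨a, haN⟩ = 0 := tendsto_nhds_unique h2
      (tendsto_nhds_of_eventually_eq (h1.mono fun y hy => hy.1))
    exact ⟨⟨a, haN⟩, h3, rfl⟩)
  have h4 : (LinearMap.ker f' : Set N') = Subtype.val ⁻¹'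
      (((LinearMap.ker f).map N.toSubmodule.subtype : Submodule ℂ (H →L[ℂ] H)) :
        Set (H →L[ℂ] H)) := by
    ext y
    constructor
    · intro hy
      exact ⟨y, hy, rfl⟩
    · rintro ⟨z, hz, hzy⟩
      have : z = y := Subtype.ext hzy
      exact this ▸ hz
  rw [h4]
  exact IsClosed.preimage (X := N') (Y := UltraweakSpace H) continuous_subtype_val h

/-- Weak-star continuity of a bounded linear map follows from continuity on balls for the weak
operator topology. -/
lemma DualOperatorSystem.continuous_weakStar_of_wtendsto {M : DualOperatorSystem H}
    {N : DualOperatorSystem K} (T : M →ₗ[ℂ] N) (B : ℝ)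
    (hB : ∀ x, ‖(T x : K →L[ℂ] K)‖ ≤ B * ‖(x : H →L[ℂ] H)‖)
    (hT : ∀ ξ η : K, BallNormal M fun x => inner ℂ ξ ((T x : K →L[ℂ] K) η)) :
    Continuous[M.weakStar, N.weakStar] T := by
  let _ := M.weakStar
  refine continuous_induced_rng.2 (continuous_iInf_rng.2 fun p => continuous_induced_rng.2 ?_)
  refine M.continuous_of_ballNormal ((ultraweakFunctional p).comp (N.toSubmodule.subtype.comp T)) ?_
  intro 𝒰 a C h𝒰 ha
  have h1 : ∀ᶠ x : M in 𝒰, ‖(T x : K →L[ℂ] K)‖ ≤ |B| * C := by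
    filter_upwards [h𝒰] with x hx
    exact (hB x).trans (mul_le_mul (le_abs_self B) hx (norm_nonneg _) (abs_nonneg _))
  have h2 : WTendsto 𝒰 (fun x => (T x : K →L[ℂ] K)) (T a) := fun ξ η => hT ξ η 𝒰 a C h𝒰 ha
  have h3 := tendsto_ultraweak_of_bounded h1 h2
  let _ := ultraweakTopology K
  have hcont : Continuous fun x : K →L[ℂ] K => ultraweakFunctional p x :=
    continuous_iInf_dom (i := p) continuous_induced_dom
  exact (hcont.tendsto _).comp h3

lemma wtendsto_of_continuous_weakStar {M : DualOperatorSystem H} {N : DualOperatorSystem K}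
    {T : M → N} (hT : Continuous[M.weakStar, N.weakStar] T) {ι : Type*} {l : Filter ι}
    {x : ι → M} {a : M} {C : ℝ} (hx : ∀ᶠ i in l, ‖(x i : H →L[ℂ] H)‖ ≤ C)
    (h : WTendsto l (fun i => (x i : H →L[ℂ] H)) a) :
    WTendsto l (fun i => (T (x i) : K →L[ℂ] K)) (T a) := by
  have h1 := tendsto_ultraweak_of_bounded hx h
  have h2 : Tendsto x l (@nhds _ M.weakStar a) := by
    rw [@nhds_induced _ _ (ultraweakTopology H)]
    exact tendsto_comap_iff.2 h1
  have h3 := (@Continuous.tendsto _ _ M.weakStar N.weakStar T hT a).comp h2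
  rw [@nhds_induced _ _ (ultraweakTopology K)] at h3
  exact wtendsto_of_tendsto_ultraweak (tendsto_comap_iff.1 h3)

end DualOperatorSystems

/-! ### Kadison's inequality by Bernstein polynomials -/

section Kadison

open Polynomial

variable {H : Type u} [NormedAddCommGroup H] [InnerProductSpace ℂ H] [CompleteSpace H]

lemma IsSelfAdjoint.norm_le_iff_mem_Icc {a : H →L[ℂ] H} (ha : IsSelfAdjoint a) {C : ℝ}
    (hC : 0 ≤ C) : ‖a‖ ≤ C ↔ -((C : ℂ) • (1 : H →L[ℂ] H)) ≤ a ∧ a ≤ (C : ℂ) • (1 : H →L[ℂ] H) := by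
  have hal : ∀ r : ℝ, algebraMap ℝ (H →L[ℂ] H) r = (r : ℂ) • 1 := fun r => by
    rw [Algebra.algebraMap_eq_smul_one]; rfl
  have hneg : -((C : ℂ) • (1 : H →L[ℂ] H)) = algebraMap ℝ (H →L[ℂ] H) (-C) := by
    rw [hal]; simp
  rw [hneg, ← hal, algebraMap_le_iff_le_spectrum, le_algebraMap_iff_spectrum_le]
  have h2 : ‖a‖ ≤ C ↔ ∀ x ∈ spectrum ℝ a, ‖x‖ ≤ C := by
    have := norm_cfc_le_iff (𝕜 := ℝ) (id : ℝ → ℝ) a hC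
    rwa [cfc_id ℝ a] at this
  rw [h2]
  simp only [Real.norm_eq_abs, abs_le]
  exact forall₂_and

lemma IsSelfAdjoint.aeval_nonneg {a : H →L[ℂ] H} (ha : IsSelfAdjoint a) {C : ℝ} (hC : ‖a‖ ≤ C)
    {q : ℝ[X]} (hq : ∀ t : ℝ, |t| ≤ C → 0 ≤ q.eval t) : 0 ≤ aeval a q := by
  rw [← cfc_polynomial q a]
  refine cfc_nonneg fun x hx => hq x ?_
  have := (norm_cfc_le_iff (𝕜 := ℝ) (id : ℝ → ℝ) a ((norm_nonneg a).trans hC)).1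
    (by rwa [cfc_id ℝ a]) x hx
  simpa using this

/-- Kadison's inequality for a positive map on polynomials over the unit interval. -/
lemma mul_self_le_of_nonneg_unitInterval (L : ℝ[X] →ₗ[ℝ] (H →L[ℂ] H)) (h1 : L 1 = 1)
    (hL : ∀ q : ℝ[X], (∀ t : ℝ, 0 ≤ t → t ≤ 1 → 0 ≤ q.eval t) → 0 ≤ L q) :
    L X * L X ≤ L (X ^ 2) := by
  set c := L X with hc
  have hcs : star c = c := (IsSelfAdjoint.of_nonneg (hL X fun t ht _ => by simpa using ht)).star_eq
  have key : ∀ n : ℕ, 0 < n → 0 ≤ L (X ^ 2) + (n : ℝ)⁻¹ • (c - L (X ^ 2)) - c * c := by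
    intro n hn
    have hn' : (n : ℝ) ≠ 0 := by exact_mod_cast hn.ne'
    -- The positive operators `L (b ν)` sum to `1` and act as a finite measure with values `ν`, mean
    -- `n c` and known second moment. The variance `∑ (ν - n c) L (b ν) (ν - n c)` is positive.
    -- Divided by `n²`, it is the claimed inequality up to a term of order `1 / n`.
    let b : ℕ → ℝ[X] := bernsteinPolynomial ℝ n
    have hb : ∀ ν, 0 ≤ L (b ν) := fun ν => hL _ fun t ht0 ht1 => by
      simp only [b, bernsteinPolynomial, eval_mul, eval_pow, eval_sub, eval_X, eval_one,
        eval_natCast]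
      have := sub_nonneg.2 ht1
      positivity
    have e0 : ∑ ν ∈ Finset.range (n + 1), L (b ν) = 1 := by
      rw [← map_sum, bernsteinPolynomial.sum, h1]
    have e1 : ∑ ν ∈ Finset.range (n + 1), (ν : ℝ) • L (b ν) = (n : ℝ) • c := by
      have := congrArg L (bernsteinPolynomial.sum_smul ℝ n)
      simp only [map_sum, ← Nat.cast_smul_eq_nsmul ℝ, map_smul] at this
      exact this
    have e2 : ∑ ν ∈ Finset.range (n + 1), ((ν : ℝ) * (ν - 1)) • L (b ν) =
        ((n : ℝ) * (n - 1)) • L (X ^ 2) := by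
      have := congrArg L (bernsteinPolynomial.sum_mul_smul ℝ n)
      simp only [map_sum, ← Nat.cast_smul_eq_nsmul ℝ, map_smul] at this
      have hcast : ∀ m : ℕ, ((m * (m - 1) : ℕ) : ℝ) = (m : ℝ) * (m - 1) := by
        intro m
        cases m <;> simp
      simp only [hcast] at this
      exact this
    have hsum : 0 ≤ ∑ ν ∈ Finset.range (n + 1),
        star ((ν : ℝ) • (1 : H →L[ℂ] H) - (n : ℝ) • c) * L (b ν) *
          ((ν : ℝ) • (1 : H →L[ℂ] H) - (n : ℝ) • c) :=
      Finset.sum_nonneg fun ν _ => star_left_conjugate_nonneg (hb ν) _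
    have hexp : ∀ ν : ℕ, star ((ν : ℝ) • (1 : H →L[ℂ] H) - (n : ℝ) • c) * L (b ν) *
          ((ν : ℝ) • (1 : H →L[ℂ] H) - (n : ℝ) • c) =
        ((ν : ℝ) * (ν - 1)) • L (b ν) + (ν : ℝ) • L (b ν) - (n : ℝ) • (((ν : ℝ) • L (b ν)) * c)
          - (n : ℝ) • (c * ((ν : ℝ) • L (b ν))) + ((n : ℝ) * n) • (c * L (b ν) * c) := by
      intro ν
      simp only [star_sub, star_smul, star_one, hcs, star_trivial, sub_mul, mul_sub, smul_mul_assoc,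
        mul_smul_comm, one_mul, mul_one]
      module
    simp only [hexp, Finset.sum_add_distrib, Finset.sum_sub_distrib, ← Finset.smul_sum,
      ← Finset.sum_mul, ← Finset.mul_sum, e0, e1, e2] at hsum
    have hfin : ((n : ℝ) * n)⁻¹ • (((n : ℝ) * (n - 1)) • L (X ^ 2) + (n : ℝ) • c -
        (n : ℝ) • ((n : ℝ) • c * c) - (n : ℝ) • (c * (n : ℝ) • c) + ((n : ℝ) * n) • (c * 1 * c)) =
        L (X ^ 2) + (n : ℝ)⁻¹ • (c - L (X ^ 2)) - c * c := by
      simp only [mul_one, smul_mul_assoc, mul_smul_comm]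
      match_scalars <;> field_simp <;> ring
    rw [← hfin]
    exact smul_nonneg (by positivity) hsum
  have hlim : Tendsto (fun n : ℕ => L (X ^ 2) + (n : ℝ)⁻¹ • (c - L (X ^ 2)) - c * c) atTop
      (𝓝 (L (X ^ 2) + (0 : ℝ) • (c - L (X ^ 2)) - c * c)) :=
    (((tendsto_inv_atTop_nhds_zero_nat (𝕜 := ℝ)).smul_const _).const_add _).sub_const _
  have := CStarAlgebra.isClosed_nonneg.mem_of_tendsto hlim
    (eventually_atTop.2 ⟨1, fun n hn => key n hn⟩)
  rw [zero_smul, add_zero] at this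
  exact sub_nonneg.1 this

/-- Kadison's inequality for a positive map on polynomials over a symmetric interval. -/
lemma mul_self_le_of_nonneg_Icc (L : ℝ[X] →ₗ[ℝ] (H →L[ℂ] H)) (h1 : L 1 = 1) {C : ℝ} (hC : 0 < C)
    (hL : ∀ q : ℝ[X], (∀ t : ℝ, |t| ≤ C → 0 ≤ q.eval t) → 0 ≤ L q) :
    L X * L X ≤ L (X ^ 2) := by
  -- The affine map `t ↦ t / (2C) + 1 / 2` takes `[-C, C]` onto `[0, 1]`. The Kadison defect ignores
  -- the translation and scales by `(2C)⁻²`.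
  let p : ℝ[X] := (2 * C)⁻¹ • X + (2⁻¹ : ℝ) • 1
  let L' : ℝ[X] →ₗ[ℝ] (H →L[ℂ] H) := L ∘ₗ (aeval p).toLinearMap
  have hX : L' X = (2 * C)⁻¹ • L X + (2⁻¹ : ℝ) • 1 := by
    simp [L', p, h1]
  have hX2 : L' (X ^ 2) = ((2 * C)⁻¹ * (2 * C)⁻¹) • L (X ^ 2) + ((2 * C)⁻¹) • L X +
      (4⁻¹ : ℝ) • 1 := by
    have : aeval p (X ^ 2 : ℝ[X]) = ((2 * C)⁻¹ * (2 * C)⁻¹) • X ^ 2 + ((2 * C)⁻¹) • X +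
      (4⁻¹ : ℝ) • (1 : ℝ[X]) := by
      rw [map_pow, aeval_X, sq]
      simp only [p, add_mul, mul_add, smul_mul_smul_comm, mul_one, one_mul, sq]
      module
    simp only [L', LinearMap.comp_apply, AlgHom.toLinearMap_apply, this, map_add, map_smul, h1]
  have h := mul_self_le_of_nonneg_unitInterval L' (by simp [L', h1]) (by
    intro q hq
    refine hL _ fun t ht => ?_
    have hev : (aeval p q).eval t = q.eval ((2 * C)⁻¹ * t + 2⁻¹) := by
      rw [← Polynomial.comp_eq_aeval, eval_comp]
      simp [p]
    rw [AlgHom.toLinearMap_apply, hev]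
    rw [abs_le] at ht
    have h2C : 0 < (2 * C)⁻¹ := by positivity
    have hCC : (2 * C)⁻¹ * C = 2⁻¹ := by field_simp
    refine hq _ ?_ ?_ <;> nlinarith)
  rw [hX, hX2] at h
  have h' := sub_nonneg.2 h
  have hfin : ((2 * C) * (2 * C)) • (((2 * C)⁻¹ * (2 * C)⁻¹) • L (X ^ 2) + ((2 * C)⁻¹) • L X +
      (4⁻¹ : ℝ) • 1 - ((2 * C)⁻¹ • L X + (2⁻¹ : ℝ) • 1) * ((2 * C)⁻¹ • L X + (2⁻¹ : ℝ) • 1)) =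
      L (X ^ 2) - L X * L X := by
    simp only [mul_add, add_mul, smul_mul_smul_comm, mul_one, one_mul]
    match_scalars <;> field_simp <;> ring
  rw [← sub_nonneg, ← hfin]
  exact smul_nonneg (by positivity) h'

end Kadison

/-! ### Positive unital maps on operator systems -/

section PositiveMaps

variable {H : Type u} [NormedAddCommGroup H] [InnerProductSpace ℂ H] [CompleteSpace H]
variable {K : Type v} [NormedAddCommGroup K] [InnerProductSpace ℂ K] [CompleteSpace K]

namespace DualOperatorSystem

variable (N : DualOperatorSystem H)

@[simp] lemma coe_unit : (N.unit : H →L[ℂ] H) = 1 := rfl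

@[simp] lemma coe_adj (x : N) : (N.adj x : H →L[ℂ] H) = star (x : H →L[ℂ] H) := rfl

/-- The self-adjoint part of an element. -/
def rePart (y : N) : N := (2⁻¹ : ℂ) • (y + N.adj y)

/-- The imaginary part of an element. -/
def imPart (y : N) : N := (-(Complex.I * 2⁻¹) : ℂ) • (y - N.adj y)

lemma rePart_add_imPart (y : N) : N.rePart y + Complex.I • N.imPart y = y := by
  simp only [rePart, imPart, smul_smul, smul_add, smul_sub]
  match_scalars <;> ring_nf <;> simp <;> ring

lemma rePart_isSelfAdjoint (y : N) : IsSelfAdjoint (N.rePart y : H →L[ℂ] H) := by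
  simp only [IsSelfAdjoint, rePart, Submodule.coe_smul, Submodule.coe_add, coe_adj, star_smul,
    star_add, star_star]
  rw [add_comm]
  simp

lemma imPart_isSelfAdjoint (y : N) : IsSelfAdjoint (N.imPart y : H →L[ℂ] H) := by
  simp only [IsSelfAdjoint, imPart, Submodule.coe_smul, Submodule.coe_sub, coe_adj, star_smul,
    star_sub, star_star]
  rw [← neg_sub, smul_neg, ← neg_smul]
  simp

lemma norm_rePart_le (y : N) : ‖(N.rePart y : H →L[ℂ] H)‖ ≤ ‖(y : H →L[ℂ] H)‖ := by
  simp only [rePart, Submodule.coe_smul, Submodule.coe_add, coe_adj, norm_smul]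
  have := norm_add_le (y : H →L[ℂ] H) (star (y : H →L[ℂ] H))
  rw [norm_star] at this
  norm_num
  linarith

lemma norm_imPart_le (y : N) : ‖(N.imPart y : H →L[ℂ] H)‖ ≤ ‖(y : H →L[ℂ] H)‖ := by
  simp only [imPart, Submodule.coe_smul, Submodule.coe_sub, coe_adj, norm_smul]
  have := norm_sub_le (y : H →L[ℂ] H) (star (y : H →L[ℂ] H))
  rw [norm_star] at this
  norm_num
  linarith

variable {N}

/-- A positive unital linear map on a dual operator system. -/
structure IsPositiveUnital (T : N →ₗ[ℂ] (K →L[ℂ] K)) : Prop where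
  map_unit : T N.unit = 1
  map_nonneg : ∀ x : N, 0 ≤ (x : H →L[ℂ] H) → 0 ≤ T x

namespace IsPositiveUnital

variable {T : N →ₗ[ℂ] (K →L[ℂ] K)} (hT : N.IsPositiveUnital T)

include hT

lemma map_Icc {a : N} (ha : IsSelfAdjoint (a : H →L[ℂ] H)) {C : ℝ} (hC : ‖(a : H →L[ℂ] H)‖ ≤ C) :
    -((C : ℂ) • (1 : K →L[ℂ] K)) ≤ T a ∧ T a ≤ (C : ℂ) • (1 : K →L[ℂ] K) := by
  obtain ⟨h1, h2⟩ := (ha.norm_le_iff_mem_Icc ((norm_nonneg _).trans hC)).1 hC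
  constructor
  · have := hT.map_nonneg (a + (C : ℂ) • N.unit) (by
      have := sub_nonneg.2 h1
      rwa [sub_neg_eq_add] at this)
    rw [map_add, map_smul, hT.map_unit] at this
    rw [← sub_nonneg, sub_neg_eq_add]
    exact this
  · have := hT.map_nonneg ((C : ℂ) • N.unit - a) (sub_nonneg.2 h2)
    rw [map_sub, map_smul, hT.map_unit] at this
    exact sub_nonneg.1 this

lemma isSelfAdjoint {a : N} (ha : IsSelfAdjoint (a : H →L[ℂ] H)) : IsSelfAdjoint (T a) := by
  have h1 := (hT.map_Icc ha le_rfl).1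
  have h2 : IsSelfAdjoint (((‖(a : H →L[ℂ] H)‖ : ℂ)) • (1 : K →L[ℂ] K)) := by
    simp [IsSelfAdjoint, star_smul]
  have h3 := (IsSelfAdjoint.of_nonneg (sub_nonneg.2 h1)).sub h2
  simpa using h3

lemma norm_le_of_isSelfAdjoint {a : N} (ha : IsSelfAdjoint (a : H →L[ℂ] H)) :
    ‖T a‖ ≤ ‖(a : H →L[ℂ] H)‖ :=
  ((hT.isSelfAdjoint ha).norm_le_iff_mem_Icc (norm_nonneg _)).2 (hT.map_Icc ha le_rfl)

/-- The map is contractive on self-adjoint elements. The factor `2` arises from adding the real and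
imaginary parts. -/
lemma norm_le (y : N) : ‖T y‖ ≤ 2 * ‖(y : H →L[ℂ] H)‖ := by
  rw [← N.rePart_add_imPart y, map_add, map_smul]
  refine (norm_add_le _ _).trans ?_
  rw [norm_smul, Complex.norm_I, one_mul, N.rePart_add_imPart y, two_mul]
  exact add_le_add
    ((hT.norm_le_of_isSelfAdjoint (N.rePart_isSelfAdjoint y)).trans (N.norm_rePart_le y))
    ((hT.norm_le_of_isSelfAdjoint (N.imPart_isSelfAdjoint y)).trans (N.norm_imPart_le y))

lemma map_adj (y : N) : T (N.adj y) = star (T y) := by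
  have h : N.adj y = N.rePart y - Complex.I • N.imPart y := by
    simp only [rePart, imPart, smul_smul, smul_add, smul_sub]
    match_scalars <;> ring_nf <;> simp <;> ring
  conv_rhs => rw [← N.rePart_add_imPart y]
  rw [h, map_sub, map_add, map_smul, star_add, star_smul,
    (hT.isSelfAdjoint (N.rePart_isSelfAdjoint y)).star_eq,
    (hT.isSelfAdjoint (N.imPart_isSelfAdjoint y)).star_eq]
  simp [sub_eq_add_neg]

/-- Kadison's inequality for an element all of whose powers lie in the operator system. -/
lemma mul_self_le {a : N} (ha : IsSelfAdjoint (a : H →L[ℂ] H))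
    (hpow : ∀ n : ℕ, (a : H →L[ℂ] H) ^ n ∈ N.toSubmodule) :
    T a * T a ≤ T ⟨(a : H →L[ℂ] H) ^ 2, hpow 2⟩ := by
  have hmem : ∀ q : Polynomial ℝ, Polynomial.aeval (a : H →L[ℂ] H) q ∈ N.toSubmodule := by
    intro q
    rw [Polynomial.aeval_eq_sum_range]
    exact Submodule.sum_mem _ fun i _ => N.toSubmodule.smul_mem ((q.coeff i : ℝ) : ℂ) (hpow i)
  let L : Polynomial ℝ →ₗ[ℝ] (K →L[ℂ] K) :=
    { toFun := fun q => T ⟨Polynomial.aeval (a : H →L[ℂ] H) q, hmem q⟩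
      map_add' := fun p q => by
        rw [← map_add]
        congr 1
        ext1
        simp
      map_smul' := fun r q => by
        have : (⟨Polynomial.aeval (a : H →L[ℂ] H) (r • q), hmem _⟩ : N) =
            (r : ℂ) • ⟨Polynomial.aeval (a : H →L[ℂ] H) q, hmem q⟩ := by
          ext1
          show Polynomial.aeval (a : H →L[ℂ] H) (r • q) =
            (r : ℂ) • Polynomial.aeval (a : H →L[ℂ] H) q
          rw [map_smul]
          rfl
        rw [this, map_smul]
        rfl }
  have h := mul_self_le_of_nonneg_Icc L (by
      rw [← hT.map_unit]
      show T _ = T _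
      congr 1
      ext1
      simp) (C := ‖(a : H →L[ℂ] H)‖ + 1) (by positivity) (fun q hq => hT.map_nonneg _
        (ha.aeval_nonneg (lt_add_one _).le hq))
  have hX : L Polynomial.X = T a := by
    show T _ = T _
    congr 1
    ext1
    simp
  have hX2 : L (Polynomial.X ^ 2) = T ⟨(a : H →L[ℂ] H) ^ 2, hpow 2⟩ := by
    show T _ = T _
    congr 1
    ext1
    simp
  rwa [hX, hX2] at h

end IsPositiveUnital

end DualOperatorSystem

end PositiveMaps

/-! ### Order isomorphisms of JW*-algebras -/

section JordanIsomorphisms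

variable {H : Type u} [NormedAddCommGroup H] [InnerProductSpace ℂ H] [CompleteSpace H]
variable {K : Type v} [NormedAddCommGroup K] [InnerProductSpace ℂ K] [CompleteSpace K]

namespace JWStarAlgebra

variable (A : JWStarAlgebra H)

@[simp] lemma coe_jordan (x y : A) : (A.jordan x y : H →L[ℂ] H) =
    (2⁻¹ : ℂ) • ((x : H →L[ℂ] H) * (y : H →L[ℂ] H) + (y : H →L[ℂ] H) * (x : H →L[ℂ] H)) := rfl

lemma coe_jordan_self (x : A) : (A.jordan x x : H →L[ℂ] H) = (x : H →L[ℂ] H) ^ 2 := by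
  rw [coe_jordan, ← two_smul ℂ, smul_smul, sq]
  simp

lemma pow_mem (x : A) (n : ℕ) : (x : H →L[ℂ] H) ^ n ∈ A.toSubmodule := by
  induction n with
  | zero => rw [pow_zero]; exact A.one_mem'
  | succ n ih =>
    have := A.jordan_mem' _ ih _ x.2
    rwa [← pow_succ, ← pow_succ', ← two_smul ℂ, smul_smul, inv_mul_cancel₀ two_ne_zero,
      one_smul] at this

/-- The Jordan product as a bilinear map. -/
def jordanₗ : A →ₗ[ℂ] A →ₗ[ℂ] A := LinearMap.mk₂ ℂ A.jordan
  (fun x y z => by ext1; simp [add_mul, mul_add]; module)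
  (fun c x y => by ext1; simp; module)
  (fun x y z => by ext1; simp [add_mul, mul_add]; module)
  (fun c x y => by ext1; simp; module)

@[simp] lemma jordanₗ_apply (x y : A) : A.jordanₗ x y = A.jordan x y := rfl

lemma jordan_comm (x y : A) : A.jordan x y = A.jordan y x := by
  ext1
  rw [coe_jordan, coe_jordan, add_comm]

end JWStarAlgebra

lemma IsUnitalOrderIso.isPositiveUnital {M : DualOperatorSystem H} {N : DualOperatorSystem K}
    {f : M ≃ₗ[ℂ] N} (hf : IsUnitalOrderIso f) :
    M.IsPositiveUnital (N.toSubmodule.subtype ∘ₗ (f : M →ₗ[ℂ] N)) where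
  map_unit := congrArg Subtype.val hf.map_unit
  map_nonneg := fun x hx => (hf.nonneg_iff x).2 hx

lemma IsUnitalOrderIso.symm {M : DualOperatorSystem H} {N : DualOperatorSystem K}
    {f : M ≃ₗ[ℂ] N} (hf : IsUnitalOrderIso f) : IsUnitalOrderIso f.symm where
  map_unit := by rw [← hf.map_unit, f.symm_apply_apply]
  nonneg_iff := fun x => by rw [← hf.nonneg_iff, f.apply_symm_apply]

/-- A unital order isomorphism of JW*-algebras is a Jordan isomorphism. -/
theorem IsUnitalOrderIso.isJordanIso {A : JWStarAlgebra H} {B : JWStarAlgebra K} {f : A ≃ₗ[ℂ] B}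
    (hf : IsUnitalOrderIso (M := A.toDualOperatorSystem) (N := B.toDualOperatorSystem) f) :
    IsJordanIso f := by
  have hp := hf.isPositiveUnital
  have hp' := hf.symm.isPositiveUnital
  have hsa : ∀ x : A, IsSelfAdjoint (x : H →L[ℂ] H) → f (A.jordan x x) = B.jordan (f x) (f x) := by
    intro x hx
    have hfx : IsSelfAdjoint (f x : K →L[ℂ] K) := hp.isSelfAdjoint (a := x) hx
    -- Kadison's inequality for `f` and for its inverse, the latter carried over by `f`, bounds `f
    -- (x²)` by `f (x)²` from both sides. Polarization and complex linearity then extend the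
    -- identity from squares to products.
    have h1 := hp.mul_self_le (a := x) hx (A.pow_mem x)
    have h2 := hp'.mul_self_le (a := f x) hfx (B.pow_mem (f x))
    have e1 : (⟨(x : H →L[ℂ] H) ^ 2, A.pow_mem x 2⟩ : A) = A.jordan x x :=
      Subtype.ext (A.coe_jordan_self x).symm
    have e2 : (⟨(f x : K →L[ℂ] K) ^ 2, B.pow_mem (f x) 2⟩ : B) = B.jordan (f x) (f x) :=
      Subtype.ext (B.coe_jordan_self (f x)).symm
    have h1' : (f x : K →L[ℂ] K) * f x ≤ f (A.jordan x x) := by rw [← e1]; exact h1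
    have h2' : (x : H →L[ℂ] H) * x ≤ f.symm (B.jordan (f x) (f x)) := by
      rw [← e2]
      have h3 : (f.symm (f x) : H →L[ℂ] H) * f.symm (f x) ≤ f.symm ⟨(f x : K →L[ℂ] K) ^ 2, B.pow_mem (f x) 2⟩ := h2
      rwa [f.symm_apply_apply] at h3
    refine Subtype.ext (le_antisymm ?_ ?_)
    · have h4 := hp.map_nonneg (f.symm (B.jordan (f x) (f x)) - A.jordan x x) (by
        rw [← sq, ← A.coe_jordan_self] at h2'
        exact sub_nonneg.2 h2')
      rw [map_sub] at h4
      have h5 := sub_nonneg.1 h4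
      have h6 : (f (A.jordan x x) : K →L[ℂ] K) ≤ f (f.symm (B.jordan (f x) (f x))) := h5
      rwa [f.apply_symm_apply] at h6
    · rwa [B.coe_jordan_self, sq]
  have hpol : ∀ x y : A, IsSelfAdjoint (x : H →L[ℂ] H) → IsSelfAdjoint (y : H →L[ℂ] H) →
      f (A.jordan x y) = B.jordan (f x) (f y) := by
    intro x y hx hy
    have h1 := hsa (x + y) (hx.add hy)
    simp only [← JWStarAlgebra.jordanₗ_apply, map_add, LinearMap.add_apply] at h1 hsa ⊢
    rw [hsa x hx, hsa y hy] at h1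
    have e1 : A.jordanₗ y x = A.jordanₗ x y := A.jordan_comm y x
    have e2 : B.jordanₗ (f y) (f x) = B.jordanₗ (f x) (f y) := B.jordan_comm _ _
    rw [e1, e2] at h1
    have h2 : (2 : ℂ) • f (A.jordanₗ x y) = (2 : ℂ) • B.jordanₗ (f x) (f y) := by
      rw [two_smul, two_smul]
      have := congrArg (fun z => z - B.jordanₗ (f x) (f x) - B.jordanₗ (f y) (f y)) h1
      convert this using 1 <;> abel
    exact smul_right_injective _ (two_ne_zero (α := ℂ)) h2
  refine ⟨fun x y => ?_, fun x => Subtype.ext (hp.map_adj x)⟩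
  have hx := A.toDualOperatorSystem.rePart_add_imPart x
  have hy := A.toDualOperatorSystem.rePart_add_imPart y
  have hx1 := A.toDualOperatorSystem.rePart_isSelfAdjoint x
  have hx2 := A.toDualOperatorSystem.imPart_isSelfAdjoint x
  have hy1 := A.toDualOperatorSystem.rePart_isSelfAdjoint y
  have hy2 := A.toDualOperatorSystem.imPart_isSelfAdjoint y
  generalize A.toDualOperatorSystem.rePart x = a at *
  generalize A.toDualOperatorSystem.imPart x = b at *
  generalize A.toDualOperatorSystem.rePart y = c at *
  generalize A.toDualOperatorSystem.imPart y = d at *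
  rw [← hx, ← hy]
  simp only [← JWStarAlgebra.jordanₗ_apply, map_add, map_smul, LinearMap.add_apply,
    LinearMap.smul_apply] at hpol ⊢
  rw [hpol a c hx1 hy1, hpol a d hx1 hy2, hpol b c hx2 hy1, hpol b d hx2 hy2]

end JordanIsomorphisms

/-! ### Positive projections: the Effros-Størmer argument -/

section EffrosStormer

open scoped ComplexOrder

variable {H : Type u} [NormedAddCommGroup H] [InnerProductSpace ℂ H] [CompleteSpace H]
variable {ι : Type*}

/-- A quadratic polynomial without constant term that is nonnegative on the real line has no linear
term. The imaginary part is settled by comparing `t = 1` with `t = -1`, so `b` need not be known to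
be self-adjoint. -/
lemma ContinuousLinearMap.eq_zero_of_forall_nonneg {b c : H →L[ℂ] H}
    (h : ∀ t : ℝ, 0 ≤ (t : ℂ) • b + ((t * t : ℝ) : ℂ) • c) : b = 0 := by
  have h0 : ∀ ξ : H, inner ℂ ξ (b ξ) = (0 : ℂ) := by
    intro ξ
    have h1 : ∀ t : ℝ, 0 ≤ (t : ℂ) * inner ℂ ξ (b ξ) + ((t * t : ℝ) : ℂ) * inner ℂ ξ (c ξ) := by
      intro t
      have := ContinuousLinearMap.nonneg_iff_inner.1 (h t) ξ
      simpa [inner_add_right, inner_smul_right] using this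
    generalize (inner ℂ ξ (b ξ) : ℂ) = β at h1
    generalize (inner ℂ ξ (c ξ) : ℂ) = γ at h1
    have hre : ∀ t : ℝ, 0 ≤ γ.re * (t * t) + β.re * t + 0 := fun t => by
      have := (Complex.le_def.1 (h1 t)).1
      simp at this
      linarith
    have him : ∀ t : ℝ, 0 = t * β.im + t * t * γ.im := fun t => by
      have := (Complex.le_def.1 (h1 t)).2
      simpa using this
    have hd := discrim_le_zero hre
    simp only [discrim, mul_zero, sub_zero] at hd
    refine Complex.ext (by simpa using pow_eq_zero_iff two_ne_zero |>.1 (le_antisymm hd (sq_nonneg _))) ?_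
    have h2 := him 1
    have h3 := him (-1)
    simp only [Complex.zero_im]
    linarith
  have h1 := (inner_map_self_eq_zero (b : H →ₗ[ℂ] H)).1 fun ξ => by
    have := congrArg (starRingEnd ℂ) (h0 ξ)
    rwa [inner_conj_symm, map_zero] at this
  exact ContinuousLinearMap.coe_injective h1

lemma Pi.eq_zero_of_forall_nonneg {b c : ι → H →L[ℂ] H}
    (h : ∀ t : ℝ, 0 ≤ (t : ℂ) • b + ((t * t : ℝ) : ℂ) • c) : b = 0 :=
  funext fun i => ContinuousLinearMap.eq_zero_of_forall_nonneg fun t => h t i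

lemma Pi.star_mul_mul_nonneg {x : ι → H →L[ℂ] H} (hx : 0 ≤ x) (a : ι → H →L[ℂ] H) :
    0 ≤ star a * x * a := fun i => star_left_conjugate_nonneg (hx i) (a i)

lemma Pi.star_mul_self_nonneg (a : ι → H →L[ℂ] H) : 0 ≤ star a * a :=
  fun i => _root_.star_mul_self_nonneg (a i)

/-- A positive unital idempotent `P` on a star-algebra `R` of bounded families of operators. -/
structure IsPositiveProjection (R : StarSubalgebra ℂ (ι → H →L[ℂ] H))
    (P : (ι → H →L[ℂ] H) →ₗ[ℂ] (ι → H →L[ℂ] H)) : Prop where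
  bounded : ∀ x ∈ R, ∃ C : ℝ, ∀ i, ‖x i‖ ≤ C
  map_mem : ∀ x ∈ R, P x ∈ R
  map_nonneg : ∀ x ∈ R, 0 ≤ x → 0 ≤ P x
  map_one : P 1 = 1
  idem : ∀ x ∈ R, P (P x) = P x

namespace IsPositiveProjection

variable {R : StarSubalgebra ℂ (ι → H →L[ℂ] H)} {P : (ι → H →L[ℂ] H) →ₗ[ℂ] (ι → H →L[ℂ] H)}
variable (hP : IsPositiveProjection R P)

include hP

lemma mono {x y : ι → H →L[ℂ] H} (hx : x ∈ R) (hy : y ∈ R) (h : x ≤ y) : P x ≤ P y := by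
  have := hP.map_nonneg (y - x) (sub_mem hy hx) (sub_nonneg.2 h)
  rw [map_sub] at this
  exact sub_nonneg.1 this

lemma isSelfAdjoint {x : ι → H →L[ℂ] H} (hx : x ∈ R) (hs : star x = x) : star (P x) = P x := by
  obtain ⟨C, hC⟩ := hP.bounded x hx
  have h1 : 0 ≤ (C : ℂ) • (1 : ι → H →L[ℂ] H) + x := by
    intro i
    have hxi : IsSelfAdjoint (x i) := congrFun hs i
    have := ((hxi.norm_le_iff_mem_Icc ((norm_nonneg _).trans (hC i))).1 (hC i)).1
    rw [← sub_nonneg, sub_neg_eq_add, add_comm] at this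
    exact this
  have h2 := hP.map_nonneg _ (add_mem (R.smul_mem (one_mem R) _) hx) h1
  have h3 : star (P ((C : ℂ) • (1 : ι → H →L[ℂ] H) + x)) = P ((C : ℂ) • (1 : ι → H →L[ℂ] H) + x) :=
    funext fun i => (IsSelfAdjoint.of_nonneg (h2 i)).star_eq
  rw [map_add, map_smul, hP.map_one, star_add, star_smul, star_one] at h3
  simpa using h3

lemma map_star {x : ι → H →L[ℂ] H} (hx : x ∈ R) : P (star x) = star (P x) := by
  have h1 := hP.isSelfAdjoint (x := x + star x) (add_mem hx (star_mem hx)) (by simp [add_comm])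
  have h2 := hP.isSelfAdjoint (x := Complex.I • (x - star x))
    (R.smul_mem (sub_mem hx (star_mem hx)) _) (by
      rw [star_smul, star_sub, star_star, ← neg_sub, smul_neg, ← neg_smul]; simp)
  simp only [map_add, map_smul, map_sub, star_add, star_smul, star_sub, Complex.star_def,
    Complex.conj_I] at h1 h2
  have h3 : P x - P (star x) = -(star (P x) - star (P (star x))) := by
    have := congrArg (fun z => (-Complex.I) • z) h2
    simp only [smul_smul] at this
    simpa using this.symm
  have h4 : (2 : ℂ) • P (star x) = (2 : ℂ) • star (P x) := by
    rw [two_smul, two_smul]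
    calc P (star x) + P (star x) = (P x + P (star x)) - (P x - P (star x)) := by abel
      _ = star (P x) + star (P x) := by rw [← h1, h3]; abel
  exact smul_right_injective _ (two_ne_zero (α := ℂ)) h4

/-- Kadison's inequality for `P`. -/
lemma mul_self_le {a : ι → H →L[ℂ] H} (ha : a ∈ R) (hs : star a = a) : P a * P a ≤ P (a * a) := by
  intro i
  obtain ⟨C, hC⟩ := hP.bounded a ha
  have hmem : ∀ q : Polynomial ℝ, Polynomial.aeval a q ∈ R := by
    intro q
    rw [Polynomial.aeval_eq_sum_range]
    exact sum_mem fun i _ => R.smul_mem (pow_mem ha i) ((q.coeff _ : ℝ) : ℂ)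
  let L : Polynomial ℝ →ₗ[ℝ] (H →L[ℂ] H) :=
    LinearMap.proj i ∘ₗ (P.restrictScalars ℝ) ∘ₗ (Polynomial.aeval a).toLinearMap
  have h := mul_self_le_of_nonneg_Icc L (by simp [L, hP.map_one]) (C := max C 1)
    (by positivity) (fun q hq => hP.map_nonneg _ (hmem q) (fun j => by
      have h1 : Polynomial.aeval a q j = Polynomial.aeval (a j) q :=
        (Polynomial.aeval_algHom_apply (Pi.evalAlgHom ℝ _ j) a q).symm
      have hj : IsSelfAdjoint (a j) := congrFun hs j
      show 0 ≤ Polynomial.aeval a q j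
      rw [h1]
      exact hj.aeval_nonneg ((hC j).trans (le_max_left _ _)) hq) i)
  simpa [L, sq] using h

/-- The range of `P` acts on its kernel by Jordan multiplication. -/
lemma map_jordan_eq_zero_of_isSelfAdjoint {s z : ι → H →L[ℂ] H} (hs : s ∈ R) (hss : star s = s)
    (hPs : P s = s) (hz : z ∈ R) (hzs : star z = z) (hPz : P z = 0) : P (s * z + z * s) = 0 := by
  -- Since `P (s + t z) = s`, Kadison gives `s² ≤ P ((s + t z)²)`. Applying `P` once more cancels `P
  -- (s²)` and leaves `0 ≤ t P (sz + zs) + t² P (z²)` for all real `t`.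
  refine Pi.eq_zero_of_forall_nonneg (c := P (z * z)) fun t => ?_
  have ha : s + (t : ℂ) • z ∈ R := add_mem hs (R.smul_mem hz _)
  have h1 := hP.mul_self_le ha (by simp [hss, hzs])
  have hexp : (s + (t : ℂ) • z) * (s + (t : ℂ) • z) =
      s * s + (t : ℂ) • (s * z + z * s) + ((t * t : ℝ) : ℂ) • (z * z) := by
    simp only [add_mul, mul_add, smul_mul_assoc, mul_smul_comm, smul_smul, smul_add]
    push_cast
    abel
  rw [map_add, map_smul, hPz, smul_zero, add_zero, hPs] at h1
  have h2 := hP.mono (mul_mem hs hs) (hP.map_mem _ (mul_mem ha ha)) h1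
  rw [hP.idem _ (mul_mem ha ha), hexp, map_add, map_add, map_smul, map_smul, add_assoc] at h2
  simpa using h2

lemma map_jordan_eq_zero {s z : ι → H →L[ℂ] H} (hs : s ∈ R) (hss : star s = s)
    (hPs : P s = s) (hz : z ∈ R) (hPz : P z = 0) : P (s * z + z * s) = 0 := by
  have hPz' : P (star z) = 0 := by rw [hP.map_star hz, hPz, star_zero]
  have h1 := hP.map_jordan_eq_zero_of_isSelfAdjoint hs hss hPs (z := z + star z)
    (add_mem hz (star_mem hz)) (by simp [add_comm]) (by rw [map_add, hPz, hPz', add_zero])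
  have h2 := hP.map_jordan_eq_zero_of_isSelfAdjoint hs hss hPs (z := Complex.I • (z - star z))
    (R.smul_mem (sub_mem hz (star_mem hz)) _) (by
      rw [star_smul, star_sub, star_star, ← neg_sub, smul_neg, ← neg_smul]; simp)
    (by rw [map_smul, map_sub, hPz, hPz', sub_zero, smul_zero])
  have h3 : s * z + z * s = (2⁻¹ : ℂ) • (s * (z + star z) + (z + star z) * s) +
      (-(Complex.I * 2⁻¹) : ℂ) • (s * (Complex.I • (z - star z)) + (Complex.I • (z - star z)) * s) := by
    simp only [mul_add, add_mul, mul_sub, sub_mul, mul_smul_comm, smul_mul_assoc]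
    match_scalars <;> ring_nf <;> simp <;> ring
  rw [h3, map_add, map_smul, map_smul, h1, h2, smul_zero, smul_zero, add_zero]

lemma map_jordan {s z : ι → H →L[ℂ] H} (hs : s ∈ R) (hss : star s = s)
    (hPs : P s = s) (hz : z ∈ R) : P (s * z + z * s) = P (s * P z + P z * s) := by
  have h := hP.map_jordan_eq_zero hs hss hPs (z := z - P z) (sub_mem hz (hP.map_mem z hz))
    (by rw [map_sub, hP.idem z hz, sub_self])
  have h2 : s * (z - P z) + (z - P z) * s = (s * z + z * s) - (s * P z + P z * s) := by
    simp only [mul_sub, sub_mul]; abel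
  rw [h2, map_sub] at h
  exact sub_eq_zero.1 h

/-- The degenerate case of Cauchy-Schwarz: `P ((t a + b)* (t a + b))` is positive and has no
constant term in `t`. Replacing `a` by `i a` separates the two mixed terms. -/
lemma map_star_mul_eq_zero {a b : ι → H →L[ℂ] H} (ha : a ∈ R) (hb : b ∈ R)
    (h0 : P (star b * b) = 0) : P (star a * b) = 0 := by
  have key : ∀ a ∈ R, P (star a * b + star b * a) = 0 := by
    intro a ha
    refine Pi.eq_zero_of_forall_nonneg (c := P (star a * a)) fun t => ?_
    have hm : (t : ℂ) • a + b ∈ R := add_mem (R.smul_mem ha _) hb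
    have h1 := hP.map_nonneg _ (mul_mem (star_mem hm) hm) (Pi.star_mul_self_nonneg _)
    have hexp : star ((t : ℂ) • a + b) * ((t : ℂ) • a + b) =
        (t : ℂ) • (star a * b + star b * a) + ((t * t : ℝ) : ℂ) • (star a * a) + star b * b := by
      simp only [star_add, star_smul, Complex.star_def, Complex.conj_ofReal, add_mul, mul_add,
        smul_mul_assoc, mul_smul_comm, smul_smul, smul_add]
      push_cast
      abel
    rwa [hexp, map_add, h0, add_zero, map_add, map_smul, map_smul] at h1
  have h1 := key a ha
  have h2 := key (Complex.I • a) (R.smul_mem ha _)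
  have h3 : star a * b = (2⁻¹ : ℂ) • (star a * b + star b * a) +
      (Complex.I * 2⁻¹ : ℂ) • (star (Complex.I • a) * b + star b * (Complex.I • a)) := by
    simp only [star_smul, mul_smul_comm, smul_mul_assoc, Complex.star_def, Complex.conj_I]
    match_scalars <;> ring_nf <;> simp <;> ring
  rw [h3, map_add, map_smul, map_smul, h1, h2, smul_zero, smul_zero, add_zero]

/-- The defect `P(s²) - s²` of a self-adjoint fixed point is positive. -/
lemma defect_nonneg {s : ι → H →L[ℂ] H} (hs : s ∈ R) (hss : star s = s) (hPs : P s = s) :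
    0 ≤ P (s * s) - s * s := by
  have := hP.mul_self_le hs hss
  rw [hPs] at this
  exact sub_nonneg.2 this

/-- From `0 ≤ e ≤ C` follows `e² ≤ C e`, hence `(ew)* (ew) ≤ C w* e w`. -/
lemma map_star_mul_mul_self_mul_eq_zero {e w : ι → H →L[ℂ] H} (he : e ∈ R) (he0 : 0 ≤ e)
    (hw : w ∈ R) (h0 : P (star w * e * w) = 0) : P (star (e * w) * (e * w)) = 0 := by
  obtain ⟨C, hC⟩ := hP.bounded e he
  have hes : star e = e := funext fun i => (IsSelfAdjoint.of_nonneg (he0 i)).star_eq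
  have hle : star (e * w) * (e * w) ≤ (C : ℂ) • (star w * e * w) := by
    intro i
    have h1 : 0 ≤ e i * ((C : ℂ) • 1 - e i) := by
      refine Commute.mul_nonneg (he0 i) (sub_nonneg.2 ?_) ?_
      · exact (((IsSelfAdjoint.of_nonneg (he0 i)).norm_le_iff_mem_Icc
          ((norm_nonneg _).trans (hC i))).1 (hC i)).2
      · exact ((Commute.one_right _).smul_right _).sub_right (Commute.refl _)
    have h2 := star_left_conjugate_nonneg h1 (w i)
    rw [← sub_nonneg]
    convert h2 using 1
    have : star (e i) = e i := congrFun hes i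
    simp only [Pi.smul_apply, Pi.mul_apply, Pi.star_apply, star_mul, this, mul_sub, sub_mul,
      mul_smul_comm, smul_mul_assoc, mul_one, mul_assoc]
  have hm : star w * e * w ∈ R := mul_mem (mul_mem (star_mem hw) he) hw
  have hm' : star (e * w) * (e * w) ∈ R := mul_mem (star_mem (mul_mem he hw)) (mul_mem he hw)
  have h1 := hP.mono hm' (R.smul_mem hm _) hle
  rw [map_smul, h0, smul_zero] at h1
  exact le_antisymm h1 (hP.map_nonneg _ hm' (Pi.star_mul_self_nonneg _))

/-- The defect `e` is positive with `P e = 0`, so `P (e²) = 0`, and Cauchy-Schwarz annihilates `e z`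
and `z e` for every `z`. -/
lemma map_defect_mul_eq_zero {s z : ι → H →L[ℂ] H} (hs : s ∈ R) (hss : star s = s) (hPs : P s = s)
    (hz : z ∈ R) : P ((P (s * s) - s * s) * z + z * (P (s * s) - s * s)) = 0 := by
  have he0 := hP.defect_nonneg hs hss hPs
  have hss' : s * s ∈ R := mul_mem hs hs
  have he : P (s * s) - s * s ∈ R := sub_mem (hP.map_mem _ hss') hss'
  have hPe : P (P (s * s) - s * s) = 0 := by rw [map_sub, hP.idem _ hss', sub_self]
  set e := P (s * s) - s * s with hedef
  have hes : star e = e := funext fun i => (IsSelfAdjoint.of_nonneg (he0 i)).star_eq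
  have h0 : P (star e * e) = 0 := by
    have := hP.map_star_mul_mul_self_mul_eq_zero he he0 (one_mem R) (by simpa using hPe)
    simpa using this
  have h1 : P (z * e) = 0 := by
    have := hP.map_star_mul_eq_zero (star_mem hz) he h0
    rwa [star_star] at this
  have h2 : P (e * z) = 0 := by
    have h3 := hP.map_star_mul_eq_zero hz he h0
    have h4 := hP.map_star (mul_mem (star_mem hz) he)
    rwa [star_mul, star_star, hes, h3, star_zero] at h4
  rw [map_add, h1, h2, add_zero]

/-- The Jordan identity `2 szs = s(sz + zs) + (sz + zs)s - (s²z + zs²)`, in which the vanishing of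
the defect allows `s²` to be replaced by the fixed point `P (s²)`. Every term is then a Jordan
product with a fixed point, so `z` enters only through `P z`. -/
lemma two_smul_map_mul_mul {s z : ι → H →L[ℂ] H} (hs : s ∈ R) (hss : star s = s) (hPs : P s = s)
    (hz : z ∈ R) : (2 : ℂ) • P (s * z * s) =
      P (s * P (s * P z + P z * s) + P (s * P z + P z * s) * s) -
        P (P (s * s) * P z + P z * P (s * s)) := by
  have hss' : s * s ∈ R := mul_mem hs hs
  have hsz : s * z + z * s ∈ R := add_mem (mul_mem hs hz) (mul_mem hz hs)
  have h1 : (2 : ℂ) • (s * z * s) = (s * (s * z + z * s) + (s * z + z * s) * s) -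
      (P (s * s) * z + z * P (s * s)) +
      ((P (s * s) - s * s) * z + z * (P (s * s) - s * s)) := by
    simp only [mul_add, add_mul, mul_sub, sub_mul, two_smul, mul_assoc]
    abel
  rw [← map_smul, h1, map_add, hP.map_defect_mul_eq_zero hs hss hPs hz, add_zero, map_sub,
    hP.map_jordan hs hss hPs hsz, hP.map_jordan hs hss hPs hz,
    hP.map_jordan (hP.map_mem _ hss') (hP.isSelfAdjoint hss' (by rw [star_mul, hss]))
      (hP.idem _ hss') hz]

/-- By `two_smul_map_mul_mul` the left side depends on `z` only through `P z`, which is unchanged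
when `z` is replaced by `P z`. -/
lemma map_mul_mul {s z : ι → H →L[ℂ] H} (hs : s ∈ R) (hss : star s = s) (hPs : P s = s)
    (hz : z ∈ R) : P (s * z * s) = P (s * P z * s) := by
  have h1 := hP.two_smul_map_mul_mul hs hss hPs hz
  have h2 := hP.two_smul_map_mul_mul hs hss hPs (hP.map_mem z hz)
  rw [hP.idem z hz, ← h1] at h2
  exact (smul_right_injective _ (two_ne_zero (α := ℂ)) h2).symm

omit hP in
variable (R P) in
/-- The self-adjoint fixed points of `P`. -/
def saFixed : Set (ι → H →L[ℂ] H) := {s | s ∈ R ∧ star s = s ∧ P s = s}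

omit hP in
variable (R P) in
/-- The multiplicative monoid generated by the self-adjoint fixed points of `P`. -/
def words : Submonoid (ι → H →L[ℂ] H) := Submonoid.closure (saFixed R P)

omit hP in
lemma words_le {w : ι → H →L[ℂ] H} (hw : w ∈ words R P) : w ∈ R := by
  have : words R P ≤ R.toSubalgebra.toSubmonoid := by
    rw [words, Submonoid.closure_le]
    exact fun s hs => hs.1
  exact this hw

/-- Compression by `ab` is compression by `a` followed by compression by `b`, so the property passes
from letters to words. This is how an identity on Jordan products reaches the associative algebra
generated by the fixed points. -/
lemma map_star_word_mul_mul {w : ι → H →L[ℂ] H} (hw : w ∈ words R P) :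
    ∀ z ∈ R, P (star w * z * w) = P (star w * P z * w) := by
  induction hw using Submonoid.closure_induction with
  | mem s hs =>
    intro z hz
    rw [hs.2.1]
    exact hP.map_mul_mul hs.1 hs.2.1 hs.2.2 hz
  | one => intro z hz; simp [hP.idem z hz]
  | mul a b ha hb iha ihb =>
    intro z hz
    have haR : a ∈ R := words_le ha
    have h1 : ∀ y, star (a * b) * y * (a * b) = star b * (star a * y * a) * b := fun y => by
      simp only [star_mul, mul_assoc]
    have hm : ∀ y ∈ R, star a * y * a ∈ R := fun y hy => mul_mem (mul_mem (star_mem haR) hy) haR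
    rw [h1, h1, ihb _ (hm z hz), iha z hz, ← ihb _ (hm _ (hP.map_mem z hz))]

/-- The defect of a self-adjoint fixed point acts as zero on the algebra generated by the fixed
points, modulo the kernel of `P`. -/
lemma map_star_mul_defect_mul_eq_zero {s v w : ι → H →L[ℂ] H} (hs : s ∈ saFixed R P)
    (hv : v ∈ R) (hw : w ∈ Submodule.span ℂ (words R P : Set (ι → H →L[ℂ] H))) :
    P (star v * ((P (s * s) - s * s) * w)) = 0 := by
  have hss' : s * s ∈ R := mul_mem hs.1 hs.1
  have he : P (s * s) - s * s ∈ R := sub_mem (hP.map_mem _ hss') hss'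
  induction hw using Submodule.span_induction with
  | mem w hw =>
    have hwR : w ∈ R := words_le hw
    refine hP.map_star_mul_eq_zero hv (mul_mem he hwR)
      (hP.map_star_mul_mul_self_mul_eq_zero he (hP.defect_nonneg hs.1 hs.2.1 hs.2.2) hwR ?_)
    rw [hP.map_star_word_mul_mul hw _ he, map_sub, hP.idem _ hss', sub_self, mul_zero, zero_mul,
      map_zero]
  | zero => simp
  | add a b _ _ iha ihb => rw [mul_add, mul_add, map_add, iha, ihb, add_zero]
  | smul c a _ ih => rw [mul_smul_comm, mul_smul_comm, map_smul, ih, smul_zero]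

end IsPositiveProjection

end EffrosStormer

/-! ### Iterates of a UP map -/

section Iterates

variable {H : Type u} [NormedAddCommGroup H] [InnerProductSpace ℂ H] [CompleteSpace H]
variable {K : Type v} [NormedAddCommGroup K] [InnerProductSpace ℂ K] [CompleteSpace K]
variable {G : Type w} [NormedAddCommGroup G] [InnerProductSpace ℂ G] [CompleteSpace G]

lemma WTendsto.mul_left {ι : Type*} {l : Filter ι} {x : ι → H →L[ℂ] H} {a : H →L[ℂ] H}
    (b : H →L[ℂ] H) (h : WTendsto l x a) : WTendsto l (fun i => b * x i) (b * a) := fun ξ η => by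
  have := h (ContinuousLinearMap.adjoint b ξ) η
  simpa [ContinuousLinearMap.adjoint_inner_left] using this

lemma WTendsto.mul_right {ι : Type*} {l : Filter ι} {x : ι → H →L[ℂ] H} {a : H →L[ℂ] H}
    (b : H →L[ℂ] H) (h : WTendsto l x a) : WTendsto l (fun i => x i * b) (a * b) := fun ξ η =>
  h ξ (b η)

lemma IsUPMap.comp {M : DualOperatorSystem H} {N : DualOperatorSystem K}
    {L : DualOperatorSystem G} {g : N →ₗ[ℂ] L} {f : M →ₗ[ℂ] N} (hg : IsUPMap g) (hf : IsUPMap f) :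
    IsUPMap (g ∘ₗ f) where
  map_unit := by rw [LinearMap.comp_apply, hf.map_unit, hg.map_unit]
  map_nonneg := fun x hx => hg.map_nonneg _ (hf.map_nonneg x hx)
  normal := @Continuous.comp _ _ _ M.weakStar N.weakStar L.weakStar _ _ hg.normal hf.normal

lemma IsUPMap.id {M : DualOperatorSystem H} : IsUPMap (LinearMap.id : M →ₗ[ℂ] M) where
  map_unit := rfl
  map_nonneg := fun _ hx => hx
  normal := @continuous_id _ M.weakStar

lemma IsUPMap.pow {M : DualOperatorSystem H} {f : M →ₗ[ℂ] M} (hf : IsUPMap f) (n : ℕ) :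
    IsUPMap (f ^ n) := by
  induction n with
  | zero => exact IsUPMap.id
  | succ n ih => rw [pow_succ]; exact ih.comp hf

lemma IsUPMap.isPositiveUnital {M : DualOperatorSystem H} {N : DualOperatorSystem K}
    {f : M →ₗ[ℂ] N} (hf : IsUPMap f) : M.IsPositiveUnital (N.toSubmodule.subtype ∘ₗ f) where
  map_unit := congrArg Subtype.val hf.map_unit
  map_nonneg := hf.map_nonneg

/-- An extension of a linear map of an operator system to all bounded operators. -/
lemma exists_linear_extension (M : DualOperatorSystem H) (φ : M →ₗ[ℂ] M) :
    ∃ Φ : (H →L[ℂ] H) →ₗ[ℂ] (H →L[ℂ] H), ∀ x : M, Φ x = φ x := by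
  -- A purely algebraic extension, with no positivity or continuity off `M`. It serves only to write
  -- iterates without membership proofs.
  obtain ⟨Φ, hΦ⟩ := LinearMap.exists_extend (M.toSubmodule.subtype ∘ₗ φ)
  exact ⟨Φ, fun x => LinearMap.congr_fun hΦ x⟩

variable {M : DualOperatorSystem H} {φ : M →ₗ[ℂ] M} {Φ : (H →L[ℂ] H) →ₗ[ℂ] (H →L[ℂ] H)}

lemma extension_pow_apply (hΦ : ∀ x : M, Φ x = φ x) (n : ℕ) (x : M) :
    (Φ ^ n) x = ((φ ^ n) x : M) := by
  induction n generalizing x with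
  | zero => rfl
  | succ n ih => rw [pow_succ, pow_succ, Module.End.mul_apply, Module.End.mul_apply, hΦ, ih]

lemma extension_pow_mem (hΦ : ∀ x : M, Φ x = φ x) (n : ℕ) {x : H →L[ℂ] H}
    (hx : x ∈ M.toSubmodule) : (Φ ^ n) x ∈ M.toSubmodule := by
  rw [extension_pow_apply hΦ n ⟨x, hx⟩]
  exact ((φ ^ n) _).2

lemma extension_pow_nonneg (hφ : IsUPMap φ) (hΦ : ∀ x : M, Φ x = φ x) (n : ℕ) {x : H →L[ℂ] H}
    (hx : x ∈ M.toSubmodule) (h0 : 0 ≤ x) : 0 ≤ (Φ ^ n) x := by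
  rw [extension_pow_apply hΦ n ⟨x, hx⟩]
  exact (hφ.pow n).map_nonneg _ h0

lemma norm_extension_pow_le (hφ : IsUPMap φ) (hΦ : ∀ x : M, Φ x = φ x) (n : ℕ) {x : H →L[ℂ] H}
    (hx : x ∈ M.toSubmodule) : ‖(Φ ^ n) x‖ ≤ 2 * ‖x‖ := by
  rw [extension_pow_apply hΦ n ⟨x, hx⟩]
  exact (hφ.pow n).isPositiveUnital.norm_le ⟨x, hx⟩

lemma extension_pow_one (hφ : IsUPMap φ) (hΦ : ∀ x : M, Φ x = φ x) (n : ℕ) : (Φ ^ n) 1 = 1 := by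
  rw [extension_pow_apply hΦ n ⟨1, M.one_mem'⟩]
  exact congrArg Subtype.val (hφ.pow n).map_unit

lemma wtendsto_extension_pow (hφ : IsUPMap φ) (hΦ : ∀ x : M, Φ x = φ x) (n : ℕ) {ι : Type*}
    {l : Filter ι} {x : ι → H →L[ℂ] H} {a : H →L[ℂ] H} {C : ℝ} (hxM : ∀ i, x i ∈ M.toSubmodule)
    (ha : a ∈ M.toSubmodule) (hx : ∀ᶠ i in l, ‖x i‖ ≤ C) (h : WTendsto l x a) :
    WTendsto l (fun i => (Φ ^ n) (x i)) ((Φ ^ n) a) := by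
  have h1 := wtendsto_of_continuous_weakStar (hφ.pow n).normal (x := fun i => ⟨x i, hxM i⟩)
    (a := ⟨a, ha⟩) hx h
  have h2 : ∀ i, (Φ ^ n) (x i) = ((φ ^ n) ⟨x i, hxM i⟩ : M) := fun i =>
    extension_pow_apply hΦ n ⟨x i, hxM i⟩
  simp only [h2]
  rw [extension_pow_apply hΦ n ⟨a, ha⟩]
  exact h1

end Iterates

/-! ### The projection onto inverse sequences -/

section LimitProjection

variable {H : Type u} [NormedAddCommGroup H] [InnerProductSpace ℂ H] [CompleteSpace H]

/-- The star-algebra of bounded sequences in a von Neumann algebra. -/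
def boundedSequences (M : VonNeumannAlgebra H) : StarSubalgebra ℂ (ℕ → H →L[ℂ] H) where
  carrier := {x | (∀ k, x k ∈ M.toStarSubalgebra) ∧ ∃ C : ℝ, ∀ k, ‖x k‖ ≤ C}
  mul_mem' := by
    rintro x y ⟨hx, C, hC⟩ ⟨hy, D, hD⟩
    exact ⟨fun k => mul_mem (hx k) (hy k), C * D, fun k => (norm_mul_le _ _).trans
      (mul_le_mul (hC k) (hD k) (norm_nonneg _) ((norm_nonneg _).trans (hC k)))⟩
  add_mem' := by
    rintro x y ⟨hx, C, hC⟩ ⟨hy, D, hD⟩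
    exact ⟨fun k => add_mem (hx k) (hy k), C + D, fun k => (norm_add_le _ _).trans
      (add_le_add (hC k) (hD k))⟩
  algebraMap_mem' := fun r => ⟨fun k => M.toStarSubalgebra.algebraMap_mem r,
    ‖algebraMap ℂ (H →L[ℂ] H) r‖, fun k => le_rfl⟩
  star_mem' := by
    rintro x ⟨hx, C, hC⟩
    exact ⟨fun k => star_mem (hx k), C, fun k => by
      rw [Pi.star_apply, norm_star]; exact hC k⟩

lemma mem_boundedSequences {M : VonNeumannAlgebra H} {x : ℕ → H →L[ℂ] H} :
    x ∈ boundedSequences M ↔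
      (∀ k, x k ∈ M.toDualOperatorSystem.toSubmodule) ∧ ∃ C : ℝ, ∀ k, ‖x k‖ ≤ C := Iff.rfl

/-- The idempotent map onto the inverse sequences of `φ`, obtained as a limit of the iterates of
`φ` along an ultrafilter. -/
structure IsLimitProjection (M : VonNeumannAlgebra H) (Φ : (H →L[ℂ] H) →ₗ[ℂ] (H →L[ℂ] H))
    (P : (ℕ → H →L[ℂ] H) →ₗ[ℂ] (ℕ → H →L[ℂ] H)) : Prop
    extends IsPositiveProjection (boundedSequences M) P where
  wtendsto : ∀ x ∈ boundedSequences M, ∀ m,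
    WTendsto (hyperfilter ℕ : Filter ℕ) (fun k => (Φ ^ (k - m)) (x k)) (P x m)
  norm_le : ∀ x ∈ boundedSequences M, ∀ C : ℝ, (∀ k, ‖x k‖ ≤ C) → ∀ m, ‖P x m‖ ≤ 2 * C
  map_succ : ∀ x ∈ boundedSequences M, ∀ k, Φ (P x (k + 1)) = P x k
  eq_self : ∀ x ∈ boundedSequences M, (∀ k, Φ (x (k + 1)) = x k) → P x = x

lemma pow_apply_of_inverse {Φ : (H →L[ℂ] H) →ₗ[ℂ] (H →L[ℂ] H)} {x : ℕ → H →L[ℂ] H}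
    (hx : ∀ k, Φ (x (k + 1)) = x k) (m n : ℕ) : (Φ ^ n) (x (m + n)) = x m := by
  induction n with
  | zero => rfl
  | succ n ih => rw [pow_succ, Module.End.mul_apply, ← add_assoc, hx, ih]

lemma eventually_hyperfilter_ge (m : ℕ) : ∀ᶠ k in (hyperfilter ℕ : Filter ℕ), m ≤ k :=
  Nat.hyperfilter_le_atTop (eventually_ge_atTop m)

/-- Normality of `φ` lets it pass through the ultrafilter limit, so `Φ (P x (m + 1)) = P x m` and
values of `P` are inverse sequences. Conversely, for an inverse sequence the terms `Φᵏ⁻ᵐ (xₖ)` equal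
`xₘ` for all `k ≥ m`, so `P` fixes it. Together these give idempotence; positivity passes to the
limit. -/
theorem exists_isLimitProjection (M : VonNeumannAlgebra H)
    {φ : M.toDualOperatorSystem →ₗ[ℂ] M.toDualOperatorSystem} (hφ : IsUPMap φ)
    {Φ : (H →L[ℂ] H) →ₗ[ℂ] (H →L[ℂ] H)} (hΦ : ∀ x : M.toDualOperatorSystem, Φ x = φ x) :
    ∃ P, IsLimitProjection M Φ P := by
  have hex : ∀ (x : boundedSequences M) (m : ℕ), ∃ a : H →L[ℂ] H,
      WTendsto (hyperfilter ℕ : Filter ℕ) (fun k => (Φ ^ (k - m)) (x.1 k)) a := fun x m => by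
    obtain ⟨C, hC⟩ := x.2.2
    obtain ⟨a, ha, -⟩ := exists_wtendsto (hyperfilter ℕ) (C := 2 * C)
      (x := fun k => (Φ ^ (k - m)) (x.1 k)) (Eventually.of_forall fun k =>
        (norm_extension_pow_le hφ hΦ _ (x.2.1 k)).trans
          (mul_le_mul_of_nonneg_left (hC k) zero_le_two))
    exact ⟨a, ha⟩
  choose p hp using hex
  let P₀ : (boundedSequences M).toSubalgebra.toSubmodule →ₗ[ℂ] (ℕ → H →L[ℂ] H) :=
    { toFun := fun x => p ⟨x.1, x.2⟩
      map_add' := fun x y => funext fun m => (hp _ m).unique (by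
        simpa using (hp ⟨x.1, x.2⟩ m).add (hp ⟨y.1, y.2⟩ m))
      map_smul' := fun c x => funext fun m => (hp _ m).unique (by
        simpa using (hp ⟨x.1, x.2⟩ m).smul c) }
  -- Off the bounded sequences the values of `P` are arbitrary.
  obtain ⟨P, hP⟩ := LinearMap.exists_extend P₀
  have hw : ∀ x ∈ boundedSequences M, ∀ m,
      WTendsto (hyperfilter ℕ : Filter ℕ) (fun k => (Φ ^ (k - m)) (x k)) (P x m) := by
    intro x hx m
    have : P x = p ⟨x, hx⟩ := LinearMap.congr_fun hP ⟨x, hx⟩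
    rw [this]
    exact hp ⟨x, hx⟩ m
  have hbound : ∀ x ∈ boundedSequences M, ∀ C : ℝ, (∀ k, ‖x k‖ ≤ C) →
      ∀ m, ∀ k, ‖(Φ ^ (k - m)) (x k)‖ ≤ 2 * C := fun x hx C hC m k =>
    (norm_extension_pow_le hφ hΦ _ (hx.1 k)).trans
          (mul_le_mul_of_nonneg_left (hC k) zero_le_two)
  have hnorm : ∀ x ∈ boundedSequences M, ∀ C : ℝ, (∀ k, ‖x k‖ ≤ C) → ∀ m, ‖P x m‖ ≤ 2 * C :=
    fun x hx C hC m => (hw x hx m).norm_le (Eventually.of_forall (hbound x hx C hC m))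
  have hmem : ∀ x ∈ boundedSequences M, P x ∈ boundedSequences M := by
    intro x hx
    obtain ⟨C, hC⟩ := hx.2
    exact ⟨fun m => M.toDualOperatorSystem.mem_of_wtendsto (Eventually.of_forall fun k =>
      ⟨extension_pow_mem hΦ _ (hx.1 k), hbound x hx C hC m k⟩) (hw x hx m),
      2 * C, hnorm x hx C hC⟩
  have hsucc : ∀ x ∈ boundedSequences M, ∀ k, Φ (P x (k + 1)) = P x k := by
    intro x hx m
    obtain ⟨C, hC⟩ := hx.2
    have h1 := wtendsto_extension_pow hφ hΦ 1
      (fun k => extension_pow_mem hΦ (k - (m + 1)) (hx.1 k)) ((hmem x hx).1 (m + 1))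
      (Eventually.of_forall (hbound x hx C hC (m + 1))) (hw x hx (m + 1))
    rw [pow_one] at h1
    refine h1.unique ((hw x hx m).congr' ?_)
    filter_upwards [eventually_hyperfilter_ge (m + 1)] with k hk
    rw [← Module.End.mul_apply, ← pow_succ']
    congr 2
    omega
  have hself : ∀ x ∈ boundedSequences M, (∀ k, Φ (x (k + 1)) = x k) → P x = x := by
    intro x hx hxs
    funext m
    refine ((hw x hx m).congr' ?_).unique (WTendsto.const (l := (hyperfilter ℕ : Filter ℕ)) (x m))
    -- For `k < m` the truncated exponent `k - m` is `0`; the free ultrafilter ignores these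
    -- indices.
    filter_upwards [eventually_hyperfilter_ge m] with k hk
    have := pow_apply_of_inverse hxs m (k - m)
    rwa [Nat.add_sub_cancel' hk] at this
  refine ⟨P, ⟨fun x hx => hx.2, hmem, ?_, ?_, fun x hx => hself _ (hmem x hx) (hsucc x hx)⟩,
    hw, hnorm, hsucc, hself⟩
  · intro x hx h0 m
    exact (hw x hx m).nonneg (Eventually.of_forall fun k =>
      extension_pow_nonneg hφ hΦ _ (hx.1 k) (h0 k))
  · refine hself 1 (one_mem _) fun k => ?_
    have := extension_pow_one hφ hΦ 1
    rwa [pow_one] at this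

end LimitProjection

/-! ### Maps that are weakly continuous on bounded sets -/

section FixedNormal

variable {H : Type u} [NormedAddCommGroup H] [InnerProductSpace ℂ H] [CompleteSpace H]
variable {ι : Type*}

/-- A linear map that leaves a space `S` of families of operators invariant, is bounded on it, and
respects weak limits of bounded families there. -/
structure FixedNormal (S : Submodule ℂ (ι → H →L[ℂ] H))
    (T : (ι → H →L[ℂ] H) →ₗ[ℂ] (ι → H →L[ℂ] H)) : Prop where
  map_mem : ∀ x ∈ S, T x ∈ S
  bounded : ∃ B : ℝ, ∀ x ∈ S, ∀ C : ℝ, (∀ i, ‖x i‖ ≤ C) → ∀ i, ‖T x i‖ ≤ B * C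
  wtendsto : ∀ (l : Filter (ι → H →L[ℂ] H)) (a : ι → H →L[ℂ] H) (C : ℝ), a ∈ S →
    (∀ᶠ x in l, x ∈ S ∧ ∀ i, ‖x i‖ ≤ C) → (∀ i, WTendsto l (fun x => x i) (a i)) →
      ∀ i, WTendsto l (fun x => T x i) (T a i)

namespace FixedNormal

variable {S : Submodule ℂ (ι → H →L[ℂ] H)} {T U : (ι → H →L[ℂ] H) →ₗ[ℂ] (ι → H →L[ℂ] H)}

lemma comp (hT : FixedNormal S T) (hU : FixedNormal S U) : FixedNormal S (T ∘ₗ U) := by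
  obtain ⟨B, hB⟩ := hT.bounded
  obtain ⟨D, hD⟩ := hU.bounded
  refine ⟨fun x hx => hT.map_mem _ (hU.map_mem x hx), ⟨B * D, fun x hx C hC i => ?_⟩, ?_⟩
  · rw [mul_assoc]
    exact hB _ (hU.map_mem x hx) _ (hD x hx C hC) i
  · intro l a C ha hC h i
    have h1 := hT.wtendsto (l.map U) (U a) (D * C) (hU.map_mem _ ha)
      (eventually_map.2 (hC.mono fun x hx => ⟨hU.map_mem _ hx.1, hD _ hx.1 _ hx.2⟩))
      (fun i ξ η => tendsto_map'_iff.2 (hU.wtendsto l a C ha hC h i ξ η)) i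
    exact fun ξ η => tendsto_map'_iff.1 (h1 ξ η)

lemma sub (hT : FixedNormal S T) (hU : FixedNormal S U) : FixedNormal S (T - U) := by
  obtain ⟨B, hB⟩ := hT.bounded
  obtain ⟨D, hD⟩ := hU.bounded
  refine ⟨fun x hx => S.sub_mem (hT.map_mem x hx) (hU.map_mem x hx),
    ⟨B + D, fun x hx C hC i => ?_⟩, ?_⟩
  · rw [add_mul]
    exact (norm_sub_le _ _).trans (add_le_add (hB x hx C hC i) (hD x hx C hC i))
  · intro l a C ha hC h i
    exact (hT.wtendsto l a C ha hC h i).sub (hU.wtendsto l a C ha hC h i)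

lemma smul (c : ℂ) (hT : FixedNormal S T) : FixedNormal S (c • T) := by
  obtain ⟨B, hB⟩ := hT.bounded
  refine ⟨fun x hx => S.smul_mem c (hT.map_mem x hx), ⟨‖c‖ * B, fun x hx C hC i => ?_⟩, ?_⟩
  · rw [LinearMap.smul_apply, Pi.smul_apply, norm_smul, mul_assoc]
    exact mul_le_mul_of_nonneg_left (hB x hx C hC i) (norm_nonneg _)
  · intro l a C ha hC h i
    simp only [LinearMap.smul_apply, Pi.smul_apply]
    exact (hT.wtendsto l a C ha hC h i).smul c

lemma id : FixedNormal S LinearMap.id :=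
  ⟨fun _ hx => hx, ⟨1, fun x _ C hC i => by simpa using hC i⟩, fun _ _ _ _ _ h => h⟩

lemma congr (hT : FixedNormal S T) (h : ∀ x ∈ S, U x = T x) : FixedNormal S U := by
  obtain ⟨B, hB⟩ := hT.bounded
  refine ⟨fun x hx => h x hx ▸ hT.map_mem x hx, ⟨B, fun x hx C hC i => by
    rw [h x hx]; exact hB x hx C hC i⟩, ?_⟩
  intro l a C ha hC hl i
  rw [h a ha]
  exact (hT.wtendsto l a C ha hC hl i).congr' (hC.mono fun x hx => by
    simp only [h _ hx.1])

end FixedNormal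

end FixedNormal

/-! ### Normality of Jordan multiplication and of compressions on the fixed points -/

section Normality

open scoped ComplexOrder

variable {H : Type u} [NormedAddCommGroup H] [InnerProductSpace ℂ H] [CompleteSpace H]

/-- The space of fixed points of `P` in `R`. -/
def fixedSpace {ι : Type*} (R : StarSubalgebra ℂ (ι → H →L[ℂ] H))
    (P : (ι → H →L[ℂ] H) →ₗ[ℂ] (ι → H →L[ℂ] H)) : Submodule ℂ (ι → H →L[ℂ] H) :=
  R.toSubalgebra.toSubmodule ⊓ LinearMap.eqLocus P LinearMap.id

lemma mem_fixedSpace {ι : Type*} {R : StarSubalgebra ℂ (ι → H →L[ℂ] H)}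
    {P : (ι → H →L[ℂ] H) →ₗ[ℂ] (ι → H →L[ℂ] H)} {x : ι → H →L[ℂ] H} :
    x ∈ fixedSpace R P ↔ x ∈ R ∧ P x = x := Iff.rfl

/-- The self-adjoint part of a family of operators. -/
def piRe {ι : Type*} (d : ι → H →L[ℂ] H) : ι → H →L[ℂ] H := (2⁻¹ : ℂ) • (d + star d)

/-- The imaginary part of a family of operators. -/
def piIm {ι : Type*} (d : ι → H →L[ℂ] H) : ι → H →L[ℂ] H := (-(Complex.I * 2⁻¹) : ℂ) • (d - star d)

section Parts

variable {ι : Type*}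

lemma piRe_add_piIm (d : ι → H →L[ℂ] H) : piRe d + Complex.I • piIm d = d := by
  simp only [piRe, piIm, smul_smul, smul_add, smul_sub]
  match_scalars
  · ring_nf; simp; ring
  · ring_nf; simp

lemma norm_piRe_le {d : ι → H →L[ℂ] H} {C : ℝ} (h : ∀ i, ‖d i‖ ≤ C) (i : ι) : ‖piRe d i‖ ≤ C := by
  have h1 : ‖piRe d i‖ = 2⁻¹ * ‖d i + star (d i)‖ := by
    show ‖(2⁻¹ : ℂ) • (d i + star (d i))‖ = _
    rw [norm_smul]; norm_num
  have h2 := norm_add_le (d i) (star (d i))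
  rw [norm_star] at h2
  linarith [h i]

lemma norm_piIm_le {d : ι → H →L[ℂ] H} {C : ℝ} (h : ∀ i, ‖d i‖ ≤ C) (i : ι) : ‖piIm d i‖ ≤ C := by
  have h1 : ‖piIm d i‖ = 2⁻¹ * ‖d i - star (d i)‖ := by
    show ‖(-(Complex.I * 2⁻¹) : ℂ) • (d i - star (d i))‖ = _
    rw [norm_smul]; norm_num
  have h2 := norm_sub_le (d i) (star (d i))
  rw [norm_star] at h2
  linarith [h i]

lemma wtendsto_piRe_zero {κ : Type*} {l : Filter κ} {d : κ → ι → H →L[ℂ] H} {i : ι}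
    (h : WTendsto l (fun j => d j i) 0) : WTendsto l (fun j => piRe (d j) i) 0 := by
  have := (h.add h.star).smul (2⁻¹ : ℂ)
  rwa [star_zero, add_zero, smul_zero] at this

lemma wtendsto_piIm_zero {κ : Type*} {l : Filter κ} {d : κ → ι → H →L[ℂ] H} {i : ι}
    (h : WTendsto l (fun j => d j i) 0) : WTendsto l (fun j => piIm (d j) i) 0 := by
  have := (h.sub h.star).smul (-(Complex.I * 2⁻¹) : ℂ)
  rwa [star_zero, sub_zero, smul_zero] at this

variable {R : StarSubalgebra ℂ (ι → H →L[ℂ] H)} {P : (ι → H →L[ℂ] H) →ₗ[ℂ] (ι → H →L[ℂ] H)}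

lemma piRe_mem_saFixed (hP : IsPositiveProjection R P) {d : ι → H →L[ℂ] H}
    (hd : d ∈ fixedSpace R P) : piRe d ∈ IsPositiveProjection.saFixed R P := by
  obtain ⟨hR, hPd⟩ := mem_fixedSpace.1 hd
  refine ⟨R.smul_mem (add_mem hR (star_mem hR)) _, ?_, ?_⟩
  · rw [piRe, star_smul, star_add, star_star, add_comm]; simp
  · rw [piRe, map_smul, map_add, hP.map_star hR, hPd]

lemma piIm_mem_saFixed (hP : IsPositiveProjection R P) {d : ι → H →L[ℂ] H}
    (hd : d ∈ fixedSpace R P) : piIm d ∈ IsPositiveProjection.saFixed R P := by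
  obtain ⟨hR, hPd⟩ := mem_fixedSpace.1 hd
  refine ⟨R.smul_mem (sub_mem hR (star_mem hR)) _, ?_, ?_⟩
  · rw [piIm, star_smul, star_sub, star_star, ← neg_sub, smul_neg, ← neg_smul]; simp
  · rw [piIm, map_smul, map_sub, hP.map_star hR, hPd]

end Parts

/-- The map `x ↦ P (s x + x s)`. -/
def jordanMap {ι : Type*} (P : (ι → H →L[ℂ] H) →ₗ[ℂ] (ι → H →L[ℂ] H)) (s : ι → H →L[ℂ] H) :
    (ι → H →L[ℂ] H) →ₗ[ℂ] (ι → H →L[ℂ] H) :=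
  P ∘ₗ (LinearMap.mulLeft ℂ s + LinearMap.mulRight ℂ s)

@[simp] lemma jordanMap_apply {ι : Type*} (P : (ι → H →L[ℂ] H) →ₗ[ℂ] (ι → H →L[ℂ] H))
    (s x : ι → H →L[ℂ] H) : jordanMap P s x = P (s * x + x * s) := rfl

open IsPositiveProjection

namespace IsLimitProjection

variable {M : VonNeumannAlgebra H} {φ : M.toDualOperatorSystem →ₗ[ℂ] M.toDualOperatorSystem}
variable {Φ : (H →L[ℂ] H) →ₗ[ℂ] (H →L[ℂ] H)} {P : (ℕ → H →L[ℂ] H) →ₗ[ℂ] (ℕ → H →L[ℂ] H)}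
variable (hφ : IsUPMap φ) (hΦ : ∀ x : M.toDualOperatorSystem, Φ x = φ x)
variable (hP : IsLimitProjection M Φ P)

include hP

lemma pow_apply {x : ℕ → H →L[ℂ] H} (hx : x ∈ boundedSequences M) {m k : ℕ} (hmk : m ≤ k) :
    (Φ ^ (k - m)) (P x k) = P x m := by
  have := pow_apply_of_inverse (hP.map_succ x hx) m (k - m)
  rwa [Nat.add_sub_cancel' hmk] at this

include hφ hΦ

/-- Cauchy-Schwarz for the defect form `P(xy + yx) - (xy + yx)`, pushed forward by an iterate. -/
lemma sq_re_inner_defect_le {s y : ℕ → H →L[ℂ] H} (hs : s ∈ saFixed (boundedSequences M) P)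
    (hy : y ∈ saFixed (boundedSequences M) P) {C : ℝ} (hC : ∀ k, ‖y k‖ ≤ C) {m k : ℕ} (hmk : m ≤ k)
    (h : H) :
    (inner ℂ h ((Φ ^ (k - m)) ((P (s * y + y * s) - (s * y + y * s)) k) h) : ℂ).re ^ 2 ≤
      4 * (inner ℂ h ((Φ ^ (k - m)) ((P (s * s) - s * s) k) h) : ℂ).re *
        (2 * (C * C) * ‖h‖ ^ 2) := by
  let F : (ℕ → H →L[ℂ] H) → ℝ := fun x => (inner ℂ h ((Φ ^ (k - m)) (x k) h) : ℂ).re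
  have Fadd : ∀ x y, F (x + y) = F x + F y := fun x y => by
    simp [F]
  have Fsmul : ∀ (t : ℝ) x, F ((t : ℂ) • x) = t * F x := fun t x => by
    simp [F]
  have hF0 : ∀ x ∈ boundedSequences M, 0 ≤ x → 0 ≤ F x := fun x hx h0 =>
    (Complex.le_def.1 (ContinuousLinearMap.nonneg_iff_inner.1
      (extension_pow_nonneg hφ hΦ _ (hx.1 k) (h0 k)) h)).1
  -- Positivity of the defect of `y + t s`, pushed forward by an iterate, is a quadratic inequality
  -- in `t`; its discriminant yields Cauchy-Schwarz.
  have hquad : ∀ t : ℝ, 0 ≤ F (P (s * s) - s * s) * (t * t) +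
      F (P (s * y + y * s) - (s * y + y * s)) * t + F (P (y * y) - y * y) := by
    intro t
    have hz : y + (t : ℂ) • s ∈ boundedSequences M :=
      add_mem hy.1 ((boundedSequences M).smul_mem hs.1 _)
    have h1 := hP.defect_nonneg hz (by simp [hs.2.1, hy.2.1]) (by simp [hs.2.2, hy.2.2])
    have h2 := hF0 _ (sub_mem (hP.map_mem _ (mul_mem hz hz)) (mul_mem hz hz)) h1
    have hexp : (y + (t : ℂ) • s) * (y + (t : ℂ) • s) =
        ((t * t : ℝ) : ℂ) • (s * s) + (t : ℂ) • (s * y + y * s) + y * y := by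
      simp only [add_mul, mul_add, smul_mul_assoc, mul_smul_comm, smul_smul, smul_add]
      push_cast
      abel
    have hexp2 : P ((y + (t : ℂ) • s) * (y + (t : ℂ) • s)) - (y + (t : ℂ) • s) * (y + (t : ℂ) • s) =
        ((t * t : ℝ) : ℂ) • (P (s * s) - s * s) +
          (t : ℂ) • (P (s * y + y * s) - (s * y + y * s)) + (P (y * y) - y * y) := by
      rw [hexp, map_add, map_add, map_smul, map_smul, smul_sub, smul_sub]
      abel
    rw [hexp2, Fadd, Fadd, Fsmul, Fsmul] at h2
    linarith
  have hd := discrim_le_zero hquad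
  rw [discrim] at hd
  have hyy : y * y ∈ boundedSequences M := mul_mem hy.1 hy.1
  -- Dropping `F (y²) ≥ 0` leaves `F (P (y²))`. Because `P (y²)` is an inverse sequence, the iterate
  -- returns its coordinate `m`, and the bound does not depend on `k`.
  have hle : F (P (y * y) - y * y) ≤ 2 * (C * C) * ‖h‖ ^ 2 := by
    have h1 : 0 ≤ y * y := by
      have := Pi.star_mul_self_nonneg y
      rwa [hy.2.1] at this
    have h2 : F (P (y * y)) ≤ 2 * (C * C) * ‖h‖ ^ 2 := by
      have h3 := hP.norm_le _ hyy (C * C) (fun k => (norm_mul_le _ _).trans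
        (mul_le_mul (hC k) (hC k) (norm_nonneg _) ((norm_nonneg _).trans (hC k)))) m
      have h4 : F (P (y * y)) = (inner ℂ h (P (y * y) m h) : ℂ).re := by
        simp only [F, hP.pow_apply hyy hmk]
      rw [h4]
      refine ((Complex.re_le_norm _).trans (norm_inner_apply_le _ _ _)).trans ?_
      calc ‖P (y * y) m‖ * ‖h‖ * ‖h‖ = ‖P (y * y) m‖ * ‖h‖ ^ 2 := by ring
        _ ≤ _ := mul_le_mul_of_nonneg_right h3 (sq_nonneg _)
    have h3 : F (P (y * y)) = F (P (y * y) - y * y) + F (y * y) := by rw [← Fadd, sub_add_cancel]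
    linarith [hF0 _ hyy h1]
  have hs0 : 0 ≤ F (P (s * s) - s * s) :=
    hF0 _ (sub_mem (hP.map_mem _ (mul_mem hs.1 hs.1)) (mul_mem hs.1 hs.1))
      (hP.defect_nonneg hs.1 hs.2.1 hs.2.2)
  have hfin := mul_le_mul_of_nonneg_left hle (mul_nonneg zero_le_four hs0)
  simp only [F] at *
  linarith

/-- `P` annihilates the defect, and its coordinates are by construction the limits of the
pushed-forward defect. -/
lemma tendsto_inner_defect {s : ℕ → H →L[ℂ] H} (hs : s ∈ saFixed (boundedSequences M) P) (m : ℕ)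
    (h : H) : Tendsto (fun k => (inner ℂ h ((Φ ^ (k - m)) ((P (s * s) - s * s) k) h) : ℂ).re)
      (hyperfilter ℕ : Filter ℕ) (𝓝 0) := by
  have hss : s * s ∈ boundedSequences M := mul_mem hs.1 hs.1
  have h1 := hP.wtendsto _ (sub_mem (hP.map_mem _ hss) hss) m h h
  rw [map_sub, hP.idem _ hss, sub_self] at h1
  simpa [Function.comp_def] using (Complex.continuous_re.tendsto _).comp h1

/-- For `k ≥ m` the coordinate `P (sy + ys)ₘ` splits into the `(k - m)`-th iterate of the defect at
`k` and that of `(sy + ys)ₖ`. Cauchy-Schwarz makes the first part small for one suitable `k`,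
uniformly over the bounded family. With that `k` held fixed, the second part tends to zero by
normality of `φ`. Continuity of `P` is not used. -/
lemma wtendsto_jordan_zero {s : ℕ → H →L[ℂ] H} (hs : s ∈ saFixed (boundedSequences M) P)
    {κ : Type*} {l : Filter κ} {y : κ → ℕ → H →L[ℂ] H}
    (hy : ∀ j, y j ∈ saFixed (boundedSequences M) P) {C : ℝ} (hC : ∀ᶠ j in l, ∀ k, ‖y j k‖ ≤ C)
    (hlim : ∀ k, WTendsto l (fun j => y j k) 0) (m : ℕ) :
    WTendsto l (fun j => P (s * y j + y j * s) m) 0 := by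
  refine wtendsto_of_diag fun h => ?_
  have hsy : ∀ j, s * y j + y j * s ∈ boundedSequences M := fun j =>
    add_mem (mul_mem hs.1 (hy j).1) (mul_mem (hy j).1 hs.1)
  have him : ∀ j, (inner ℂ h (P (s * y j + y j * s) m h) : ℂ) =
      ((inner ℂ h (P (s * y j + y j * s) m h) : ℂ).re : ℂ) := by
    intro j
    have hsa : star (P (s * y j + y j * s)) = P (s * y j + y j * s) :=
      hP.isSelfAdjoint (hsy j) (by simp [hs.2.1, (hy j).2.1, add_comm])
    have h1 : ContinuousLinearMap.adjoint (P (s * y j + y j * s) m) = P (s * y j + y j * s) m :=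
      congrFun hsa m
    refine (Complex.conj_eq_iff_re.1 ?_).symm
    rw [inner_conj_symm, ← ContinuousLinearMap.adjoint_inner_right, h1]
  suffices hre : Tendsto (fun j => (inner ℂ h (P (s * y j + y j * s) m h) : ℂ).re) l (𝓝 0) by
    have := (Complex.continuous_ofReal.tendsto _).comp hre
    simp only [Function.comp_def, ← him] at this
    simpa using this
  rw [Metric.tendsto_nhds]
  intro ε hε
  have h0 := ((hP.tendsto_inner_defect hφ hΦ hs m h).const_mul 4).mul_const
    (2 * (C * C) * ‖h‖ ^ 2)
  rw [mul_zero, zero_mul] at h0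
  -- The index `k` depends on `s`, `m`, `h`, `C` and `ε` but not on the member `j` of the family.
  obtain ⟨k, hk, hmk⟩ := ((h0.eventually (Iio_mem_nhds (show (0 : ℝ) < (ε / 2) ^ 2 by
    positivity))).and (eventually_hyperfilter_ge m)).exists
  have hlimk : Tendsto (fun j => (inner ℂ h ((Φ ^ (k - m)) ((s * y j + y j * s) k) h) : ℂ).re) l
      (𝓝 0) := by
    have h1 : WTendsto l (fun j => (s * y j + y j * s) k) 0 := by
      simpa using ((hlim k).mul_left (s k)).add ((hlim k).mul_right (s k))
    have h2 := wtendsto_extension_pow hφ hΦ (k - m) (fun j => (hsy j).1 k)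
      (M.toDualOperatorSystem.toSubmodule.zero_mem) (C := ‖s k‖ * C + C * ‖s k‖) (by
        filter_upwards [hC] with j hj
        refine (norm_add_le _ _).trans (add_le_add ?_ ?_)
        · exact (norm_mul_le _ _).trans (mul_le_mul_of_nonneg_left (hj k) (norm_nonneg _))
        · exact (norm_mul_le _ _).trans (mul_le_mul_of_nonneg_right (hj k) (norm_nonneg _))) h1
    simpa [Function.comp_def] using (Complex.continuous_re.tendsto _).comp (h2 h h)
  filter_upwards [hC, hlimk.eventually (Metric.ball_mem_nhds 0 (half_pos hε))] with j hj hj2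
  have h1 := hP.sq_re_inner_defect_le hφ hΦ hs (hy j) hj hmk h
  have h2 := abs_lt_of_sq_lt_sq (h1.trans_lt hk) (half_pos hε).le
  have h3 : (inner ℂ h (P (s * y j + y j * s) m h) : ℂ).re =
      (inner ℂ h ((Φ ^ (k - m)) ((P (s * y j + y j * s) - (s * y j + y j * s)) k) h) : ℂ).re +
      (inner ℂ h ((Φ ^ (k - m)) ((s * y j + y j * s) k) h) : ℂ).re := by
    rw [← Complex.add_re, ← inner_add_right, ← add_apply, ← map_add,
      Pi.sub_apply, sub_add_cancel, hP.pow_apply (hsy j) hmk]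
  rw [dist_zero_right, Real.norm_eq_abs] at hj2
  rw [dist_zero_right, Real.norm_eq_abs, h3]
  exact (abs_add_le _ _).trans_lt (by linarith)

lemma fixedNormal_jordanMap {s : ℕ → H →L[ℂ] H} (hs : s ∈ saFixed (boundedSequences M) P) :
    FixedNormal (fixedSpace (boundedSequences M) P) (jordanMap P s) := by
  have hR : ∀ x ∈ boundedSequences M, s * x + x * s ∈ boundedSequences M := fun x hx =>
    add_mem (mul_mem hs.1 hx) (mul_mem hx hs.1)
  obtain ⟨D, hD⟩ := hs.1.2
  refine ⟨fun x hx => ⟨hP.map_mem _ (hR x hx.1), hP.idem _ (hR x hx.1)⟩,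
    ⟨2 * (D + D), fun x hx C hC m => ?_⟩, ?_⟩
  · rw [mul_assoc]
    refine hP.norm_le _ (hR x hx.1) _ (fun k => ?_) m
    rw [add_mul]
    refine (norm_add_le _ _).trans (add_le_add ?_ ?_)
    · exact (norm_mul_le _ _).trans (mul_le_mul (hD k) (hC k) (norm_nonneg _)
        ((norm_nonneg _).trans (hD k)))
    · rw [mul_comm D]
      exact (norm_mul_le _ _).trans (mul_le_mul (hC k) (hD k) (norm_nonneg _)
        ((norm_nonneg _).trans (hC k)))
  · intro l a C ha hC hlim m
    obtain ⟨D, hD⟩ := ha.1.2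
    let S := fixedSpace (boundedSequences M) P
    let d : (ℕ → H →L[ℂ] H) → ℕ → H →L[ℂ] H := fun x => x - a
    have hl : ∀ᶠ x in l, x ∈ S := hC.mono fun x hx => hx.1
    -- The filter is moved to the subtype so that all members, not just eventually all, are fixed
    -- points.
    let l' : Filter S := l.comap Subtype.val
    have hmap : l'.map Subtype.val = l := Filter.map_comap_of_mem (by
      rw [Subtype.range_val]; exact hl)
    have hd : ∀ x : S, (x : ℕ → H →L[ℂ] H) - a ∈ S := fun x => S.sub_mem x.2 ha
    have hlim0 : ∀ k, WTendsto l' (fun x : S => ((x : ℕ → H →L[ℂ] H) - a) k) 0 := fun k => by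
      have h1 := hlim k
      rw [← hmap] at h1
      simpa using (wtendsto_map.1 h1).sub (WTendsto.const (a k))
    have hdC : ∀ᶠ x : S in l', ∀ k, ‖((x : ℕ → H →L[ℂ] H) - a) k‖ ≤ C + D := by
      rw [← hmap] at hC
      exact (eventually_map.1 hC).mono fun x hx k =>
        (norm_sub_le _ _).trans (add_le_add (hx.2 k) (hD k))
    have h1 := (hP.wtendsto_jordan_zero hφ hΦ hs
        (fun x => piRe_mem_saFixed hP.toIsPositiveProjection (hd x))
        (hdC.mono fun x hx => norm_piRe_le hx) (fun k => wtendsto_piRe_zero (hlim0 k)) m).add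
      ((hP.wtendsto_jordan_zero hφ hΦ hs
        (fun x => piIm_mem_saFixed hP.toIsPositiveProjection (hd x))
        (hdC.mono fun x hx => norm_piIm_le hx) (fun k => wtendsto_piIm_zero (hlim0 k)) m).smul
          Complex.I)
    rw [smul_zero, add_zero] at h1
    rw [← hmap]
    refine wtendsto_map.2 ?_
    have h2 : ∀ x : S, jordanMap P s x m = jordanMap P s a m +
        (P (s * piRe ((x : ℕ → H →L[ℂ] H) - a) + piRe ((x : ℕ → H →L[ℂ] H) - a) * s) m +
          Complex.I • P (s * piIm ((x : ℕ → H →L[ℂ] H) - a) +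
            piIm ((x : ℕ → H →L[ℂ] H) - a) * s) m) := fun x => by
      have h3 : (x : ℕ → H →L[ℂ] H) =
          a + (piRe ((x : ℕ → H →L[ℂ] H) - a) + Complex.I • piIm ((x : ℕ → H →L[ℂ] H) - a)) := by
        rw [piRe_add_piIm]; abel
      conv_lhs => rw [h3, map_add, map_add, map_smul]
      rfl
    simp only [h2]
    simpa using (WTendsto.const (jordanMap P s a m)).add h1

/-- Compression by a word in self-adjoint fixed points is normal on the space of fixed points. -/
lemma fixedNormal_word {w : ℕ → H →L[ℂ] H} (hw : w ∈ words (boundedSequences M) P) :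
    FixedNormal (fixedSpace (boundedSequences M) P)
      (P ∘ₗ LinearMap.mulLeft ℂ (star w) ∘ₗ LinearMap.mulRight ℂ w) := by
  have hP' := hP.toIsPositiveProjection
  induction hw using Submonoid.closure_induction with
  | mem s hs =>
    have hss : P (s * s) ∈ saFixed (boundedSequences M) P :=
      ⟨hP.map_mem _ (mul_mem hs.1 hs.1),
        hP.isSelfAdjoint (mul_mem hs.1 hs.1) (by rw [star_mul, hs.2.1]),
        hP.idem _ (mul_mem hs.1 hs.1)⟩
    have h1 := hP.fixedNormal_jordanMap hφ hΦ hs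
    have h2 := hP.fixedNormal_jordanMap hφ hΦ hss
    -- For `J_s x = P (sx + xs)`, `two_smul_map_mul_mul` reads `P (s x s) = (J_s² x - J_{P(s²)} x) /
    -- 2` on fixed points, so normality of the Jordan multiplications suffices.
    refine (((h1.comp h1).sub h2).smul (2⁻¹ : ℂ)).congr fun x hx => ?_
    have h3 := hP'.two_smul_map_mul_mul hs.1 hs.2.1 hs.2.2 hx.1
    rw [(mem_fixedSpace.1 hx).2] at h3
    simp only [LinearMap.comp_apply, LinearMap.mulLeft_apply, LinearMap.mulRight_apply,
      LinearMap.smul_apply, LinearMap.sub_apply, jordanMap_apply, hs.2.1]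
    rw [← h3, smul_smul, inv_mul_cancel₀ two_ne_zero, one_smul, mul_assoc]
  | one =>
    refine FixedNormal.id.congr fun x hx => ?_
    simpa using (mem_fixedSpace.1 hx).2
  | mul a b ha hb iha ihb =>
    refine (ihb.comp iha).congr fun x hx => ?_
    have haR : a ∈ boundedSequences M := words_le ha
    have h1 := hP'.map_star_word_mul_mul hb (star a * x * a)
      (mul_mem (mul_mem (star_mem haR) hx.1) haR)
    simp only [LinearMap.comp_apply, LinearMap.mulLeft_apply, LinearMap.mulRight_apply, star_mul]
    simp only [mul_assoc] at h1 ⊢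
    exact h1

end IsLimitProjection

end Normality

/-! ### Compactness of the self-adjoint ball and Hahn-Banach separation -/

section SelfAdjointBall

variable {H : Type u} [NormedAddCommGroup H] [InnerProductSpace ℂ H] [CompleteSpace H]
variable {K : Type v} [NormedAddCommGroup K] [InnerProductSpace ℂ K] [CompleteSpace K]

instance : T2Space (UltraweakSpace H) := by
  rw [t2_iff_nhds]
  intro x y h
  have h1 : WTendsto (𝓝 x ⊓ 𝓝 y) (fun z : UltraweakSpace H => (z : H →L[ℂ] H)) x :=
    wtendsto_of_tendsto_ultraweak (tendsto_id.mono_left inf_le_left)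
  exact h1.unique (wtendsto_of_tendsto_ultraweak (tendsto_id.mono_left inf_le_right))

lemma WTendsto.isSelfAdjoint {ι : Type*} {l : Filter ι} [l.NeBot] {x : ι → H →L[ℂ] H}
    {a : H →L[ℂ] H} (h : WTendsto l x a) (hx : ∀ᶠ i in l, IsSelfAdjoint (x i)) :
    IsSelfAdjoint a :=
  h.star.unique (h.congr' (hx.mono fun _ hi => hi.star_eq.symm))

namespace DualOperatorSystem

/-- The unit ball of the self-adjoint part. -/
def saBall (N : DualOperatorSystem H) : Set N :=
  {y | IsSelfAdjoint (y : H →L[ℂ] H) ∧ ‖(y : H →L[ℂ] H)‖ ≤ 1}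

lemma isCompact_saBall (N : DualOperatorSystem H) : @IsCompact _ N.weakStar N.saBall := by
  let _ := N.weakStar
  refine isCompact_iff_ultrafilter_le_nhds'.2 fun 𝒰 h𝒰 => ?_
  have hn : ∀ᶠ y : N in 𝒰, IsSelfAdjoint (y : H →L[ℂ] H) ∧ ‖(y : H →L[ℂ] H)‖ ≤ 1 := h𝒰
  obtain ⟨a, ha, haC⟩ := N.exists_wtendsto 𝒰 (x := id) (hn.mono fun _ h => h.2)
  refine ⟨a, ⟨ha.isSelfAdjoint (hn.mono fun _ h => h.1), haC⟩, ?_⟩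
  rw [@nhds_induced _ _ (ultraweakTopology H)]
  exact tendsto_iff_comap.1 (tendsto_ultraweak_of_bounded (hn.mono fun _ h => h.2) ha)

/-- If a self-adjoint element is dominated by the unit ball on all normal functionals, it lies in
the image of the unit ball. -/
lemma exists_mem_saBall_of_le_saNorm {M : DualOperatorSystem H} {N : DualOperatorSystem K}
    {E : N →ₗ[ℂ] M} (hE : IsUPMap E) {x : M} (hx : IsSelfAdjoint (x : H →L[ℂ] H))
    (h : ∀ ρ : M →ₗ[ℂ] ℂ, M.IsNormalFunctional ρ → ‖ρ x‖ₑ ≤ N.saNorm (ρ ∘ₗ E)) :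
    ∃ y ∈ N.saBall, E y = x := by
  by_contra! hcon
  let T : N →ₗ[ℂ] UltraweakSpace H := M.toSubmodule.subtype ∘ₗ E
  have hTc : Continuous[N.weakStar, inferInstance] T :=
    @Continuous.comp N M (UltraweakSpace H) N.weakStar M.weakStar (ultraweakTopology H) E
      (fun z => (z : H →L[ℂ] H)) (@continuous_induced_dom _ _ _ (ultraweakTopology H)) hE.normal
  have hcomp : IsCompact (T '' N.saBall) :=
    @IsCompact.image _ _ N.weakStar _ _ _ N.isCompact_saBall hTc
  have hconv : Convex ℝ (T '' N.saBall) := by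
    rintro _ ⟨y, hy, rfl⟩ _ ⟨z, hz, rfl⟩ s t hs ht hst
    refine ⟨(s : ℂ) • y + (t : ℂ) • z, ⟨?_, ?_⟩, ?_⟩
    · have h1 : IsSelfAdjoint ((s : ℂ)) := by simp [IsSelfAdjoint]
      have h2 : IsSelfAdjoint ((t : ℂ)) := by simp [IsSelfAdjoint]
      exact (h1.smul hy.1).add (h2.smul hz.1)
    · refine (norm_add_le ((s : ℂ) • (y : K →L[ℂ] K)) ((t : ℂ) • (z : K →L[ℂ] K))).trans ?_
      rw [norm_smul, norm_smul, Complex.norm_real, Complex.norm_real, Real.norm_eq_abs,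
        Real.norm_eq_abs, abs_of_nonneg hs, abs_of_nonneg ht]
      nlinarith [hy.2, hz.2]
    · rw [map_add, map_smul, map_smul]
      rfl
  let x' : UltraweakSpace H := (x : H →L[ℂ] H)
  have hxn : x' ∉ T '' N.saBall := by
    rintro ⟨y, hy, hyx⟩
    exact hcon y hy (Subtype.ext hyx)
  -- The image of the self-adjoint ball is convex and compact, hence closed in the Hausdorff
  -- ultraweak topology, so `x` can be separated from it.
  obtain ⟨f, r, hf, hr⟩ := RCLike.geometric_hahn_banach_closed_point (𝕜 := ℂ) hconv
    hcomp.isClosed hxn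
  -- The Hermitian part of `f`, which equals the real part of `f` on self-adjoint elements. Since
  -- the ball is symmetric, the one-sided bound on that real part becomes a bound on the norm of `ρ
  -- ∘ E`.
  let ρ : M →ₗ[ℂ] ℂ :=
    { toFun := fun z => (2⁻¹ : ℂ) * (f (z : H →L[ℂ] H) +
        starRingEnd ℂ (f (star (z : H →L[ℂ] H) : H →L[ℂ] H)))
      map_add' := fun a b => by
        have e1 : f ((a + b : M) : H →L[ℂ] H) = f (a : H →L[ℂ] H) + f (b : H →L[ℂ] H) :=
          f.map_add _ _
        have e2 : f (star ((a + b : M) : H →L[ℂ] H) : H →L[ℂ] H) =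
            f (star (a : H →L[ℂ] H) : H →L[ℂ] H) + f (star (b : H →L[ℂ] H) : H →L[ℂ] H) := by
          rw [Submodule.coe_add, star_add]
          exact f.map_add _ _
        rw [e1, e2, map_add]
        ring
      map_smul' := fun c a => by
        have e1 : f ((c • a : M) : H →L[ℂ] H) = c * f (a : H →L[ℂ] H) := f.map_smul _ _
        have e2 : f (star ((c • a : M) : H →L[ℂ] H) : H →L[ℂ] H) =
            star c * f (star (a : H →L[ℂ] H) : H →L[ℂ] H) := by
          rw [Submodule.coe_smul, star_smul]
          exact f.map_smul _ _
        rw [e1, e2, map_mul]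
        simp only [RCLike.star_def, Complex.conj_conj, RingHom.id_apply, smul_eq_mul]
        ring }
  have hρ : M.IsNormalFunctional ρ := by
    refine M.continuous_of_ballNormal ρ fun 𝒰 a C h𝒰 ha => ?_
    have t1 : Tendsto (fun z : M => f (z : H →L[ℂ] H)) 𝒰 (𝓝 (f (a : H →L[ℂ] H))) :=
      (f.continuous.tendsto _).comp (tendsto_ultraweak_of_bounded h𝒰 ha)
    have t2 : Tendsto (fun z : M => f (star (z : H →L[ℂ] H) : H →L[ℂ] H)) 𝒰
        (𝓝 (f (star (a : H →L[ℂ] H) : H →L[ℂ] H))) :=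
      (f.continuous.tendsto _).comp (tendsto_ultraweak_of_bounded (C := C)
        (h𝒰.mono fun z hz => by rwa [norm_star]) ha.star)
    exact (t1.add ((Complex.continuous_conj.tendsto _).comp t2)).const_mul _
  have hre : ∀ z : M, IsSelfAdjoint (z : H →L[ℂ] H) → ρ z = ((f (z : H →L[ℂ] H)).re : ℂ) := by
    intro z hz
    show (2⁻¹ : ℂ) * (f (z : H →L[ℂ] H) + starRingEnd ℂ (f (star (z : H →L[ℂ] H) : H →L[ℂ] H))) = _
    rw [hz.star_eq, Complex.add_conj]
    push_cast
    ring
  have hr0 : 0 < r := by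
    have := hf 0 ⟨0, ⟨by simp [IsSelfAdjoint], by simp⟩, map_zero T⟩
    simpa using this
  have hsup : N.saNorm (ρ ∘ₗ E) ≤ ENNReal.ofReal r := by
    refine iSup_le fun ⟨y, hy⟩ => ?_
    have h1 := hf (T y) ⟨y, hy, rfl⟩
    have h2 := hf (T (-y)) ⟨-y, ⟨hy.1.neg, by simpa using hy.2⟩, rfl⟩
    rw [map_neg, map_neg] at h2
    simp only [RCLike.re_to_complex, Complex.neg_re] at h1 h2
    have h3 : ρ (E y) = ((f (T y)).re : ℂ) := hre _ (hE.isPositiveUnital.isSelfAdjoint hy.1)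
    rw [LinearMap.comp_apply, h3, ← ofReal_norm, Complex.norm_real, Real.norm_eq_abs]
    exact ENNReal.ofReal_le_ofReal (abs_le.2 ⟨by linarith, h1.le⟩)
  have h4 := (h ρ hρ).trans hsup
  rw [hre x hx, ← ofReal_norm, Complex.norm_real, Real.norm_eq_abs,
    ENNReal.ofReal_le_ofReal_iff hr0.le] at h4
  exact absurd ((le_abs_self _).trans h4) (not_le.2 hr)

end DualOperatorSystem

end SelfAdjointBall

/-! ### The lift as the space of inverse sequences -/

section Orbits

variable {H : Type u} [NormedAddCommGroup H] [InnerProductSpace ℂ H] [CompleteSpace H]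
variable {K : Type v} [NormedAddCommGroup K] [InnerProductSpace ℂ K] [CompleteSpace K]

/-- The map `y ↦ (E y, E (α⁻¹ y), E (α⁻² y), …)`. -/
def orbitMap {M : DualOperatorSystem H} {N : DualOperatorSystem K} (α : N ≃ₗ[ℂ] N)
    (E : N →ₗ[ℂ] M) : N →ₗ[ℂ] (ℕ → H →L[ℂ] H) :=
  LinearMap.pi fun k => M.toSubmodule.subtype ∘ₗ E ∘ₗ (α.symm : N →ₗ[ℂ] N) ^ k

lemma orbitMap_apply {M : DualOperatorSystem H} {N : DualOperatorSystem K} (α : N ≃ₗ[ℂ] N)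
    (E : N →ₗ[ℂ] M) (y : N) (k : ℕ) :
    orbitMap α E y k = E (((α.symm : N →ₗ[ℂ] N) ^ k) y) := rfl

namespace IsAsymptoticLift

section

variable {M : DualOperatorSystem H} {N : DualOperatorSystem K} {φ : M →ₗ[ℂ] M}
variable {α : N ≃ₗ[ℂ] N} {E : N →ₗ[ℂ] M} (hl : IsAsymptoticLift φ α E)

include hl

lemma isUPMap_comp_symm_pow (k : ℕ) : IsUPMap (E ∘ₗ (α.symm : N →ₗ[ℂ] N) ^ k) :=
  hl.isUPMap.comp (hl.isUPIso.isUPMap_symm.pow k)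

lemma isPositiveUnital_orbitMap (k : ℕ) :
    N.IsPositiveUnital (LinearMap.proj k ∘ₗ orbitMap α E) :=
  (hl.isUPMap_comp_symm_pow k).isPositiveUnital

lemma norm_orbitMap_le (y : N) (k : ℕ) : ‖orbitMap α E y k‖ ≤ 2 * ‖(y : K →L[ℂ] K)‖ :=
  (hl.isPositiveUnital_orbitMap k).norm_le y

lemma orbitMap_unit : orbitMap α E N.unit = 1 :=
  funext fun k => (hl.isPositiveUnital_orbitMap k).map_unit

lemma orbitMap_adj (y : N) : orbitMap α E (N.adj y) = star (orbitMap α E y) :=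
  funext fun k => (hl.isPositiveUnital_orbitMap k).map_adj y

lemma wtendsto_orbitMap {ι : Type*} {l : Filter ι} {y : ι → N} {a : N} {C : ℝ}
    (hy : ∀ᶠ i in l, ‖(y i : K →L[ℂ] K)‖ ≤ C) (h : WTendsto l (fun i => (y i : K →L[ℂ] K)) a)
    (k : ℕ) : WTendsto l (fun i => orbitMap α E (y i) k) (orbitMap α E a k) :=
  wtendsto_of_continuous_weakStar (hl.isUPMap_comp_symm_pow k).normal hy h

lemma orbitMap_injective : Function.Injective (orbitMap α E) := by
  refine (injective_iff_map_eq_zero _).2 fun y hy => hl.nondegenerate y fun n => ?_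
  have h1 := congrFun hy n
  rw [orbitMap_apply, Module.End.pow_apply] at h1
  exact Subtype.ext h1

lemma map_orbitMap_succ {Φ : (H →L[ℂ] H) →ₗ[ℂ] (H →L[ℂ] H)} (hΦ : ∀ x : M, Φ x = φ x) (y : N)
    (k : ℕ) : Φ (orbitMap α E y (k + 1)) = orbitMap α E y k := by
  rw [orbitMap_apply, orbitMap_apply, hΦ, ← hl.equivariant, pow_succ', Module.End.mul_apply]
  simp

lemma equivariant_pow (j : ℕ) (y : N) : E (((α : N →ₗ[ℂ] N) ^ j) y) = (φ ^ j) (E y) := by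
  induction j with
  | zero => rfl
  | succ j ih =>
    rw [pow_succ', pow_succ', Module.End.mul_apply, Module.End.mul_apply, ← ih]
    exact hl.equivariant _

/-- Every self-adjoint inverse sequence in the unit ball comes from the lift. -/
lemma exists_orbitMap_eq_of_norm_le_one {x : ℕ → M}
    (hx : ∀ k, φ (x (k + 1)) = x k) (hs : ∀ k, IsSelfAdjoint (x k : H →L[ℂ] H))
    (h1 : ∀ k, ‖(x k : H →L[ℂ] H)‖ ≤ 1) :
    ∃ y ∈ N.saBall, ∀ k, orbitMap α E y k = x k := by
  have hpow : ∀ k j, (φ ^ j) (x (k + j)) = x k := fun k j => by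
    induction j with
    | zero => rfl
    | succ j ih => rw [pow_succ, Module.End.mul_apply, ← add_assoc, hx, ih]
  -- As `x k = φʲ (x (k + j))` with `x (k + j)` in the ball, `|ρ (x k)|` is at most the norm of `ρ ∘
  -- φʲ` for every `j`; the limit axiom bounds it by the norm of `ρ ∘ E`.
  have hex : ∀ k, ∃ y ∈ N.saBall, E y = x k := fun k =>
    DualOperatorSystem.exists_mem_saBall_of_le_saNorm hl.isUPMap (hs k) fun ρ hρ => by
      refine ge_of_tendsto' (hl.tendsto_saNorm ρ hρ) fun j => ?_
      rw [← hpow k j]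
      exact le_iSup (fun z : {z : M // IsSelfAdjoint (z : H →L[ℂ] H) ∧ ‖(z : H →L[ℂ] H)‖ ≤ 1} =>
        ‖(ρ ∘ₗ φ ^ j) z.1‖ₑ) ⟨x (k + j), hs _, h1 _⟩
  choose y hy hyx using hex
  have hup := fun k => (hl.isUPIso.isUPMap.pow k).isPositiveUnital
  -- For `j ≤ k` one has `E (α⁻ʲ (z k)) = φᵏ⁻ʲ (x k) = x j`. The orbit of `z k` thus agrees with `x`
  -- up to index `k`, and that of a weak limit agrees everywhere.
  let z : ℕ → N := fun k => ((α : N →ₗ[ℂ] N) ^ k) (y k)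
  have hzs : ∀ k, IsSelfAdjoint (z k : K →L[ℂ] K) := fun k => (hup k).isSelfAdjoint (hy k).1
  have hzn : ∀ k, ‖(z k : K →L[ℂ] K)‖ ≤ 1 := fun k =>
    ((hup k).norm_le_of_isSelfAdjoint (hy k).1).trans (hy k).2
  obtain ⟨a, ha, han⟩ := N.exists_wtendsto (hyperfilter ℕ) (Eventually.of_forall hzn)
  refine ⟨a, ⟨ha.isSelfAdjoint (Eventually.of_forall hzs), han⟩, fun j => ?_⟩
  refine (hl.wtendsto_orbitMap (Eventually.of_forall hzn) ha j).unique
    ((WTendsto.const (x j : H →L[ℂ] H)).congr' ?_)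
  filter_upwards [eventually_hyperfilter_ge j] with k hk
  obtain ⟨i, rfl⟩ := Nat.exists_eq_add_of_le hk
  have hcancel : ((α.symm : N →ₗ[ℂ] N) ^ j) (((α : N →ₗ[ℂ] N) ^ j)
      (((α : N →ₗ[ℂ] N) ^ i) (y (j + i)))) = ((α : N →ₗ[ℂ] N) ^ i) (y (j + i)) := by
    rw [← Module.End.mul_apply, ← Commute.mul_pow]
    · have : (α.symm : N →ₗ[ℂ] N) * (α : N →ₗ[ℂ] N) = 1 := by ext1 v; simp
      rw [this, one_pow, Module.End.one_apply]
    · ext1 v; simp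
  rw [orbitMap_apply]
  show _ = ((E (((α.symm : N →ₗ[ℂ] N) ^ j) (((α : N →ₗ[ℂ] N) ^ (j + i)) (y (j + i)))) : M) :
    H →L[ℂ] H)
  rw [pow_add, Module.End.mul_apply, hcancel, hl.equivariant_pow, hyx, hpow]

end

section

variable {M : VonNeumannAlgebra H} {φ : M.toDualOperatorSystem →ₗ[ℂ] M.toDualOperatorSystem}
variable {Φ : (H →L[ℂ] H) →ₗ[ℂ] (H →L[ℂ] H)} {P : (ℕ → H →L[ℂ] H) →ₗ[ℂ] (ℕ → H →L[ℂ] H)}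
variable {N : DualOperatorSystem K} {α : N ≃ₗ[ℂ] N} {E : N →ₗ[ℂ] M.toDualOperatorSystem}
variable (hφ : IsUPMap φ) (hΦ : ∀ x : M.toDualOperatorSystem, Φ x = φ x)
variable (hP : IsLimitProjection M Φ P) (hl : IsAsymptoticLift φ α E)

include hl hΦ hP

lemma orbitMap_mem (y : N) : orbitMap α E y ∈ fixedSpace (boundedSequences M) P := by
  have h1 : orbitMap α E y ∈ boundedSequences M :=
    mem_boundedSequences.2 ⟨fun k => (E _).2, 2 * ‖(y : K →L[ℂ] K)‖, hl.norm_orbitMap_le y⟩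
  exact ⟨h1, hP.eq_self _ h1 (hl.map_orbitMap_succ hΦ y)⟩

include hφ

/-- The norm bound on the preimage is the point: with injectivity it makes the orbit map
norm-preserving on self-adjoint elements. -/
lemma exists_orbitMap_eq_of_mem_saFixed {x : ℕ → H →L[ℂ] H}
    (hx : x ∈ IsPositiveProjection.saFixed (boundedSequences M) P) {C : ℝ} (hC : 0 < C)
    (hn : ∀ k, ‖x k‖ ≤ C) :
    ∃ y : N, IsSelfAdjoint (y : K →L[ℂ] K) ∧ ‖(y : K →L[ℂ] K)‖ ≤ C ∧ orbitMap α E y = x := by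
  have hCC : (C : ℂ) ≠ 0 := by exact_mod_cast hC.ne'
  let z : ℕ → M.toDualOperatorSystem := fun k => (C⁻¹ : ℂ) • ⟨x k, hx.1.1 k⟩
  have hz : ∀ k, (z k : H →L[ℂ] H) = (C⁻¹ : ℂ) • x k := fun k => rfl
  have hself : IsSelfAdjoint (C : ℂ) := by simp [IsSelfAdjoint]
  obtain ⟨y, hy, hyx⟩ := hl.exists_orbitMap_eq_of_norm_le_one (x := z) (fun k => by
      apply Subtype.ext
      rw [← hΦ, hz, hz, map_smul]
      have := hP.map_succ x hx.1 k
      rw [hx.2.2] at this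
      rw [this])
    (fun k => by
      rw [hz]
      have h2 : IsSelfAdjoint (x k) := congrFun hx.2.1 k
      exact IsSelfAdjoint.smul (by simp [IsSelfAdjoint]) h2)
    (fun k => by
      rw [hz, norm_smul, norm_inv, Complex.norm_real, Real.norm_eq_abs, abs_of_pos hC,
        inv_mul_le_iff₀ hC, mul_one]
      exact hn k)
  refine ⟨(C : ℂ) • y, hself.smul hy.1, ?_, ?_⟩
  · rw [Submodule.coe_smul, norm_smul, Complex.norm_real, Real.norm_eq_abs, abs_of_pos hC]
    nlinarith [hy.2]
  · funext k
    rw [map_smul, Pi.smul_apply, hyx, hz, smul_smul, mul_inv_cancel₀ hCC, one_smul]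

lemma exists_orbitMap_eq {x : ℕ → H →L[ℂ] H} (hx : x ∈ fixedSpace (boundedSequences M) P) :
    ∃ y : N, orbitMap α E y = x := by
  obtain ⟨C, hC⟩ := hx.1.2
  have hC' : ∀ k, ‖x k‖ ≤ |C| + 1 := fun k => (hC k).trans ((le_abs_self C).trans (by linarith))
  obtain ⟨a, -, -, ha⟩ := hl.exists_orbitMap_eq_of_mem_saFixed hφ hΦ hP
    (piRe_mem_saFixed hP.toIsPositiveProjection hx) (by positivity) (norm_piRe_le hC')
  obtain ⟨b, -, -, hb⟩ := hl.exists_orbitMap_eq_of_mem_saFixed hφ hΦ hP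
    (piIm_mem_saFixed hP.toIsPositiveProjection hx) (by positivity) (norm_piIm_le hC')
  exact ⟨a + Complex.I • b, by rw [map_add, map_smul, ha, hb, piRe_add_piIm]⟩

/-- Order is read off from norms. With `c ≥ ‖y‖`, the coordinates of `y - c` lie between `-c` and
`0`, so they have norm at most `c`. The preimage of norm at most `c` is `y - c` itself by
injectivity, whence `y ≥ 0`. -/
lemma nonneg_of_orbitMap_nonneg {y : N} (hy : 0 ≤ orbitMap α E y) : 0 ≤ (y : K →L[ℂ] K) := by
  have hsa : IsSelfAdjoint (y : K →L[ℂ] K) := by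
    have h1 : N.adj y = y := hl.orbitMap_injective (by
      rw [hl.orbitMap_adj]
      exact funext fun k => (IsSelfAdjoint.of_nonneg (hy k)).star_eq)
    exact congrArg Subtype.val h1
  let c : ℝ := ‖(y : K →L[ℂ] K)‖ + 1
  have hc : 0 < c := by positivity
  have hle : ‖(y : K →L[ℂ] K)‖ ≤ c := by simp [c]
  have hcs : IsSelfAdjoint ((c : ℂ) • (1 : H →L[ℂ] H)) := by
    simp [IsSelfAdjoint, star_smul]
  let w : N := y - (c : ℂ) • N.unit
  have hw : orbitMap α E w = orbitMap α E y - (c : ℂ) • (1 : ℕ → H →L[ℂ] H) := by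
    rw [map_sub, map_smul, hl.orbitMap_unit]
  have hwsa : IsSelfAdjoint (w : K →L[ℂ] K) := by
    refine hsa.sub ?_
    simp [IsSelfAdjoint, star_smul]
  have hmem : orbitMap α E w ∈ IsPositiveProjection.saFixed (boundedSequences M) P := by
    obtain ⟨h1, h2⟩ := mem_fixedSpace.1 (hl.orbitMap_mem hΦ hP w)
    refine ⟨h1, ?_, h2⟩
    rw [← hl.orbitMap_adj]
    exact congrArg _ (Subtype.ext hwsa)
  obtain ⟨v, -, hv, hvw⟩ := hl.exists_orbitMap_eq_of_mem_saFixed hφ hΦ hP hmem hc (fun k => by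
    have h1 : IsSelfAdjoint (orbitMap α E w k) := congrFun hmem.2.1 k
    rw [h1.norm_le_iff_mem_Icc hc.le, hw]
    have h2 := ((hl.isPositiveUnital_orbitMap k).map_Icc hsa hle).2
    have h3 : (0 : H →L[ℂ] H) ≤ (c : ℂ) • (1 : H →L[ℂ] H) := (hy k).trans h2
    constructor
    · have h4 : (0 : H →L[ℂ] H) ≤ orbitMap α E y k := hy k
      rw [← sub_nonneg]
      simpa using h4
    · have h4 : orbitMap α E y k - (c : ℂ) • (1 : H →L[ℂ] H) ≤ 0 := sub_nonpos.2 h2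
      exact h4.trans h3)
  have hvw' : v = w := hl.orbitMap_injective hvw
  rw [hvw', hwsa.norm_le_iff_mem_Icc hc.le] at hv
  have h1 := sub_nonneg.2 hv.1
  simpa [w] using h1

end

end IsAsymptoticLift

end Orbits

/-! ### The GNS construction for a family of positive functionals -/

section GelfandNaimarkSegal

open UniformSpace

variable (W : Type u) (I : Type u) [Ring W] [StarRing W] [Algebra ℂ W] [StarModule ℂ W]

/-- A family of positive functionals on a star-algebra for which left multiplications are
bounded. -/
structure PositiveFamily where
  toFun : I → W →ₗ[ℂ] ℂ
  map_star : ∀ i a, toFun i (star a) = starRingEnd ℂ (toFun i a)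
  re_nonneg : ∀ i a, 0 ≤ (toFun i (star a * a)).re
  bounded : ∀ a, ∃ C : ℝ, 0 ≤ C ∧ ∀ i b,
    (toFun i (star (a * b) * (a * b))).re ≤ C ^ 2 * (toFun i (star b * b)).re

variable {W I}

namespace PositiveFamily

variable (ω : PositiveFamily W I)

set_option linter.unusedVariables false in
/-- Finitely supported families in `W`, with the semi-inner product given by `ω`. -/
@[nolint unusedArguments]
def PreGNS (ω : PositiveFamily W I) : Type u := I →₀ W

instance : AddCommGroup ω.PreGNS := inferInstanceAs (AddCommGroup (I →₀ W))
instance : Module ℂ ω.PreGNS := inferInstanceAs (Module ℂ (I →₀ W))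

/-- The identity map onto the pre-Hilbert space. -/
def toPre : (I →₀ W) ≃ₗ[ℂ] ω.PreGNS := LinearEquiv.refl ℂ _

/-- The sesquilinear form. -/
def form (f g : I →₀ W) : ℂ := f.sum fun i a => ω.toFun i (star a * g i)

lemma form_eq_sum {f g : I →₀ W} {s : Finset I} (hs : f.support ⊆ s) :
    ω.form f g = ∑ i ∈ s, ω.toFun i (star (f i) * g i) :=
  Finsupp.sum_of_support_subset f hs _ fun i _ => by simp

lemma form_self_re (f : I →₀ W) :
    (ω.form f f).re = ∑ i ∈ f.support, (ω.toFun i (star (f i) * f i)).re := by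
  rw [ω.form_eq_sum subset_rfl, Complex.re_sum]

lemma form_star (f g : I →₀ W) : starRingEnd ℂ (ω.form g f) = ω.form f g := by
  classical
  rw [ω.form_eq_sum (Finset.subset_union_left (s₂ := f.support)),
    ω.form_eq_sum (Finset.subset_union_right (s₁ := g.support)), map_sum]
  refine Finset.sum_congr rfl fun i _ => ?_
  rw [← ω.map_star, star_mul, star_star]

lemma form_self_nonneg (f : I →₀ W) : 0 ≤ (ω.form f f).re := by
  rw [ω.form_self_re]
  exact Finset.sum_nonneg fun i _ => ω.re_nonneg i _

lemma form_add (f g h : I →₀ W) : ω.form (f + g) h = ω.form f h + ω.form g h := by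
  refine Finsupp.sum_add_index' (fun i => by simp) fun i a b => ?_
  rw [star_add, add_mul, map_add]

lemma form_smul (f g : I →₀ W) (c : ℂ) : ω.form (c • f) g = starRingEnd ℂ c * ω.form f g := by
  rw [ω.form_eq_sum (Finsupp.support_smul (b := c) (g := f)), ω.form_eq_sum subset_rfl,
    Finset.mul_sum]
  refine Finset.sum_congr rfl fun i _ => ?_
  rw [Finsupp.smul_apply, star_smul, smul_mul_assoc, map_smul, smul_eq_mul]
  rfl

/-- The semi-inner product. -/
abbrev preInnerProductSpace : PreInnerProductSpace.Core ℂ ω.PreGNS where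
  inner f g := ω.form (ω.toPre.symm f) (ω.toPre.symm g)
  conj_inner_symm _ _ := ω.form_star _ _
  re_inner_nonneg _ := ω.form_self_nonneg _
  add_left _ _ _ := ω.form_add _ _ _
  smul_left _ _ c := ω.form_smul _ _ c

instance : SeminormedAddCommGroup ω.PreGNS :=
  InnerProductSpace.Core.toSeminormedAddCommGroup (c := ω.preInnerProductSpace)

instance : InnerProductSpace ℂ ω.PreGNS := InnerProductSpace.ofCore ω.preInnerProductSpace

lemma inner_toPre (f g : I →₀ W) : inner ℂ (ω.toPre f) (ω.toPre g) = ω.form f g := rfl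

lemma norm_toPre_sq (f : I →₀ W) : ‖ω.toPre f‖ ^ 2 = (ω.form f f).re :=
  norm_sq_eq_re_inner (𝕜 := ℂ) (ω.toPre f)

/-- Left multiplication on finitely supported families. -/
def mulₗ (a : W) : (I →₀ W) →ₗ[ℂ] (I →₀ W) := Finsupp.mapRange.linearMap (LinearMap.mulLeft ℂ a)

@[simp] lemma mulₗ_apply (a : W) (f : I →₀ W) (i : I) : mulₗ a f i = a * f i := rfl

lemma norm_mulₗ_le {a : W} {C : ℝ} (hC : 0 ≤ C) (h : ∀ i b,
    (ω.toFun i (star (a * b) * (a * b))).re ≤ C ^ 2 * (ω.toFun i (star b * b)).re)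
    (f : I →₀ W) : ‖ω.toPre (mulₗ a f)‖ ≤ C * ‖ω.toPre f‖ := by
  rw [← sq_le_sq₀ (norm_nonneg _) (by positivity), mul_pow, ω.norm_toPre_sq, ω.norm_toPre_sq,
    ω.form_self_re f]
  have hs : (mulₗ a f).support ⊆ f.support := Finsupp.support_mapRange (hf := mul_zero _)
  rw [ω.form_eq_sum hs, Complex.re_sum, Finset.mul_sum]
  exact Finset.sum_le_sum fun i _ => h i _

lemma form_mulₗ (a : W) (f g : I →₀ W) : ω.form (mulₗ (star a) f) g = ω.form f (mulₗ a g) := by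
  have hs : (mulₗ (star a) f).support ⊆ f.support := Finsupp.support_mapRange (hf := mul_zero _)
  rw [ω.form_eq_sum hs, ω.form_eq_sum subset_rfl]
  refine Finset.sum_congr rfl fun i _ => ?_
  rw [mulₗ_apply, mulₗ_apply, star_mul, star_star, mul_assoc]

/-- Left multiplication as a bounded operator on the pre-Hilbert space. -/
def mulL (a : W) : ω.PreGNS →L[ℂ] ω.PreGNS :=
  (ω.toPre.toLinearMap ∘ₗ mulₗ a ∘ₗ ω.toPre.symm.toLinearMap).mkContinuous (ω.bounded a).choose
    fun f => ω.norm_mulₗ_le (ω.bounded a).choose_spec.1 (ω.bounded a).choose_spec.2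
      (ω.toPre.symm f)

lemma mulL_toPre (a : W) (f : I →₀ W) : ω.mulL a (ω.toPre f) = ω.toPre (mulₗ a f) := rfl

lemma mulL_ext {S T : ω.PreGNS →L[ℂ] ω.PreGNS} (h : ∀ f, S (ω.toPre f) = T (ω.toPre f)) : S = T :=
  ContinuousLinearMap.ext fun f => h (ω.toPre.symm f)

lemma mulL_one : ω.mulL 1 = 1 := ω.mulL_ext fun f => by
  rw [mulL_toPre, show mulₗ 1 f = f from Finsupp.ext fun i => by simp]
  rfl

lemma mulL_mul (a b : W) : ω.mulL (a * b) = ω.mulL a * ω.mulL b := ω.mulL_ext fun f => by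
  rw [ContinuousLinearMap.mul_def, ContinuousLinearMap.comp_apply, mulL_toPre, mulL_toPre,
    mulL_toPre, show mulₗ (a * b) f = mulₗ a (mulₗ b f) from Finsupp.ext fun i => by simp [mul_assoc]]

lemma mulL_add (a b : W) : ω.mulL (a + b) = ω.mulL a + ω.mulL b := ω.mulL_ext fun f => by
  rw [add_apply, mulL_toPre, mulL_toPre, mulL_toPre, ← map_add,
    show mulₗ (a + b) f = mulₗ a f + mulₗ b f from Finsupp.ext fun i => by simp [add_mul]]

lemma mulL_smul (c : ℂ) (a : W) : ω.mulL (c • a) = c • ω.mulL a := ω.mulL_ext fun f => by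
  rw [smul_apply, mulL_toPre, mulL_toPre, ← map_smul,
    show mulₗ (c • a) f = c • mulₗ a f from Finsupp.ext fun i => by simp]

lemma mulL_zero : ω.mulL 0 = 0 := ω.mulL_ext fun f => by
  rw [mulL_toPre, show mulₗ 0 f = 0 from Finsupp.ext fun i => by simp, map_zero]
  rfl

/-- The Hilbert space of the family. -/
abbrev GNS : Type u := Completion ω.PreGNS

lemma completion_ext {S T : ω.GNS →L[ℂ] ω.GNS} (h : ∀ f : ω.PreGNS, S f = T f) : S = T := by
  ext c
  induction c using Completion.induction_on with
  | hp => exact isClosed_eq S.continuous T.continuous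
  | ih f => exact h f

/-- The representation of `W` by left multiplications. -/
def rep : W →⋆ₐ[ℂ] (ω.GNS →L[ℂ] ω.GNS) where
  toFun a := (ω.mulL a).completion
  map_one' := ω.completion_ext fun f => by
    rw [ContinuousLinearMap.completion_apply_coe, mulL_one]; rfl
  map_mul' a b := ω.completion_ext fun f => by
    simp only [ContinuousLinearMap.mul_def, ContinuousLinearMap.comp_apply,
      ContinuousLinearMap.completion_apply_coe, mulL_mul]
  map_zero' := ω.completion_ext fun f => by
    rw [ContinuousLinearMap.completion_apply_coe, mulL_zero, zero_apply, zero_apply,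
      Completion.coe_zero]
  map_add' a b := ω.completion_ext fun f => by
    rw [add_apply]
    simp only [ContinuousLinearMap.completion_apply_coe, mulL_add, add_apply, Completion.coe_add]
  commutes' r := ω.completion_ext fun f => by
    rw [Algebra.algebraMap_eq_smul_one, Algebra.algebraMap_eq_smul_one, smul_apply]
    rw [ContinuousLinearMap.completion_apply_coe, mulL_smul, mulL_one, smul_apply,
      Completion.coe_smul]
    rfl
  map_star' a := by
    refine (ContinuousLinearMap.eq_adjoint_iff (ω.mulL (star a)).completion
      (ω.mulL a).completion).mpr ?_
    intro x y
    induction x, y using Completion.induction_on₂ with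
    | hp => apply isClosed_eq <;> fun_prop
    | ih x y =>
      rw [ContinuousLinearMap.completion_apply_coe, ContinuousLinearMap.completion_apply_coe,
        Completion.inner_coe, Completion.inner_coe]
      exact ω.form_mulₗ a (ω.toPre.symm x) (ω.toPre.symm y)

lemma rep_apply_coe (a : W) (f : I →₀ W) :
    ω.rep a (ω.toPre f : ω.GNS) = (ω.toPre (mulₗ a f) : ω.GNS) :=
  ContinuousLinearMap.completion_apply_coe _ _

lemma norm_rep_le {a : W} {C : ℝ} (hC : 0 ≤ C) (h : ∀ i b,
    (ω.toFun i (star (a * b) * (a * b))).re ≤ C ^ 2 * (ω.toFun i (star b * b)).re) :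
    ‖ω.rep a‖ ≤ C := by
  refine ContinuousLinearMap.opNorm_le_bound _ hC fun x => ?_
  induction x using Completion.induction_on with
  | hp => apply isClosed_le <;> fun_prop
  | ih f =>
    have h1 := ω.norm_mulₗ_le hC h (ω.toPre.symm f)
    have h2 := ω.rep_apply_coe a (ω.toPre.symm f)
    rw [LinearEquiv.apply_symm_apply] at h2 h1
    rw [h2, Completion.norm_coe, Completion.norm_coe]
    exact h1

/-- The cyclic vectors. -/
def cyclic (i : I) : ω.GNS := (ω.toPre (Finsupp.single i 1) : ω.GNS)

lemma rep_cyclic (a : W) (i : I) :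
    ω.rep a (ω.cyclic i) = (ω.toPre (Finsupp.single i a) : ω.GNS) := by
  rw [cyclic, rep_apply_coe]
  congr 2
  refine (Finsupp.mapRange_single (f := fun b => a * b) (hf := mul_zero a)).trans ?_
  rw [mul_one]

lemma inner_cyclic (a : W) (i : I) :
    inner ℂ (ω.cyclic i) (ω.rep a (ω.cyclic i)) = ω.toFun i a := by
  rw [rep_cyclic, cyclic, Completion.inner_coe, inner_toPre, form, Finsupp.sum_single_index]
  · simp
  · simp

lemma dense_span_cyclic {S : Set W} (hS : Submodule.span ℂ S = ⊤) :
    Dense (Submodule.span ℂ {v | ∃ i, ∃ a ∈ S, v = ω.rep a (ω.cyclic i)} : Set ω.GNS) := by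
  refine (Completion.denseRange_coe (α := ω.PreGNS)).mono ?_
  rintro _ ⟨f, rfl⟩
  let V := Submodule.span ℂ {v | ∃ i, ∃ a ∈ S, v = ω.rep a (ω.cyclic i)}
  let j : (I →₀ W) →ₗ[ℂ] ω.GNS := (Completion.toComplL (𝕜 := ℂ) (E := ω.PreGNS)).toLinearMap ∘ₗ
    ω.toPre.toLinearMap
  have hj : ∀ f : I →₀ W, j f ∈ V := fun f => by
    induction f using Finsupp.induction_linear with
    | zero => rw [map_zero]; exact V.zero_mem
    | add f g hf hg => rw [map_add]; exact V.add_mem hf hg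
    | single i a =>
      have ha : a ∈ Submodule.span ℂ S := hS ▸ Submodule.mem_top
      have : j (Finsupp.single i a) = (j ∘ₗ Finsupp.lsingle i) a := rfl
      rw [this]
      have hle : Submodule.span ℂ S ≤ V.comap (j ∘ₗ Finsupp.lsingle i) :=
        Submodule.span_le.2 fun b hb => Submodule.subset_span ⟨i, b, hb, (ω.rep_cyclic b i).symm⟩
      exact hle ha
  exact hj (ω.toPre.symm f)

/-- The Gelfand-Naimark-Segal representation for a family of positive functionals. -/
theorem exists_rep (ω : PositiveFamily W I) : ∃ (L : Type u) (_ : NormedAddCommGroup L)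
    (_ : InnerProductSpace ℂ L) (_ : CompleteSpace L) (π : W →⋆ₐ[ℂ] (L →L[ℂ] L)) (ξ : I → L),
    (∀ a i, inner ℂ (ξ i) (π a (ξ i)) = ω.toFun i a) ∧
    (∀ (a : W) (C : ℝ), 0 ≤ C → (∀ i b, (ω.toFun i (star (a * b) * (a * b))).re ≤
      C ^ 2 * (ω.toFun i (star b * b)).re) → ‖π a‖ ≤ C) ∧
    ∀ S : Set W, Submodule.span ℂ S = ⊤ →
      Dense (Submodule.span ℂ {v | ∃ i, ∃ a ∈ S, v = π a (ξ i)} : Set L) :=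
  ⟨ω.GNS, inferInstance, inferInstance, inferInstance, ω.rep, ω.cyclic, ω.inner_cyclic,
    fun _ _ hC h => ω.norm_rep_le hC h, fun _ hS => ω.dense_span_cyclic hS⟩

end PositiveFamily

end GelfandNaimarkSegal

/-! ### The Jordan representation of the fixed points -/

section FixedAlgebra

open scoped ComplexOrder

variable {H : Type u} [NormedAddCommGroup H] [InnerProductSpace ℂ H] [CompleteSpace H]
variable {ι : Type} {R : StarSubalgebra ℂ (ι → H →L[ℂ] H)}
variable {P : (ι → H →L[ℂ] H) →ₗ[ℂ] (ι → H →L[ℂ] H)}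

open IsPositiveProjection

variable (R P) in
/-- The star-algebra generated by the fixed points. -/
def fixedAlgebra : StarSubalgebra ℂ (ι → H →L[ℂ] H) := StarAlgebra.adjoin ℂ (saFixed R P)

lemma fixedAlgebra_le : fixedAlgebra R P ≤ R := StarAlgebra.adjoin_le fun _ hs => hs.1

/-- The generators are self-adjoint, so adjoining adjoints adds nothing and the algebra is spanned
by words. -/
lemma fixedAlgebra_eq_span : (fixedAlgebra R P).toSubalgebra.toSubmodule =
    Submodule.span ℂ (words R P : Set (ι → H →L[ℂ] H)) := by
  have h : star (saFixed R P) = saFixed R P := by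
    ext x
    constructor
    · intro hx
      have hx' : star x ∈ saFixed R P := hx
      have h2 : star x = x := by rw [← hx'.2.1, star_star]
      rwa [h2] at hx'
    · intro hx
      show star x ∈ saFixed R P
      rwa [hx.2.1]
  rw [fixedAlgebra, StarAlgebra.adjoin_toSubalgebra, h, Set.union_self, Algebra.adjoin_eq_span]
  rfl

lemma words_subset_fixedAlgebra {a : ι → H →L[ℂ] H} (ha : a ∈ words R P) :
    a ∈ fixedAlgebra R P := by
  have h : a ∈ (fixedAlgebra R P).toSubalgebra.toSubmodule := by
    rw [fixedAlgebra_eq_span]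
    exact Submodule.subset_span ha
  exact h

lemma fixedSpace_le_fixedAlgebra (hP : IsPositiveProjection R P) {x : ι → H →L[ℂ] H}
    (hx : x ∈ fixedSpace R P) : x ∈ fixedAlgebra R P := by
  rw [← piRe_add_piIm x]
  exact add_mem (StarAlgebra.subset_adjoin ℂ _ (piRe_mem_saFixed hP hx))
    ((fixedAlgebra R P).smul_mem (StarAlgebra.subset_adjoin ℂ _ (piIm_mem_saFixed hP hx)) _)

lemma Pi.star_mul_mul_self_le {a b : ι → H →L[ℂ] H} {C : ℝ} (ha : ∀ k, ‖a k‖ ≤ C) :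
    star (a * b) * (a * b) ≤ ((C ^ 2 : ℝ) : ℂ) • (star b * b) := by
  have h1 : 0 ≤ ((C ^ 2 : ℝ) : ℂ) • (1 : ι → H →L[ℂ] H) - star a * a := fun k => by
    have h2 : IsSelfAdjoint (star (a k) * a k) := IsSelfAdjoint.star_mul_self _
    have h3 : ‖star (a k) * a k‖ ≤ C ^ 2 := by
      rw [CStarRing.norm_star_mul_self, sq]
      exact mul_le_mul (ha k) (ha k) (norm_nonneg _) ((norm_nonneg _).trans (ha k))
    exact sub_nonneg.2 ((h2.norm_le_iff_mem_Icc (sq_nonneg C)).1 h3).2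
  have h2 := Pi.star_mul_mul_nonneg h1 b
  rw [← sub_nonneg]
  convert h2 using 1
  simp only [mul_sub, sub_mul, star_mul, mul_smul_comm, smul_mul_assoc, mul_one, mul_assoc]

namespace IsPositiveProjection

/-- The values of the vector functionals of the coordinates of `P`. -/
def vectorFunctional (P : (ι → H →L[ℂ] H) →ₗ[ℂ] (ι → H →L[ℂ] H)) (i : ι × H) :
    (ι → H →L[ℂ] H) →ₗ[ℂ] ℂ :=
  (innerSL ℂ i.2).toLinearMap ∘ₗ (ContinuousLinearMap.apply ℂ H i.2).toLinearMap ∘ₗ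
    LinearMap.proj i.1 ∘ₗ P

lemma vectorFunctional_apply (P : (ι → H →L[ℂ] H) →ₗ[ℂ] (ι → H →L[ℂ] H)) (i : ι × H)
    (x : ι → H →L[ℂ] H) : vectorFunctional P i x = inner ℂ i.2 (P x i.1 i.2) := rfl

lemma vectorFunctional_re_nonneg (hP : IsPositiveProjection R P) (i : ι × H) {x : ι → H →L[ℂ] H}
    (hx : x ∈ R) (h0 : 0 ≤ x) : 0 ≤ (vectorFunctional P i x).re :=
  (Complex.le_def.1 (ContinuousLinearMap.nonneg_iff_inner.1 (hP.map_nonneg _ hx h0 i.1) i.2)).1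

lemma vectorFunctional_mul_le (hP : IsPositiveProjection R P) (i : ι × H) {a b : ι → H →L[ℂ] H}
    (ha : a ∈ R) (hb : b ∈ R) {C : ℝ} (hC : ∀ k, ‖a k‖ ≤ C) :
    (vectorFunctional P i (star (a * b) * (a * b))).re ≤
      C ^ 2 * (vectorFunctional P i (star b * b)).re := by
  have h1 := hP.vectorFunctional_re_nonneg i
    (sub_mem (R.smul_mem (mul_mem (star_mem hb) hb) ((C ^ 2 : ℝ) : ℂ))
      (mul_mem (star_mem (mul_mem ha hb)) (mul_mem ha hb)))
    (sub_nonneg.2 (Pi.star_mul_mul_self_le (b := b) hC))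
  rw [map_sub, map_smul, smul_eq_mul, Complex.sub_re, Complex.re_ofReal_mul] at h1
  exact sub_nonneg.1 h1

/-- The vector functionals as a family of positive functionals on the star-algebra generated by
the fixed points. -/
def positiveFamily (hP : IsPositiveProjection R P) :
    PositiveFamily (fixedAlgebra R P) (ι × H) where
  toFun i := vectorFunctional P i ∘ₗ (fixedAlgebra R P).toSubalgebra.toSubmodule.subtype
  map_star i a := by
    have h1 : P (star (a : ι → H →L[ℂ] H)) i.1 = ContinuousLinearMap.adjoint (P a i.1) :=
      congrFun (hP.map_star (fixedAlgebra_le a.2)) i.1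
    show inner ℂ i.2 (P (star (a : ι → H →L[ℂ] H)) i.1 i.2) =
      starRingEnd ℂ (inner ℂ i.2 (P a i.1 i.2))
    rw [h1, inner_conj_symm, ContinuousLinearMap.adjoint_inner_right]
  re_nonneg i a := hP.vectorFunctional_re_nonneg i
    (mul_mem (star_mem (fixedAlgebra_le a.2)) (fixedAlgebra_le a.2)) (Pi.star_mul_self_nonneg _)
  bounded a := by
    obtain ⟨C, hC⟩ := hP.bounded a (fixedAlgebra_le a.2)
    exact ⟨|C|, abs_nonneg C, fun i b => hP.vectorFunctional_mul_le i (fixedAlgebra_le a.2)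
      (fixedAlgebra_le b.2) fun k => (hC k).trans (le_abs_self C)⟩

/-- The inclusion of the fixed points into the star-algebra that they generate. -/
def fixedInclusion (hP : IsPositiveProjection R P) : fixedSpace R P →ₗ[ℂ] fixedAlgebra R P where
  toFun x := ⟨x, fixedSpace_le_fixedAlgebra hP x.2⟩
  map_add' _ _ := rfl
  map_smul' _ _ := rfl

lemma saFixed_le {s : ι → H →L[ℂ] H} (hs : s ∈ saFixed R P) : s ∈ fixedSpace R P := ⟨hs.1, hs.2.2⟩

lemma map_mem_fixedSpace (hP : IsPositiveProjection R P) {x : ι → H →L[ℂ] H} (hx : x ∈ R) :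
    P x ∈ fixedSpace R P := ⟨hP.map_mem x hx, hP.idem x hx⟩

variable {L : Type*} [NormedAddCommGroup L] [InnerProductSpace ℂ L] [CompleteSpace L]

variable (R P) in
/-- A representation of the space of fixed points as operators that turns the product `P(xy)` into
the product of operators for `x = y`, with a total family of vectors whose vector functionals are
compressions of the coordinates. -/
structure IsJordanRep (ρ : fixedSpace R P →ₗ[ℂ] (L →L[ℂ] L)) (v : words R P × ι × H → L) :
    Prop where
  norm_le : ∀ (x : fixedSpace R P) (C : ℝ), 0 ≤ C → (∀ k, ‖(x : ι → H →L[ℂ] H) k‖ ≤ C) → ‖ρ x‖ ≤ C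
  map_star : ∀ x y : fixedSpace R P, (y : ι → H →L[ℂ] H) = star (x : ι → H →L[ℂ] H) →
    ρ y = star (ρ x)
  map_one : ∀ x : fixedSpace R P, (x : ι → H →L[ℂ] H) = 1 → ρ x = 1
  map_mul_self : ∀ s y : fixedSpace R P, (s : ι → H →L[ℂ] H) ∈ saFixed R P →
    (y : ι → H →L[ℂ] H) = P (s * s) → ρ y = ρ s * ρ s
  inner_apply : ∀ (p : words R P × ι × H) (x : fixedSpace R P), inner ℂ (v p) (ρ x (v p)) =
    vectorFunctional P p.2 (star (p.1 : ι → H →L[ℂ] H) * x * p.1)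
  dense : Dense (Submodule.span ℂ (Set.range v) : Set L)

/-- The GNS representation of the generated star-algebra, restricted to the fixed points.
Restricting to this algebra matters: the defects act as zero on words, which are total there. -/
theorem exists_isJordanRep (hP : IsPositiveProjection R P) : ∃ (L : Type u)
    (_ : NormedAddCommGroup L) (_ : InnerProductSpace ℂ L) (_ : CompleteSpace L)
    (ρ : fixedSpace R P →ₗ[ℂ] (L →L[ℂ] L)) (v : words R P × ι × H → L), IsJordanRep R P ρ v := by
  obtain ⟨L, _, _, _, π, ξ, hin, hnorm, hdense⟩ := hP.positiveFamily.exists_rep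
  obtain ⟨ρ, hπ⟩ : ∃ ρ : fixedSpace R P →ₗ[ℂ] (L →L[ℂ] L), ∀ x, ρ x = π (hP.fixedInclusion x) :=
    ⟨π.toAlgHom.toLinearMap ∘ₗ hP.fixedInclusion, fun _ => rfl⟩
  refine ⟨L, inferInstance, inferInstance, inferInstance, ρ,
    fun p => π ⟨p.1, words_subset_fixedAlgebra p.1.2⟩ (ξ p.2), ?_⟩
  have hω : ∀ i a, hP.positiveFamily.toFun i a = vectorFunctional P i a := fun _ _ => rfl
  have hnorm' : ∀ (a : fixedAlgebra R P) (C : ℝ), 0 ≤ C → (∀ i, ∀ b ∈ fixedAlgebra R P,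
      (vectorFunctional P i (star (a * b) * (a * b))).re ≤
        C ^ 2 * (vectorFunctional P i (star b * b)).re) → ‖π a‖ ≤ C :=
    fun a C hC h => hnorm a C hC fun i b => h i b b.2
  clear hnorm
  simp only [hω] at hin
  constructor
  · intro x C hC h
    rw [hπ]
    exact hnorm' _ C hC fun i b hb =>
      hP.vectorFunctional_mul_le i x.2.1 (fixedAlgebra_le hb) h
  · intro x y h
    rw [hπ, hπ, ← StarHomClass.map_star]
    exact congrArg _ (Subtype.ext h)
  · intro x h
    rw [hπ, ← _root_.map_one π]
    exact congrArg _ (Subtype.ext h)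
  · intro s y hs hy
    rw [hπ, hπ, ← _root_.map_mul, ← sub_eq_zero, ← map_sub]
    -- The norm estimate is used with `C = 0`: all functionals vanish on `(e b)* (e b)` for the
    -- defect `e`, hence `e` is represented by zero.
    refine norm_le_zero_iff.1 (hnorm' _ 0 le_rfl fun i b hb => le_of_eq ?_)
    have hb' : b ∈ Submodule.span ℂ (words R P : Set (ι → H →L[ℂ] H)) := by
      rw [← fixedAlgebra_eq_span]
      exact hb
    have he : P ((s : ι → H →L[ℂ] H) * s) - s * s ∈ R :=
      sub_mem (hP.map_mem _ (mul_mem hs.1 hs.1)) (mul_mem hs.1 hs.1)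
    have h1 := hP.map_star_mul_defect_mul_eq_zero hs (mul_mem he (fixedAlgebra_le hb)) hb'
    have h2 : ((hP.fixedInclusion y - hP.fixedInclusion s * hP.fixedInclusion s :
        fixedAlgebra R P) : ι → H →L[ℂ] H) = P (s * s) - s * s := by rw [← hy]; rfl
    rw [h2, vectorFunctional_apply, h1]
    simp
  · intro p x
    rw [hπ, ← ContinuousLinearMap.adjoint_inner_right, ← ContinuousLinearMap.star_eq_adjoint,
      ← StarHomClass.map_star, ← ContinuousLinearMap.comp_apply, ← ContinuousLinearMap.comp_apply,
      ← ContinuousLinearMap.mul_def, ← ContinuousLinearMap.mul_def,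
      ← _root_.map_mul, ← _root_.map_mul, hin]
    rfl
  · have hS : Submodule.span ℂ {a : fixedAlgebra R P | (a : ι → H →L[ℂ] H) ∈ words R P} = ⊤ := by
      refine Submodule.map_injective_of_injective
        (f := (fixedAlgebra R P).toSubalgebra.toSubmodule.subtype) Subtype.val_injective ?_
      rw [Submodule.map_span, Submodule.map_top, Submodule.range_subtype]
      refine Eq.trans (congrArg (Submodule.span ℂ) ?_) fixedAlgebra_eq_span.symm
      ext x
      constructor
      · rintro ⟨a, ha, rfl⟩
        exact ha
      · intro hx
        exact ⟨⟨x, words_subset_fixedAlgebra hx⟩, hx, rfl⟩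
    refine (hdense _ hS).mono (Submodule.span_mono ?_)
    rintro _ ⟨i, a, ha, rfl⟩
    exact ⟨(⟨a, ha⟩, i), rfl⟩

lemma IsJordanRep.map_jordan {ρ : fixedSpace R P →ₗ[ℂ] (L →L[ℂ] L)} {v : words R P × ι × H → L}
    (hρ : IsJordanRep R P ρ v) (hP : IsPositiveProjection R P)
    {s t y : fixedSpace R P} (hs : (s : ι → H →L[ℂ] H) ∈ saFixed R P)
    (ht : (t : ι → H →L[ℂ] H) ∈ saFixed R P) (hy : (y : ι → H →L[ℂ] H) = jordanMap P s t) :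
    ρ y = ρ s * ρ t + ρ t * ρ s := by
  have hst : ((s + t : fixedSpace R P) : ι → H →L[ℂ] H) ∈ saFixed R P := by
    refine ⟨add_mem hs.1 ht.1, ?_, ?_⟩
    · rw [Submodule.coe_add, star_add, hs.2.1, ht.2.1]
    · rw [Submodule.coe_add, map_add, hs.2.2, ht.2.2]
  let a : fixedSpace R P := ⟨_, hP.map_mem_fixedSpace (mul_mem hs.1 hs.1)⟩
  let b : fixedSpace R P := ⟨_, hP.map_mem_fixedSpace (mul_mem ht.1 ht.1)⟩
  have h1 := hρ.map_mul_self _ a hs rfl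
  have h2 := hρ.map_mul_self _ b ht rfl
  have h3 := hρ.map_mul_self _ (a + y + b) hst (by
    rw [Submodule.coe_add, Submodule.coe_add, Submodule.coe_add, hy, jordanMap_apply]
    simp only [a, b, add_mul, mul_add, map_add]
    abel)
  rw [map_add, map_add, map_add, h1, h2] at h3
  have h4 : ρ y = (ρ s + ρ t) * (ρ s + ρ t) - ρ s * ρ s - ρ t * ρ t := by
    rw [← h3]; abel
  rw [h4, add_mul, mul_add, mul_add]
  abel

end IsPositiveProjection

end FixedAlgebra

/-! ### Closedness of convergence conditions -/

section WeakContinuity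

/-- For eventually equi-Lipschitz maps, convergence to zero survives closure, so it can be checked
on a dense set. -/
lemma isClosed_setOf_tendsto_zero {κ E F : Type*} [SeminormedAddCommGroup E]
    [SeminormedAddCommGroup F] {g : κ → E → F} {l : Filter κ} {B : ℝ}
    (hg : ∀ᶠ j in l, ∀ x y, ‖g j x - g j y‖ ≤ B * ‖x - y‖) :
    IsClosed {x | Tendsto (fun j => g j x) l (𝓝 0)} := by
  refine isClosed_of_closure_subset fun x hx => ?_
  rw [Set.mem_ofPred_eq, NormedAddGroup.tendsto_nhds_zero]
  intro ε hε
  obtain ⟨y, hy, hxy⟩ := Metric.mem_closure_iff.1 hx (ε / (2 * (|B| + 1))) (by positivity)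
  filter_upwards [hg, NormedAddGroup.tendsto_nhds_zero.1 hy (ε / 2) (by positivity)] with
    j h1 h2
  have h3 : B * ‖x - y‖ ≤ ε / 2 := by
    rw [dist_eq_norm] at hxy
    calc B * ‖x - y‖ ≤ (|B| + 1) * (ε / (2 * (|B| + 1))) :=
          mul_le_mul (by linarith [le_abs_self B]) hxy.le (norm_nonneg _) (by positivity)
      _ = ε / 2 := by field_simp
  have h4 : g j x = (g j x - g j y) + g j y := by abel
  rw [h4]
  exact (norm_add_le _ _).trans_lt (by linarith [h1 x y])

end WeakContinuity

/-! ### Normality of the Jordan representation -/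

section JordanRepNormal

open IsPositiveProjection

variable {H : Type u} [NormedAddCommGroup H] [InnerProductSpace ℂ H] [CompleteSpace H]
variable {L : Type*} [NormedAddCommGroup L] [InnerProductSpace ℂ L] [CompleteSpace L]

/-- A bounded family of vectors in the range of a real subspace tends weakly to zero (for the real
inner product) if it does so on that subspace. -/
lemma tendsto_re_inner_zero {κ : Type*} {l : Filter κ} {z : κ → L} {D : ℝ}
    (hz : ∀ᶠ j in l, ‖z j‖ ≤ D) (V : Submodule ℝ L) (hzV : ∀ j, z j ∈ V)
    (h : ∀ x ∈ V, Tendsto (fun j => (inner ℂ x (z j) : ℂ).re) l (𝓝 0)) (u : L) :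
    Tendsto (fun j => (inner ℂ u (z j) : ℂ).re) l (𝓝 0) := by
  let _ : InnerProductSpace ℝ L := InnerProductSpace.rclikeToReal ℂ L
  have hcl : IsClosed {x : L | Tendsto (fun j => (inner ℂ x (z j) : ℂ).re) l (𝓝 0)} := by
    refine isClosed_setOf_tendsto_zero (B := D) ?_
    filter_upwards [hz] with j hj x y
    rw [← Complex.sub_re, ← inner_sub_left]
    refine ((Complex.abs_re_le_norm _).trans (norm_inner_le_norm _ _)).trans ?_
    rw [mul_comm]
    exact mul_le_mul_of_nonneg_right hj (norm_nonneg _)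
  let V' := V.topologicalClosure
  have : CompleteSpace V' := V.isClosed_topologicalClosure.completeSpace_coe
  -- The component `q` is orthogonal, for the real inner product, to every `z j`; the component `p`
  -- is a limit of vectors in `V`.
  obtain ⟨p, hp, q, hq, rfl⟩ := V'.exists_add_mem_mem_orthogonal u
  have h1 : Tendsto (fun j => (inner ℂ p (z j) : ℂ).re) l (𝓝 0) :=
    hcl.closure_subset_iff.2 (fun x hx => h x hx) hp
  have h2 : ∀ j, (inner ℂ q (z j) : ℂ).re = 0 := fun j =>
    (V'.mem_orthogonal' q).1 hq (z j) (V.le_topologicalClosure (hzV j))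
  simp only [inner_add_left, Complex.add_re, h2, add_zero]
  exact h1

namespace IsPositiveProjection.IsJordanRep

variable {M : VonNeumannAlgebra H} {φ : M.toDualOperatorSystem →ₗ[ℂ] M.toDualOperatorSystem}
variable {Φ : (H →L[ℂ] H) →ₗ[ℂ] (H →L[ℂ] H)} {P : (ℕ → H →L[ℂ] H) →ₗ[ℂ] (ℕ → H →L[ℂ] H)}
variable {ρ : fixedSpace (boundedSequences M) P →ₗ[ℂ] (L →L[ℂ] L)}
variable {v : words (boundedSequences M) P × ℕ × H → L}
variable (hφ : IsUPMap φ) (hΦ : ∀ x : M.toDualOperatorSystem, Φ x = φ x)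
variable (hP : IsLimitProjection M Φ P) (hρ : IsJordanRep (boundedSequences M) P ρ v)

include hφ hΦ hP hρ

/-- For a self-adjoint fixed point `t`, the real part of `⟪ρ t v, ρ y v⟫` is half of `⟪v, ρ (P (ty +
yt)) v⟫`, which is a word compression of a Jordan multiple of `y` and tends to zero by normality of
both. The vectors `ρ y v` themselves lie in the real space of all `ρ t v`, so testing against that
space suffices. Totality of the vectors `v` finishes the argument. -/
lemma wtendsto_zero_of_saFixed {κ : Type*} {l : Filter κ}
    {y : κ → fixedSpace (boundedSequences M) P}
    (hy : ∀ j, (y j : ℕ → H →L[ℂ] H) ∈ saFixed (boundedSequences M) P) {C : ℝ} (hC0 : 0 ≤ C)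
    (hC : ∀ᶠ j in l, ∀ k, ‖(y j : ℕ → H →L[ℂ] H) k‖ ≤ C)
    (hlim : ∀ k, WTendsto l (fun j => (y j : ℕ → H →L[ℂ] H) k) 0) :
    WTendsto l (fun j => ρ (y j)) 0 := by
  have hP' := hP.toIsPositiveProjection
  have hn : ∀ᶠ j in l, ‖ρ (y j)‖ ≤ C := hC.mono fun j hj => hρ.norm_le _ C hC0 hj
  have hsa : ∀ s : fixedSpace (boundedSequences M) P,
      (s : ℕ → H →L[ℂ] H) ∈ saFixed (boundedSequences M) P → star (ρ s) = ρ s := fun s hs =>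
    (hρ.map_star s s hs.2.1.symm).symm
  have hinner : ∀ p, ∀ t : fixedSpace (boundedSequences M) P,
      (t : ℕ → H →L[ℂ] H) ∈ saFixed (boundedSequences M) P →
      Tendsto (fun j => (inner ℂ (ρ t (v p)) (ρ (y j) (v p)) : ℂ).re) l (𝓝 0) := by
    intro p t ht
    let b : κ → fixedSpace (boundedSequences M) P := fun j =>
      ⟨jordanMap P t (y j), (hP.fixedNormal_jordanMap hφ hΦ ht).map_mem _ (y j).2⟩
    have hb : ∀ j, ρ (b j) = ρ t * ρ (y j) + ρ (y j) * ρ t := fun j =>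
      hρ.map_jordan hP' ht (hy j) rfl
    have h1 : ∀ j, (inner ℂ (ρ t (v p)) (ρ (y j) (v p)) : ℂ).re =
        2⁻¹ * (vectorFunctional P p.2
          (star (p.1 : ℕ → H →L[ℂ] H) * (b j : ℕ → H →L[ℂ] H) * p.1)).re := by
      intro j
      rw [← hρ.inner_apply p (b j), hb, add_apply, inner_add_right, Complex.add_re,
        ContinuousLinearMap.mul_def, ContinuousLinearMap.mul_def, ContinuousLinearMap.comp_apply,
        ContinuousLinearMap.comp_apply]
      have e1 : inner ℂ (v p) (ρ t (ρ (y j) (v p))) = inner ℂ (ρ t (v p)) (ρ (y j) (v p)) := by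
        rw [← ContinuousLinearMap.adjoint_inner_left, ← ContinuousLinearMap.star_eq_adjoint,
          hsa t ht]
      have e2 : inner ℂ (v p) (ρ (y j) (ρ t (v p))) = inner ℂ (ρ (y j) (v p)) (ρ t (v p)) := by
        rw [← ContinuousLinearMap.adjoint_inner_left, ← ContinuousLinearMap.star_eq_adjoint,
          hsa _ (hy j)]
      rw [e1, e2, ← inner_conj_symm, Complex.conj_re]
      ring
    have h2 := ((hP.fixedNormal_word hφ hΦ p.1.2).comp
      (hP.fixedNormal_jordanMap hφ hΦ ht)).wtendsto (l.map fun j => (y j : ℕ → H →L[ℂ] H)) 0 C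
      (Submodule.zero_mem _) (hC.mono fun j hj => ⟨(y j).2, hj⟩) (fun k => hlim k) p.2.1
    have h3 : Tendsto (fun j => vectorFunctional P p.2
        (star (p.1 : ℕ → H →L[ℂ] H) * (b j : ℕ → H →L[ℂ] H) * p.1)) l (𝓝 0) := by
      have h4 := tendsto_map'_iff.1 (h2 p.2.2 p.2.2)
      rw [map_zero] at h4
      simpa [Function.comp_def, vectorFunctional_apply, mul_assoc, b] using h4
    simp only [h1]
    simpa using ((Complex.continuous_re.tendsto _).comp h3).const_mul 2⁻¹
  have hre : ∀ p u, Tendsto (fun j => (inner ℂ u (ρ (y j) (v p)) : ℂ).re) l (𝓝 0) := by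
    intro p u
    -- Only a real subspace, since `t` ranges over self-adjoint elements. The imaginary part of the
    -- coefficient is recovered afterwards by testing against `i u`.
    let V : Submodule ℝ L :=
      { carrier := {x | ∃ t : fixedSpace (boundedSequences M) P,
          (t : ℕ → H →L[ℂ] H) ∈ saFixed (boundedSequences M) P ∧ ρ t (v p) = x}
        zero_mem' := ⟨0, ⟨zero_mem _, star_zero _, map_zero _⟩, by simp⟩
        add_mem' := by
          rintro _ _ ⟨s, hs, rfl⟩ ⟨t, ht, rfl⟩
          refine ⟨s + t, ⟨add_mem hs.1 ht.1, ?_, ?_⟩, by simp⟩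
          · rw [Submodule.coe_add, star_add, hs.2.1, ht.2.1]
          · rw [Submodule.coe_add, map_add, hs.2.2, ht.2.2]
        smul_mem' := by
          rintro c _ ⟨s, hs, rfl⟩
          refine ⟨(c : ℂ) • s, ⟨(boundedSequences M).smul_mem hs.1 _, ?_, ?_⟩, by simp⟩
          · rw [Submodule.coe_smul, star_smul, hs.2.1]; simp
          · rw [Submodule.coe_smul, map_smul, hs.2.2] }
    refine tendsto_re_inner_zero (D := C * ‖v p‖) ?_ V (fun j => ⟨y j, hy j, rfl⟩) ?_ u
    · filter_upwards [hn] with j hj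
      exact ((ρ (y j)).le_opNorm _).trans (mul_le_mul_of_nonneg_right hj (norm_nonneg _))
    · rintro _ ⟨t, ht, rfl⟩
      exact hinner p t ht
  have hcomplex : ∀ p u, Tendsto (fun j => (inner ℂ u (ρ (y j) (v p)) : ℂ)) l (𝓝 0) := by
    intro p u
    have h1 := (Complex.continuous_ofReal.tendsto _).comp (hre p u)
    have h2 := (Complex.continuous_ofReal.tendsto _).comp (hre p (Complex.I • u))
    have h3 := h1.add (h2.mul_const Complex.I)
    simp only [Complex.ofReal_zero, zero_mul, add_zero] at h3
    refine h3.congr fun j => ?_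
    rw [Function.comp_apply, Function.comp_apply, inner_smul_left]
    apply Complex.ext <;> simp
  intro u η
  rw [zero_apply, inner_zero_right]
  have hcl : IsClosed {x : L | Tendsto (fun j => (inner ℂ u (ρ (y j) x) : ℂ)) l (𝓝 0)} := by
    refine isClosed_setOf_tendsto_zero (B := ‖u‖ * C) ?_
    filter_upwards [hn] with j hj x z
    rw [← inner_sub_right, ← map_sub, mul_assoc]
    exact (norm_inner_le_norm _ _).trans (mul_le_mul_of_nonneg_left
      (((ρ (y j)).le_opNorm _).trans (mul_le_mul_of_nonneg_right hj (norm_nonneg _)))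
      (norm_nonneg _))
  let V : Submodule ℂ L :=
    { carrier := {x : L | Tendsto (fun j => (inner ℂ u (ρ (y j) x) : ℂ)) l (𝓝 0)}
      zero_mem' := by simpa using tendsto_const_nhds
      add_mem' := fun {a b} ha hb => by
        simpa [inner_add_right] using Tendsto.add ha hb
      smul_mem' := fun c a ha => by
        simpa [inner_smul_right] using Tendsto.const_mul c ha }
  have hV : Submodule.span ℂ (Set.range v) ≤ V := Submodule.span_le.2 (by
    rintro _ ⟨p, rfl⟩
    exact hcomplex p u)
  exact hcl.closure_subset_iff.2 hV (hρ.dense η)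

/-- The representation of the fixed points is continuous on balls for the weak operator
topology. -/
lemma wtendsto {κ : Type*} {l : Filter κ} {y : κ → fixedSpace (boundedSequences M) P}
    {a : fixedSpace (boundedSequences M) P} {C : ℝ}
    (hC : ∀ᶠ j in l, ∀ k, ‖(y j : ℕ → H →L[ℂ] H) k‖ ≤ C)
    (hlim : ∀ k, WTendsto l (fun j => (y j : ℕ → H →L[ℂ] H) k) ((a : ℕ → H →L[ℂ] H) k)) :
    WTendsto l (fun j => ρ (y j)) (ρ a) := by
  have hP' := hP.toIsPositiveProjection
  obtain ⟨D, hD⟩ := a.2.1.2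
  have hd : ∀ j, ((y j - a : fixedSpace (boundedSequences M) P) : ℕ → H →L[ℂ] H) ∈
    fixedSpace (boundedSequences M) P := fun j => (y j - a).2
  have hCD : ∀ᶠ j in l, ∀ k,
      ‖((y j - a : fixedSpace (boundedSequences M) P) : ℕ → H →L[ℂ] H) k‖ ≤ |C + D| := by
    filter_upwards [hC] with j hj k
    exact ((norm_sub_le _ _).trans (add_le_add (hj k) (hD k))).trans (le_abs_self _)
  have hlim0 : ∀ k, WTendsto l
      (fun j => ((y j - a : fixedSpace (boundedSequences M) P) : ℕ → H →L[ℂ] H) k) 0 := fun k => by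
    simpa using (hlim k).sub (WTendsto.const ((a : ℕ → H →L[ℂ] H) k))
  let re : κ → fixedSpace (boundedSequences M) P := fun j =>
    ⟨_, saFixed_le (piRe_mem_saFixed hP' (hd j))⟩
  let im : κ → fixedSpace (boundedSequences M) P := fun j =>
    ⟨_, saFixed_le (piIm_mem_saFixed hP' (hd j))⟩
  have h1 := hρ.wtendsto_zero_of_saFixed hφ hΦ hP (y := re)
    (fun j => piRe_mem_saFixed hP' (hd j)) (abs_nonneg (C + D))
    (hCD.mono fun j hj => norm_piRe_le hj) (fun k => wtendsto_piRe_zero (hlim0 k))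
  have h2 := hρ.wtendsto_zero_of_saFixed hφ hΦ hP (y := im)
    (fun j => piIm_mem_saFixed hP' (hd j)) (abs_nonneg (C + D))
    (hCD.mono fun j hj => norm_piIm_le hj) (fun k => wtendsto_piIm_zero (hlim0 k))
  have h3 : ∀ j, ρ (y j) = ρ a + (ρ (re j) + Complex.I • ρ (im j)) := fun j => by
    rw [← map_smul, ← map_add, ← map_add]
    congr 1
    apply Subtype.ext
    have := piRe_add_piIm ((y j - a : fixedSpace (boundedSequences M) P) : ℕ → H →L[ℂ] H)
    rw [Submodule.coe_add, Submodule.coe_add, Submodule.coe_smul]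
    simp only [re, im]
    rw [this]
    simp
  simp only [h3]
  simpa using (WTendsto.const (ρ a)).add (h1.add (h2.smul Complex.I))

end IsPositiveProjection.IsJordanRep

end JordanRepNormal

/-! ### From the representation to a JW*-algebra -/

section JordanEmbedding

variable {H : Type u} [NormedAddCommGroup H] [InnerProductSpace ℂ H] [CompleteSpace H]
variable {K : Type v} [NormedAddCommGroup K] [InnerProductSpace ℂ K] [CompleteSpace K]
variable {L : Type w} [NormedAddCommGroup L] [InnerProductSpace ℂ L] [CompleteSpace L]

/-- A unital order embedding of a dual operator system that respects weak limits of bounded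
families and whose range is closed under squares of self-adjoint elements. -/
structure IsJordanEmbedding {N : DualOperatorSystem K} (θ : N →ₗ[ℂ] (L →L[ℂ] L)) : Prop
    extends N.IsPositiveUnital θ where
  nonneg_of_map : ∀ y : N, 0 ≤ θ y → 0 ≤ (y : K →L[ℂ] K)
  exists_mul_self : ∀ y : N, IsSelfAdjoint (y : K →L[ℂ] K) → ∃ z, θ z = θ y * θ y
  wtendsto : ∀ (𝒰 : Ultrafilter N) (a : N) (C : ℝ), (∀ᶠ y : N in 𝒰, ‖(y : K →L[ℂ] K)‖ ≤ C) →
    WTendsto 𝒰 (fun y : N => (y : K →L[ℂ] K)) a → WTendsto 𝒰 (fun y => θ y) (θ a)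

/-- An asymptotic lift embeds, as an ordered space, into the operators on a Hilbert space with
range closed under squares. -/
theorem IsAsymptoticLift.exists_isJordanEmbedding {M : VonNeumannAlgebra H}
    {φ : M.toDualOperatorSystem →ₗ[ℂ] M.toDualOperatorSystem} {N : DualOperatorSystem K}
    {α : N ≃ₗ[ℂ] N} {E : N →ₗ[ℂ] M.toDualOperatorSystem} (hφ : IsUPMap φ)
    (hl : IsAsymptoticLift φ α E) : ∃ (L : Type u) (_ : NormedAddCommGroup L)
      (_ : InnerProductSpace ℂ L) (_ : CompleteSpace L) (θ : N →ₗ[ℂ] (L →L[ℂ] L)),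
      IsJordanEmbedding θ := by
  obtain ⟨Φ, hΦ⟩ := exists_linear_extension M.toDualOperatorSystem φ
  obtain ⟨P, hP⟩ := exists_isLimitProjection M hφ hΦ
  have hP' := hP.toIsPositiveProjection
  obtain ⟨L, _, _, _, ρ, v, hρ⟩ := hP'.exists_isJordanRep
  let j : N →ₗ[ℂ] fixedSpace (boundedSequences M) P :=
    (orbitMap α E).codRestrict _ (hl.orbitMap_mem hΦ hP)
  have hj : ∀ y, (j y : ℕ → H →L[ℂ] H) = orbitMap α E y := fun _ => rfl
  have hsa : ∀ y : N, IsSelfAdjoint (y : K →L[ℂ] K) →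
      (j y : ℕ → H →L[ℂ] H) ∈ IsPositiveProjection.saFixed (boundedSequences M) P := fun y hy => by
    refine ⟨(j y).2.1, ?_, (j y).2.2⟩
    rw [hj, ← hl.orbitMap_adj]
    exact congrArg _ (Subtype.ext hy)
  have hnorm : ∀ y : N, IsSelfAdjoint (y : K →L[ℂ] K) → ‖ρ (j y)‖ ≤ ‖(y : K →L[ℂ] K)‖ :=
    fun y hy => hρ.norm_le _ _ (norm_nonneg _) fun k =>
      (hl.isPositiveUnital_orbitMap k).norm_le_of_isSelfAdjoint hy
  have hunit : ρ (j N.unit) = 1 := hρ.map_one _ hl.orbitMap_unit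
  have hstar : ∀ y : N, IsSelfAdjoint (y : K →L[ℂ] K) → IsSelfAdjoint (ρ (j y)) := fun y hy =>
    (hρ.map_star _ _ (hsa y hy).2.1.symm).symm
  refine ⟨L, inferInstance, inferInstance, inferInstance, ρ ∘ₗ j, ⟨hunit, ?_⟩, ?_, ?_, ?_⟩
  · intro y hy
    have hys := IsSelfAdjoint.of_nonneg hy
    let c : ℝ := ‖(y : K →L[ℂ] K)‖
    have hc : 0 ≤ c := norm_nonneg _
    -- A unital map that contracts self-adjoint elements and preserves self-adjointness is positive:
    -- `0 ≤ y ≤ c` gives `‖c - y‖ ≤ c`, so the image of `c - y` is at most `c`.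
    let z : N := (c : ℂ) • N.unit - y
    have hcs : ((c : ℂ) • (1 : K →L[ℂ] K)) = ((z + y : N) : K →L[ℂ] K) := by
      simp [z]
    have hzs : IsSelfAdjoint (z : K →L[ℂ] K) := by
      refine IsSelfAdjoint.sub ?_ hys
      simp [IsSelfAdjoint, star_smul]
    have hzn : ‖(z : K →L[ℂ] K)‖ ≤ c := by
      have h1 := ((hys.norm_le_iff_mem_Icc hc).1 le_rfl).2
      have h2 : (0 : K →L[ℂ] K) ≤ (z : K →L[ℂ] K) := sub_nonneg.2 h1
      have h3 : (z : K →L[ℂ] K) ≤ (c : ℂ) • (1 : K →L[ℂ] K) := sub_le_self _ hy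
      refine (hzs.norm_le_iff_mem_Icc hc).2 ⟨?_, h3⟩
      exact (neg_nonpos.2 (hy.trans h1)).trans h2
    have h1 := (((hstar z hzs).norm_le_iff_mem_Icc hc).1 ((hnorm z hzs).trans hzn)).2
    have h2 : ρ (j y) = (c : ℂ) • (1 : L →L[ℂ] L) - ρ (j z) := by
      rw [← hunit, ← map_smul, ← map_smul, ← map_sub, ← map_sub]
      simp [z]
    show 0 ≤ ρ (j y)
    rw [h2]
    exact sub_nonneg.2 h1
  · intro y hy
    refine hl.nonneg_of_orbitMap_nonneg hφ hΦ hP fun k => ?_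
    open scoped ComplexOrder in
    rw [Pi.zero_apply, ContinuousLinearMap.nonneg_iff_inner]
    intro h
    -- The empty word gives the vectors whose functionals are the uncompressed coordinates `⟪h, xₖ
    -- h⟫`.
    have h1 := ContinuousLinearMap.nonneg_iff_inner.1 hy (v (1, k, h))
    rw [LinearMap.comp_apply, hρ.inner_apply] at h1
    simp only [OneMemClass.coe_one, star_one, one_mul, mul_one,
      IsPositiveProjection.vectorFunctional_apply] at h1
    rw [(mem_fixedSpace.1 (j y).2).2] at h1
    exact h1
  · intro y hy
    have h1 := hP'.map_mem_fixedSpace (mul_mem (hsa y hy).1 (hsa y hy).1)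
    obtain ⟨z, hz⟩ := hl.exists_orbitMap_eq hφ hΦ hP h1
    exact ⟨z, hρ.map_mul_self _ _ (hsa y hy) hz⟩
  · intro 𝒰 a C hC ha
    refine hρ.wtendsto hφ hΦ hP (C := 2 * C) ?_ fun k => hl.wtendsto_orbitMap hC ha k
    filter_upwards [hC] with y hy k
    exact (hl.norm_orbitMap_le y k).trans (mul_le_mul_of_nonneg_left hy zero_le_two)

namespace IsJordanEmbedding

variable {N : DualOperatorSystem K} {θ : N →ₗ[ℂ] (L →L[ℂ] L)} (hθ : IsJordanEmbedding θ)

include hθ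

lemma le_norm_map_of_isSelfAdjoint {y : N} (hy : IsSelfAdjoint (y : K →L[ℂ] K)) :
    ‖(y : K →L[ℂ] K)‖ ≤ ‖θ y‖ := by
  let c : ℝ := ‖θ y‖
  obtain ⟨h1, h2⟩ := ((hθ.isSelfAdjoint hy).norm_le_iff_mem_Icc (norm_nonneg _)).1 le_rfl
  refine (hy.norm_le_iff_mem_Icc (norm_nonneg _)).2 ⟨?_, ?_⟩
  · have h3 := hθ.nonneg_of_map (y + (c : ℂ) • N.unit) (by
      rw [map_add, map_smul, hθ.map_unit, ← sub_neg_eq_add]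
      exact sub_nonneg.2 h1)
    rw [← sub_nonneg, sub_neg_eq_add]
    exact h3
  · have h3 := hθ.nonneg_of_map ((c : ℂ) • N.unit - y) (by
      rw [map_sub, map_smul, hθ.map_unit]
      exact sub_nonneg.2 h2)
    exact sub_nonneg.1 h3

lemma norm_le_two_mul (y : N) : ‖(y : K →L[ℂ] K)‖ ≤ 2 * ‖θ y‖ := by
  have hre : ‖θ (N.rePart y)‖ ≤ ‖θ y‖ := by
    rw [DualOperatorSystem.rePart, map_smul, map_add, hθ.map_adj, norm_smul]
    have := norm_add_le (θ y) (star (θ y))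
    rw [norm_star] at this
    norm_num
    linarith
  have him : ‖θ (N.imPart y)‖ ≤ ‖θ y‖ := by
    rw [DualOperatorSystem.imPart, map_smul, map_sub, hθ.map_adj, norm_smul]
    have := norm_sub_le (θ y) (star (θ y))
    rw [norm_star] at this
    norm_num
    linarith
  have h1 := hθ.le_norm_map_of_isSelfAdjoint (N.rePart_isSelfAdjoint y)
  have h2 := hθ.le_norm_map_of_isSelfAdjoint (N.imPart_isSelfAdjoint y)
  have h3 : (y : K →L[ℂ] K) = N.rePart y + Complex.I • (N.imPart y : K →L[ℂ] K) :=
    congrArg Subtype.val (N.rePart_add_imPart y).symm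
  rw [h3]
  refine (norm_add_le _ _).trans ?_
  rw [norm_smul, Complex.norm_I, one_mul]
  linarith

lemma injective : Function.Injective θ := (injective_iff_map_eq_zero _).2 fun y hy => by
  have := hθ.norm_le_two_mul y
  rw [hy, norm_zero, mul_zero] at this
  exact Subtype.ext (norm_le_zero_iff.1 this)

/-- Bounded weakly convergent families of images converge to the image of a weak limit. -/
lemma exists_wtendsto {ι : Type*} {𝒰 : Ultrafilter ι} {y : ι → N} {C : ℝ}
    (hy : ∀ᶠ i in 𝒰, ‖θ (y i)‖ ≤ C) {a : L →L[ℂ] L} (ha : WTendsto 𝒰 (fun i => θ (y i)) a) :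
    ∃ b : N, WTendsto 𝒰 (fun i => (y i : K →L[ℂ] K)) b ∧ θ b = a := by
  have hy' : ∀ᶠ i in 𝒰, ‖(y i : K →L[ℂ] K)‖ ≤ 2 * C := hy.mono fun i hi =>
    (hθ.norm_le_two_mul _).trans (mul_le_mul_of_nonneg_left hi zero_le_two)
  obtain ⟨b, hb, -⟩ := N.exists_wtendsto 𝒰 hy'
  refine ⟨b, hb, ?_⟩
  have h1 := hθ.wtendsto (𝒰.map y) b (2 * C) hy' fun ξ η => hb ξ η
  exact WTendsto.unique (l := (𝒰 : Filter ι)) (fun ξ η => h1 ξ η) ha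

lemma jordan_mem_range {x y : L →L[ℂ] L} (hx : x ∈ LinearMap.range θ)
    (hy : y ∈ LinearMap.range θ) : x * y + y * x ∈ LinearMap.range θ := by
  have hsa : ∀ a b : N, IsSelfAdjoint (a : K →L[ℂ] K) → IsSelfAdjoint (b : K →L[ℂ] K) →
      θ a * θ b + θ b * θ a ∈ LinearMap.range θ := by
    intro a b ha hb
    obtain ⟨p, hp⟩ := hθ.exists_mul_self a ha
    obtain ⟨q, hq⟩ := hθ.exists_mul_self b hb
    obtain ⟨r, hr⟩ := hθ.exists_mul_self (a + b) (ha.add hb)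
    refine ⟨r - p - q, ?_⟩
    rw [map_sub, map_sub, hp, hq, hr, map_add, add_mul, mul_add, mul_add]
    abel
  obtain ⟨a, rfl⟩ := hx
  obtain ⟨b, rfl⟩ := hy
  rw [← N.rePart_add_imPart a, ← N.rePart_add_imPart b]
  have h := add_mem (add_mem
      (hsa _ _ (N.rePart_isSelfAdjoint a) (N.rePart_isSelfAdjoint b))
      ((LinearMap.range θ).smul_mem Complex.I
        (hsa _ _ (N.rePart_isSelfAdjoint a) (N.imPart_isSelfAdjoint b))))
    (add_mem ((LinearMap.range θ).smul_mem Complex.I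
        (hsa _ _ (N.imPart_isSelfAdjoint a) (N.rePart_isSelfAdjoint b)))
      ((LinearMap.range θ).smul_mem (Complex.I * Complex.I)
        (hsa _ _ (N.imPart_isSelfAdjoint a) (N.imPart_isSelfAdjoint b))))
  convert h using 1
  simp only [map_add, map_smul, add_mul, mul_add, smul_mul_assoc, mul_smul_comm, smul_add,
    smul_smul]
  abel

omit hθ in
/-- The range of a Jordan embedding, as a JW*-algebra. -/
def range (hθ : IsJordanEmbedding θ) : JWStarAlgebra L where
  toSubmodule := LinearMap.range θ
  one_mem' := ⟨N.unit, hθ.map_unit⟩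
  star_mem' := by
    rintro _ ⟨y, rfl⟩
    exact ⟨N.adj y, hθ.map_adj y⟩
  isClosed' := by
    -- By Krein-Smulian only bounded families matter. Their preimages are bounded because `‖y‖ ≤ 2
    -- ‖θ y‖`, hence have a weak limit in `N`, which `θ` maps to the given limit.
    refine isClosed_ultraweak_of_bounded _ fun 𝒰 a C h𝒰 ha => ?_
    let g : (L →L[ℂ] L) → N := Function.invFun θ
    have hg : ∀ᶠ x in (𝒰 : Filter (L →L[ℂ] L)), θ (g x) = x := h𝒰.mono fun x hx =>
      Function.invFun_eq hx.1
    obtain ⟨b, -, hb⟩ := hθ.exists_wtendsto (𝒰 := 𝒰) (y := g) (C := C) (a := a)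
      (by filter_upwards [hg, h𝒰] with x h1 h2; rw [h1]; exact h2.2)
      (ha.congr' (hg.mono fun x hx => hx.symm))
    exact ⟨b, hb⟩
  jordan_mem' := fun x hx y hy => Submodule.smul_mem _ _ (hθ.jordan_mem_range hx hy)

/-- A Jordan embedding is an isomorphism of dual operator systems onto its range. -/
theorem exists_isUPIso : ∃ Θ : N ≃ₗ[ℂ] hθ.range,
    IsUPIso (N := hθ.range.toDualOperatorSystem) Θ := by
  let Θ : N ≃ₗ[ℂ] hθ.range := LinearEquiv.ofInjective θ hθ.injective
  have hΘ : ∀ y, (Θ y : L →L[ℂ] L) = θ y := fun _ => rfl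
  have hΘs : ∀ x : hθ.range, θ (Θ.symm x) = x := fun x => by
    rw [← hΘ, Θ.apply_symm_apply]
  refine ⟨Θ, ⟨Subtype.ext hθ.map_unit, fun y hy => hθ.map_nonneg y hy, ?_⟩,
    ⟨?_, fun x hx => hθ.nonneg_of_map _ (by rw [LinearEquiv.coe_coe, hΘs]; exact hx), ?_⟩⟩
  · exact DualOperatorSystem.continuous_weakStar_of_wtendsto
      (N := hθ.range.toDualOperatorSystem) (Θ : N →ₗ[ℂ] hθ.range) 2
      (fun y => hθ.norm_le y) fun ξ η 𝒰 a C hC ha => hθ.wtendsto 𝒰 a C hC ha ξ η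
  · refine Θ.injective (Subtype.ext ?_)
    rw [LinearEquiv.coe_coe, Θ.apply_symm_apply]
    exact hθ.map_unit.symm
  · refine DualOperatorSystem.continuous_weakStar_of_wtendsto
      (M := hθ.range.toDualOperatorSystem) (Θ.symm : hθ.range →ₗ[ℂ] N) 2 (fun x => ?_)
      fun ξ η 𝒰 a C hC ha => ?_
    · have := hθ.norm_le_two_mul (Θ.symm x)
      rwa [hΘs] at this
    · obtain ⟨b, hb, hba⟩ := hθ.exists_wtendsto (𝒰 := 𝒰) (y := fun x => Θ.symm x) (C := C)
        (a := (a : L →L[ℂ] L)) (by simpa only [hΘs] using hC) (by simpa only [hΘs] using ha)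
      have hab : b = Θ.symm a := hθ.injective (by rw [hba, hΘs])
      rw [hab] at hb
      exact hb ξ η

end IsJordanEmbedding

lemma IsUPIso.isUnitalOrderIso {M : DualOperatorSystem H} {N : DualOperatorSystem K}
    {f : M ≃ₗ[ℂ] N} (hf : IsUPIso f) : IsUnitalOrderIso f where
  map_unit := hf.isUPMap.map_unit
  nonneg_iff := fun x => ⟨fun h => by
    have := hf.isUPMap_symm.map_nonneg (f x) h
    rwa [LinearEquiv.coe_coe, f.symm_apply_apply] at this, hf.isUPMap.map_nonneg x⟩

lemma IsUnitalOrderIso.trans {M : DualOperatorSystem H} {N : DualOperatorSystem K}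
    {A : DualOperatorSystem L} {f : M ≃ₗ[ℂ] N} {g : N ≃ₗ[ℂ] A} (hf : IsUnitalOrderIso f)
    (hg : IsUnitalOrderIso g) : IsUnitalOrderIso (f.trans g) where
  map_unit := by rw [LinearEquiv.trans_apply, hf.map_unit, hg.map_unit]
  nonneg_iff := fun x => by rw [LinearEquiv.trans_apply, hg.nonneg_iff, hf.nonneg_iff]

end JordanEmbedding

end

theorem theorem2p5
    {H : Type u} [NormedAddCommGroup H] [InnerProductSpace ℂ H] [CompleteSpace H]
    {K : Type v} [NormedAddCommGroup K] [InnerProductSpace ℂ K] [CompleteSpace K]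
    (M : VonNeumannAlgebra H)
    (φ : M.toDualOperatorSystem →ₗ[ℂ] M.toDualOperatorSystem) (hφ : IsUPMap φ)
    (N : DualOperatorSystem K) (α : N ≃ₗ[ℂ] N) (E : N →ₗ[ℂ] M.toDualOperatorSystem)
    (hlift : IsAsymptoticLift φ α E) :
    ∃ (L : Type u) (_ : NormedAddCommGroup L) (_ : InnerProductSpace ℂ L) (_ : CompleteSpace L)
      (A : JWStarAlgebra L) (θ : N ≃ₗ[ℂ] A),
      -- `N` is order isomorphic (as a dual operator system) to the JW*-algebra `A`
      IsUPIso (N := A.toDualOperatorSystem) θ ∧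
      -- under this isomorphism `α` is a Jordan automorphism
      IsJordanIso (A := A) (B := A) ((θ.symm.trans α).trans θ) ∧
      -- `A` is unique: any order isomorphism of `N` onto a JW*-algebra `B` differs from `θ`
      -- by a Jordan isomorphism of `A` onto `B`
      ∀ (L' : Type w) [NormedAddCommGroup L'] [InnerProductSpace ℂ L'] [CompleteSpace L']
        (B : JWStarAlgebra L') (θ' : N ≃ₗ[ℂ] B),
        IsUnitalOrderIso (N := B.toDualOperatorSystem) θ' →
          IsJordanIso (A := A) (B := B) (θ.symm.trans θ') := by
  obtain ⟨L, _, _, _, θ₀, hθ₀⟩ := hlift.exists_isJordanEmbedding hφ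
  obtain ⟨θ, hθ⟩ := hθ₀.exists_isUPIso
  -- Both remaining claims concern unital order isomorphisms between JW*-algebras, which are
  -- automatically Jordan isomorphisms.
  have hord := hθ.isUnitalOrderIso
  refine ⟨L, inferInstance, inferInstance, inferInstance, hθ₀.range, θ, hθ, ?_, ?_⟩
  · exact IsUnitalOrderIso.isJordanIso (A := hθ₀.range) (B := hθ₀.range)
      ((hord.symm.trans hlift.isUPIso.isUnitalOrderIso).trans hord)
  · intro L' _ _ _ B θ' hθ'
    exact IsUnitalOrderIso.isJordanIso (A := hθ₀.range) (B := B) (hord.symm.trans hθ')
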